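/- Let $\widetilde\Omega\subset\mathbb R^2$ be a bounded domain with Lipschitz boundary, $\Omega:=\widetilde\Omega\times(0,1)\subset\mathbb R^3$, $Y:=(-\tfrac12,\tfrac12)^3$. Let $\alpha_1>0$, $\beta_1\in\mathbb R$, and let $\varepsilon_n,r_n>0$, $\alpha_{2,n}>0$, $\beta_{2,n}\in\mathbb R$ ($n\in\mathbb N$) be sequences such that $\varepsilon_n\to0$, $r_n\to0$ and, with $\omega_n:=\{y\in Y:\ y_1^2+y_2^2\le r_n^2\}$ and $|\omega_n|$ its Lebesgue measure, $$\varepsilon_n^2|\ln r_n|\to0,\qquad |\omega_n|\,\alpha_{2,n}\to\alpha_2>0,\qquad |\omega_n|\,\beta_{2,n}\to\beta_2\in\mathbb R .$$ Let $\Omega_n:=\Omega\cap\bigcup_{\nu\in\mathbb Z^3}\varepsilon_n(\omega_n+\nu)$ and, for $h=(h_1,h_2,h_3)\in\mathbb R^3$, let $$\mathscr E(h):=\begin{pmatrix}0&-h_3&h_2\\ h_3&0&-h_1\\ -h_2&h_1&0\end{pmatrix},\qquad \sigma_n(h):=\begin{cases}\alpha_1I_3+\beta_1\mathscr E(h)&\text{in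 }\Omega\setminus\Omega_n,\\ \alpha_{2,n}I_3+\beta_{2,n}\mathscr E(h)&\text{in }\Omega_n.\end{cases}$$ Then there exists a subsequence of $n$, still denoted by $n$, such that for every $f\in H^{-1}(\Omega)$ and every $h\in\mathbb R^3$ the (unique) solution $u_n\in H^1_0(\Omega)$ of $$-\operatorname{div}(\sigma_n(h)\nabla u_n)=f\ \text{ in }\Omega,\qquad u_n=0\ \text{ on }\partial\Omega,$$ converges weakly in $H^1_0(\Omega)$ to the (unique) solution $u\in H^1_0(\Omega)$ of $$-\operatorname{div}(\sigma_*(h)\nabla u)=f\ \text{ in }\Omega,\qquad u=0\ \text{ on }\partial\Omega,$$ where $$\sigma_*(h)=\alpha_1I_3+\left(\frac{\alpha_2^3+\alpha_2\beta_2^2|h|^2}{\alpha_2^2+\beta_2^2h_3^2}\right)e_3\otimes e_3+\beta_1\mathscr E(h).$$ -/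

import Mathlib

open MeasureTheory Filter Topology
open scoped ContDiff

noncomputable section

namespace HallFibers

/-- The physical space `ℝ³` with its Euclidean structure and Lebesgue measure. -/
abbrev E3 : Type := EuclideanSpace ℝ (Fin 3)

/-- The plane `ℝ²`. -/
abbrev E2 : Type := EuclideanSpace ℝ (Fin 2)

/-! ### Domains -/

/-- `U ⊆ ℝ²` has a Lipschitz boundary: near every boundary point, in suitable orthonormal
coordinates `y = L x`, the set `U` is the set of points lying strictly above the graph of a
Lipschitz function. -/
def HasLipschitzBoundary (U : Set E2) : Prop :=
  ∀ p ∈ frontier U, ∃ (L : E2 ≃ₗᵢ[ℝ] E2) (K : NNReal) (g : ℝ → ℝ) (ρ : ℝ),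
    LipschitzWith K g ∧ 0 < ρ ∧
      ∀ x ∈ Metric.ball p ρ, x ∈ U ↔ g ((L x) 0) < (L x) 1

/-- The cylinder `U × (0,1)` of `ℝ³` over `U ⊆ ℝ²`. -/
def cylinder (U : Set E2) : Set E3 :=
  {x | (!₂[x 0, x 1] : E2) ∈ U ∧ x 2 ∈ Set.Ioo (0 : ℝ) 1}

/-! ### The fibered microstructure -/

/-- The open unit cube `Y = (-1/2, 1/2)³`. -/
def unitCell : Set E3 := {y | ∀ i, y i ∈ Set.Ioo (-(1 / 2) : ℝ) (1 / 2)}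

/-- The fiber `ω` of radius `r` in the unit cell, parallel to the third axis. -/
def cellFiber (r : ℝ) : Set E3 := {y | y ∈ unitCell ∧ (y 0) ^ 2 + (y 1) ^ 2 ≤ r ^ 2}

/-- The part in `Ω` of the `ε`-periodic lattice of fibers:
`Ω ∩ ⋃_{ν ∈ ℤ³} ε (ω + ν)`. -/
def fibers (Ω : Set E3) (ε r : ℝ) : Set E3 :=
  Ω ∩ ⋃ ν : Fin 3 → ℤ,
    (fun y : E3 => ε • (y + WithLp.toLp 2 (fun i => (ν i : ℝ)))) '' cellFiber r

/-! ### Conductivities -/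

/-- The antisymmetric matrix `𝓔(h)`, i.e. the matrix of `x ↦ h × x`. -/
def hall (h : E3) : Matrix (Fin 3) (Fin 3) ℝ :=
  !![0, -h 2, h 1;
     h 2, 0, -h 0;
     -h 1, h 0, 0]

open Classical in
/-- The two-phase conductivity: `α₁ I₃ + β₁ 𝓔(h)` outside the fibers and
`α₂ I₃ + β₂ 𝓔(h)` in the fibers. -/
def conductivity (Ω : Set E3) (ε r α₁ β₁ α₂ β₂ : ℝ) (h : E3) (x : E3) :
    Matrix (Fin 3) (Fin 3) ℝ :=
  if x ∈ fibers Ω ε r then α₂ • (1 : Matrix (Fin 3) (Fin 3) ℝ) + β₂ • hall h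
  else α₁ • (1 : Matrix (Fin 3) (Fin 3) ℝ) + β₁ • hall h

/-- The homogenized conductivity
`α₁ I₃ + ((α₂³ + α₂ β₂² |h|²) / (α₂² + β₂² h₃²)) e₃ ⊗ e₃ + β₁ 𝓔(h)`. -/
def homogenized (α₁ β₁ α₂ β₂ : ℝ) (h : E3) : Matrix (Fin 3) (Fin 3) ℝ :=
  α₁ • (1 : Matrix (Fin 3) (Fin 3) ℝ)
    + ((α₂ ^ 3 + α₂ * β₂ ^ 2 * ‖h‖ ^ 2) / (α₂ ^ 2 + β₂ ^ 2 * (h 2) ^ 2)) •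
        Matrix.vecMulVec (Pi.single 2 1) (Pi.single 2 1)
    + β₁ • hall h

/-! ### The space `H¹₀(Ω)` and weak solutions -/

/-- Test functions: smooth functions with compact support contained in `Ω`. -/
def IsTestFunction (Ω : Set E3) (φ : E3 → ℝ) : Prop :=
  ContDiff ℝ ∞ φ ∧ HasCompactSupport φ ∧ tsupport φ ⊆ Ω

/-- The Hilbert space `L²(Ω) × L²(Ω)³`, with norm `(‖u‖² + ‖g‖²)^{1/2}`. -/
abbrev L2Pair (Ω : Set E3) : Type :=
  WithLp 2 (Lp ℝ 2 (volume.restrict Ω) × Lp E3 2 (volume.restrict Ω))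

/-- The pairs `(φ, ∇φ)` for test functions `φ` on `Ω`. -/
def testPairs (Ω : Set E3) : Submodule ℝ (L2Pair Ω) where
  carrier := {w | ∃ φ : E3 → ℝ, IsTestFunction Ω φ ∧
    w.fst =ᵐ[volume.restrict Ω] φ ∧ w.snd =ᵐ[volume.restrict Ω] gradient φ}
  zero_mem' := by
    refine ⟨0, ⟨contDiff_const, HasCompactSupport.zero, ?_⟩, ?_, ?_⟩
    · simp
    · exact Lp.coeFn_zero _ _ _
    · have h0 : gradient (0 : E3 → ℝ) = 0 := by
        funext x
        exact gradient_const x 0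
      rw [h0]
      exact Lp.coeFn_zero _ _ _
  add_mem' := by
    rintro v w ⟨φ, ⟨hφ, hφc, hφs⟩, hv1, hv2⟩ ⟨ψ, ⟨hψ, hψc, hψs⟩, hw1, hw2⟩
    refine ⟨φ + ψ, ⟨hφ.add hψ, hφc.add hψc,
      (tsupport_add φ ψ).trans (Set.union_subset hφs hψs)⟩, ?_, ?_⟩
    · exact (Lp.coeFn_add v.fst w.fst).trans (hv1.add hw1)
    · have hg : gradient (φ + ψ) = gradient φ + gradient ψ := by
        funext x
        have h1 : DifferentiableAt ℝ φ x := hφ.differentiable (by simp) x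
        have h2 : DifferentiableAt ℝ ψ x := hψ.differentiable (by simp) x
        simp [gradient, fderiv_add h1 h2]
      rw [hg]
      exact (Lp.coeFn_add v.snd w.snd).trans (hv2.add hw2)
  smul_mem' := by
    rintro c w ⟨φ, ⟨hφ, hφc, hφs⟩, hw1, hw2⟩
    refine ⟨c • φ, ⟨hφ.const_smul c, hφc.smul_left (f := fun _ => c),
      (tsupport_smul_subset_right (fun _ => c) φ).trans hφs⟩, ?_, ?_⟩
    · exact (Lp.coeFn_smul c w.fst).trans (hw1.const_smul c)
    · have hg : gradient (c • φ) = c • gradient φ := by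
        funext x
        have h1 : DifferentiableAt ℝ φ x := hφ.differentiable (by simp) x
        simp [gradient, fderiv_const_smul h1 c]
      rw [hg]
      exact (Lp.coeFn_smul c w.snd).trans (hw2.const_smul c)

/-- The Sobolev space `H¹₀(Ω)`, the closure of the test functions for the norm
`(‖u‖² + ‖∇u‖²)^{1/2}` of `H¹(Ω)`. Its elements are recorded as pairs `(u, ∇u)` of a function
and its weak gradient (integration by parts passes to the limit, so that the second component
of an element of the closure is the weak gradient of the first one and is determined by it). -/
def H10 (Ω : Set E3) : Submodule ℝ (L2Pair Ω) := (testPairs Ω).topologicalClosure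

/-- The weak gradient of an element of `H¹₀(Ω)`. -/
def weakGrad {Ω : Set E3} (u : H10 Ω) : Lp E3 2 (volume.restrict Ω) := (u : L2Pair Ω).snd

/-- `H⁻¹(Ω)`, the topological dual of `H¹₀(Ω)`. -/
abbrev HNeg1 (Ω : Set E3) : Type := StrongDual ℝ (H10 Ω)

/-- `u ∈ H¹₀(Ω)` is the weak solution of `-div (A ∇u) = f` in `Ω`, `u = 0` on `∂Ω`:
`∫_Ω A ∇u · ∇v dx = ⟨f, v⟩` for all `v ∈ H¹₀(Ω)`. -/
def IsSolution (Ω : Set E3) (A : E3 → Matrix (Fin 3) (Fin 3) ℝ) (f : HNeg1 Ω) (u : H10 Ω) :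
    Prop :=
  ∀ v : H10 Ω,
    ∫ x in Ω, inner ℝ (Matrix.toEuclideanLin (A x) (weakGrad u x)) (weakGrad v x) = f v

end HallFibers

end

/-! The proof is the method of oscillating test functions, in a quantitative form that needs no
compactness.

Let `B` be the bilinear form of the homogenized problem. It is coercive, so by Lax–Milgram every
continuous functional on `H10 Ω` is `B · v` for some `v`; weak convergence of `u n` to the
homogenized solution therefore means `B (u n) v → f v` for all `v`. Because `u n` is bounded, it is
enough to take `v` a test function `φ` (`tendsto_toWeakSpace_of_form`). Boundedness is the energy
estimate: the Hall part is antisymmetric and does not enter the energy, and the fiber conductivity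
eventually exceeds `α₁`, since its product with a volume tending to zero has a positive limit. The
whole sequence converges, so the subsequence can be the identity.

To compare `B (u n) φ` with `f φ`, the equation of `u n` is tested with `φ + w n`, where `w n` is of
order `ε + r` in `H10 Ω` (`exists_oscillating_test`). Inside the fibers the gradient of `φ + w n` is
close to the vertical derivative of `φ` times a fixed direction `(s₀, s₁, 1)`. The slopes are chosen
so that the transposed fiber conductivity sends this direction to a vertical vector `c e₃`
(`phaseT_fiberSlope`); this cancellation of the horizontal flux produces the nonlinear vertical
coefficient of the limit. Since `c` is homogeneous of degree one in the two fiber parameters and the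
slopes are homogeneous of degree zero, multiplication by the volume fraction gives convergent
quantities.

The flux in the fibers then acts like `π r² c` times the normalized density of the rods, paired with
the vertical derivatives of `φ` and `u n`. It remains to replace this density by `1`. The density
does not depend on the vertical variable, so the vertical derivative can be moved away from `u n`
(`exists_abs_integral_rodDensity_le`), and the question becomes the size of density minus one in the
dual of `H¹`. Thin rods are compared with rods of relative radius `1/4` by radial fields whose
divergences are the normalized indicators of discs; the difference costs `ε √(1 + log (R / r))`, the
logarithm being the energy of `1/|y|` in a planar annulus. Thick rods are compared with `1` by
averaging over translations in a period, at cost `ε`. Hence the hypothesis `ε² |ln r| → 0` is what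
makes the error vanish. -/

noncomputable section

namespace HallFibers

/-! ### Test functions -/

variable {Ω : Set E3}

theorem IsTestFunction.continuous {φ : E3 → ℝ} (hφ : IsTestFunction Ω φ) : Continuous φ :=
  hφ.1.continuous

theorem IsTestFunction.differentiable {φ : E3 → ℝ} (hφ : IsTestFunction Ω φ) :
    Differentiable ℝ φ := hφ.1.differentiable (by simp)

theorem continuous_gradient {φ : E3 → ℝ} (hφ : ContDiff ℝ ∞ φ) : Continuous (gradient φ) :=
  (InnerProductSpace.toDual ℝ E3).symm.continuous.comp (hφ.continuous_fderiv (by simp))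

theorem hasCompactSupport_gradient {φ : E3 → ℝ} (hφ : HasCompactSupport φ) :
    HasCompactSupport (gradient φ) :=
  (hφ.fderiv ℝ).comp_left (g := (InnerProductSpace.toDual ℝ E3).symm) (by simp)

theorem gradient_apply (φ : E3 → ℝ) (x : E3) (i : Fin 3) :
    gradient φ x i = fderiv ℝ φ x (EuclideanSpace.single i 1) := by
  rw [← inner_gradient_left, EuclideanSpace.inner_single_right]
  simp

theorem norm_gradient (φ : E3 → ℝ) (x : E3) : ‖gradient φ x‖ = ‖fderiv ℝ φ x‖ :=
  (InnerProductSpace.toDual ℝ E3).symm.norm_map _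

theorem tsupport_gradient_subset (φ : E3 → ℝ) : tsupport (gradient φ) ⊆ tsupport φ := by
  refine (closure_mono ?_).trans (tsupport_fderiv_subset ℝ (f := φ))
  intro x hx h
  exact hx (by simp [gradient, h])

theorem IsTestFunction.memLp {φ : E3 → ℝ} (hφ : IsTestFunction Ω φ) (p : ENNReal) (μ : Measure E3)
    [IsFiniteMeasureOnCompacts μ] : MemLp φ p μ :=
  hφ.continuous.memLp_of_hasCompactSupport hφ.2.1

theorem IsTestFunction.memLp_gradient {φ : E3 → ℝ} (hφ : IsTestFunction Ω φ) (p : ENNReal)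
    (μ : Measure E3) [IsFiniteMeasureOnCompacts μ] : MemLp (gradient φ) p μ :=
  (continuous_gradient hφ.1).memLp_of_hasCompactSupport (hasCompactSupport_gradient hφ.2.1)

theorem IsTestFunction.add {φ ψ : E3 → ℝ} (hφ : IsTestFunction Ω φ) (hψ : IsTestFunction Ω ψ) :
    IsTestFunction Ω (fun x => φ x + ψ x) :=
  ⟨hφ.1.add hψ.1, hφ.2.1.add hψ.2.1,
    (tsupport_add φ ψ).trans (Set.union_subset hφ.2.2 hψ.2.2)⟩

theorem IsTestFunction.mul_left {φ ψ : E3 → ℝ} (hφ : IsTestFunction Ω φ) (hψ : ContDiff ℝ ∞ ψ) :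
    IsTestFunction Ω (fun x => φ x * ψ x) :=
  ⟨hφ.1.mul hψ, hφ.2.1.mul_right, (tsupport_mul_subset_left (f := φ) (g := ψ)).trans hφ.2.2⟩

theorem IsTestFunction.fderiv_apply {φ : E3 → ℝ} (hφ : IsTestFunction Ω φ) (v : E3) :
    IsTestFunction Ω (fun x => fderiv ℝ φ x v) := by
  refine ⟨(hφ.1.fderiv_right (m := ∞) (by simp)).clm_apply contDiff_const, hφ.2.1.fderiv_apply ℝ v,
    ?_⟩
  refine (closure_mono ?_).trans ((tsupport_fderiv_subset ℝ (f := φ)).trans hφ.2.2)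
  intro x hx h
  exact hx (by simp [h])

/-- The element `(φ, ∇φ)` of `H¹₀(Ω)` given by a test function. -/
def testPair {φ : E3 → ℝ} (hφ : IsTestFunction Ω φ) : H10 Ω :=
  ⟨WithLp.toLp 2 ((hφ.memLp 2 _).toLp φ, (hφ.memLp_gradient 2 _).toLp (gradient φ)),
    (testPairs Ω).le_topologicalClosure
      ⟨φ, hφ, (hφ.memLp 2 _).coeFn_toLp, (hφ.memLp_gradient 2 _).coeFn_toLp⟩⟩

theorem weakGrad_testPair {φ : E3 → ℝ} (hφ : IsTestFunction Ω φ) :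
    weakGrad (testPair hφ) =ᵐ[volume.restrict Ω] gradient φ :=
  (hφ.memLp_gradient 2 _).coeFn_toLp

/-- Test functions are dense in `H¹₀(Ω)`. -/
theorem H10_induction {p : H10 Ω → Prop} (hc : IsClosed {u | p u})
    (ht : ∀ (φ : E3 → ℝ) (hφ : IsTestFunction Ω φ), p (testPair hφ)) (u : H10 Ω) : p u := by
  have hu : u ∈ closure {w : H10 Ω | (w : L2Pair Ω) ∈ testPairs Ω} := by
    rw [closure_subtype]
    have h1 : (Subtype.val '' {w : H10 Ω | (w : L2Pair Ω) ∈ testPairs Ω}) = testPairs Ω := by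
      ext w
      constructor
      · rintro ⟨w, hw, rfl⟩
        exact hw
      · intro hw
        exact ⟨⟨w, (testPairs Ω).le_topologicalClosure hw⟩, hw, rfl⟩
    rw [h1]
    exact u.2
  refine hc.closure_subset_iff.2 ?_ hu
  rintro w ⟨φ, hφ, h1, h2⟩
  have : w = testPair hφ := by
    apply Subtype.ext
    apply (WithLp.equiv 2 _).injective
    refine Prod.ext ?_ ?_
    · exact Lp.ext (h1.trans (hφ.memLp 2 _).coeFn_toLp.symm)
    · exact Lp.ext (h2.trans (hφ.memLp_gradient 2 _).coeFn_toLp.symm)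
  simpa [this] using ht φ hφ

theorem norm_sq_eq (u : H10 Ω) : ‖u‖ ^ 2 = ‖(u : L2Pair Ω).fst‖ ^ 2 + ‖weakGrad u‖ ^ 2 :=
  WithLp.prod_norm_sq_eq_of_L2 _

theorem norm_weakGrad_le (u : H10 Ω) : ‖weakGrad u‖ ≤ ‖u‖ := by
  have := norm_sq_eq u
  nlinarith [norm_nonneg u, norm_nonneg (weakGrad u), sq_nonneg ‖(u : L2Pair Ω).fst‖]

/-- The weak gradient as a linear map. -/
def weakGradL (Ω : Set E3) : H10 Ω →L[ℝ] Lp E3 2 (volume.restrict Ω) :=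
  LinearMap.mkContinuous
    { toFun := weakGrad
      map_add' := fun _ _ => rfl
      map_smul' := fun _ _ => rfl } 1 (fun u => by
      rw [one_mul]
      exact norm_weakGrad_le u)

theorem weakGradL_apply (u : H10 Ω) : weakGradL Ω u = weakGrad u := rfl

theorem weakGrad_add (u v : H10 Ω) : weakGrad (u + v) = weakGrad u + weakGrad v := rfl

theorem weakGrad_smul (c : ℝ) (u : H10 Ω) : weakGrad (c • u) = c • weakGrad u := rfl

instance instCompleteSpaceH10 : CompleteSpace (H10 Ω) :=
  (testPairs Ω).isClosed_topologicalClosure.completeSpace_coe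

/-! ### Poincaré inequality -/

theorem norm_toLp_sq {E : Type*} [NormedAddCommGroup E] [InnerProductSpace ℝ E] {μ : Measure E3}
    {g : E3 → E} (hg : MemLp g 2 μ) :
    ‖hg.toLp g‖ ^ 2 = ∫ x, ‖g x‖ ^ 2 ∂μ := by
  rw [← real_inner_self_eq_norm_sq, L2.inner_def]
  refine integral_congr_ae ?_
  filter_upwards [hg.coeFn_toLp] with x hx
  rw [hx, real_inner_self_eq_norm_sq]

theorem setIntegral_eq_integral_of_support {E : Type*} [NormedAddCommGroup E] [NormedSpace ℝ E]
    {f : E3 → E} (hf : ∀ x, x ∉ Ω → f x = 0) : ∫ x in Ω, f x = ∫ x, f x :=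
  setIntegral_eq_integral_of_forall_compl_eq_zero hf

theorem IsTestFunction.eq_zero {φ : E3 → ℝ} (hφ : IsTestFunction Ω φ) {x : E3} (hx : x ∉ Ω) :
    φ x = 0 := image_eq_zero_of_notMem_tsupport fun h => hx (hφ.2.2 h)

theorem IsTestFunction.gradient_eq_zero {φ : E3 → ℝ} (hφ : IsTestFunction Ω φ) {x : E3}
    (hx : x ∉ Ω) : gradient φ x = 0 :=
  image_eq_zero_of_notMem_tsupport fun h => hx (hφ.2.2 (tsupport_gradient_subset φ h))

theorem IsTestFunction.integrable {φ : E3 → ℝ} (hφ : IsTestFunction Ω φ) (μ : Measure E3)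
    [IsFiniteMeasureOnCompacts μ] : Integrable φ μ :=
  hφ.continuous.integrable_of_hasCompactSupport hφ.2.1

/-- Integration by parts against a function which is differentiable along a coordinate. -/
theorem integral_mul_fderiv_of_hasLineDerivAt {f f' : E3 → ℝ} {ψ : E3 → ℝ} {v : E3}
    (hψ : IsTestFunction Ω ψ) (hf : ∀ x, HasLineDerivAt ℝ f (f' x) x v)
    (h1 : Integrable (fun x => f' x * ψ x)) (h2 : Integrable (fun x => f x * fderiv ℝ ψ x v))
    (h3 : Integrable (fun x => f x * ψ x)) :
    ∫ x, f x * fderiv ℝ ψ x v = - ∫ x, f' x * ψ x :=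
  integral_bilinear_hasLineDerivAt_right_eq_neg_left_of_integrable
    (B := ContinuousLinearMap.mul ℝ ℝ) (f := f) (f' := f') (g := ψ)
    (g' := fun x => fderiv ℝ ψ x v) (v := v) (by simpa using h1) (by simpa using h2)
    (by simpa using h3) (fun x _ => hf x)
    (fun x _ => (hψ.differentiable x).hasFDerivAt.hasLineDerivAt v)

/-- Only the bounded height of `Ω` matters: integrate `φ²` by parts against the vertical coordinate,
which has derivative `1` and lies in `(0, 1)` on `Ω`. Young's inequality `2ab ≤ a²/2 + 2b²` absorbs
half of the left side, which gives the constant 4. -/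
theorem IsTestFunction.poincare {φ : E3 → ℝ} (hφ : IsTestFunction Ω φ)
    (hΩ : ∀ x ∈ Ω, x 2 ∈ Set.Ioo (0 : ℝ) 1) :
    ∫ x in Ω, ‖φ x‖ ^ 2 ≤ 4 * ∫ x in Ω, ‖gradient φ x‖ ^ 2 := by
  set e : E3 := EuclideanSpace.single 2 1
  have hφ2 : IsTestFunction Ω (fun x => φ x * φ x) := hφ.mul_left hφ.1
  have hd : ∀ x, fderiv ℝ (fun x => φ x * φ x) x e = 2 * (φ x * fderiv ℝ φ x e) := by
    intro x
    rw [fderiv_fun_mul (hφ.differentiable x) (hφ.differentiable x)]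
    simp
    ring
  have hx2 : Continuous (fun x : E3 => x 2) := by fun_prop
  have hc : ∀ {g : E3 → ℝ} {ψ : E3 → ℝ}, Continuous g → IsTestFunction Ω ψ →
      Integrable (fun x => g x * ψ x) := fun hg hψ =>
    (hg.mul hψ.continuous).integrable_of_hasCompactSupport hψ.2.1.mul_left
  have key : ∫ x, x 2 * fderiv ℝ (fun x => φ x * φ x) x e = - ∫ x, 1 * (φ x * φ x) := by
    refine integral_mul_fderiv_of_hasLineDerivAt (f := fun x : E3 => x 2) (f' := fun _ => 1)
      (v := e) hφ2 ?_ (hc continuous_const hφ2) (hc hx2 (hφ2.fderiv_apply e)) (hc hx2 hφ2)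
    intro x
    have : HasDerivAt (fun t : ℝ => x 2 + t) 1 0 := by
      simpa using (hasDerivAt_id (0 : ℝ)).const_add (x 2)
    simpa [HasLineDerivAt, e] using this
  have hsq : Integrable (fun x => φ x ^ 2) := by
    simpa [sq] using hφ2.integrable volume
  have hg2 : Integrable (fun x => ‖gradient φ x‖ ^ 2) := by
    have hgc : Continuous (fun x => ‖gradient φ x‖ ^ 2) := (continuous_gradient hφ.1).norm.pow 2
    have hgs : HasCompactSupport (fun x => ‖gradient φ x‖ ^ 2) :=
      (hasCompactSupport_gradient hφ.2.1).comp_left (g := fun v : E3 => ‖v‖ ^ 2) (by simp)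
    exact hgc.integrable_of_hasCompactSupport hgs
  have hb : ∀ x, -(x 2 * fderiv ℝ (fun x => φ x * φ x) x e)
      ≤ φ x ^ 2 / 2 + 2 * ‖gradient φ x‖ ^ 2 := by
    intro x
    rw [hd]
    by_cases hx : x ∈ Ω
    · have h1 := hΩ x hx
      have h2 : |fderiv ℝ φ x e| ≤ ‖gradient φ x‖ := by
        rw [norm_gradient, ← Real.norm_eq_abs]
        simpa [e] using (fderiv ℝ φ x).le_opNorm e
      have h3 : -(x 2 * (2 * (φ x * fderiv ℝ φ x e))) ≤ 2 * (|φ x| * ‖gradient φ x‖) := by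
        have : -(x 2 * (2 * (φ x * fderiv ℝ φ x e))) ≤ |x 2| * (2 * (|φ x| * |fderiv ℝ φ x e|)) := by
          refine (neg_le_abs _).trans ?_
          simp [abs_mul]
        refine this.trans ?_
        have h4 : |x 2| ≤ 1 := by rw [abs_le]; constructor <;> linarith [h1.1, h1.2]
        calc _ ≤ 1 * (2 * (|φ x| * ‖gradient φ x‖)) := by gcongr
          _ = _ := one_mul _
      nlinarith [sq_nonneg (|φ x| - 2 * ‖gradient φ x‖), sq_abs (φ x)]
    · simp [hφ.eq_zero hx]
  have : ∫ x, φ x ^ 2 ≤ ∫ x, (φ x ^ 2 / 2 + 2 * ‖gradient φ x‖ ^ 2) := by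
    calc ∫ x, φ x ^ 2 = ∫ x, -(x 2 * fderiv ℝ (fun x => φ x * φ x) x e) := by
          rw [integral_neg, key]
          simp [sq]
      _ ≤ _ := integral_mono (hc hx2 (hφ2.fderiv_apply e)).neg
          ((hsq.div_const 2).add (hg2.const_mul 2)) hb
  rw [integral_add (hsq.div_const 2) (hg2.const_mul 2), integral_div, integral_const_mul] at this
  rw [setIntegral_eq_integral_of_support (fun x hx => by simp [hφ.eq_zero hx]),
    setIntegral_eq_integral_of_support (fun x hx => by simp [hφ.gradient_eq_zero hx])]
  simp only [Real.norm_eq_abs, sq_abs]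
  linarith

theorem norm_fst_le_weakGrad (hΩ : ∀ x ∈ Ω, x 2 ∈ Set.Ioo (0 : ℝ) 1) (u : H10 Ω) :
    ‖(u : L2Pair Ω).fst‖ ^ 2 ≤ 4 * ‖weakGrad u‖ ^ 2 := by
  refine H10_induction (p := fun u : H10 Ω => ‖(u : L2Pair Ω).fst‖ ^ 2 ≤ 4 * ‖weakGrad u‖ ^ 2)
    ?_ ?_ u
  · refine isClosed_le ?_ ?_
    · exact (((WithLp.prod_continuous_ofLp 2 _ _).comp continuous_subtype_val).fst.norm).pow 2
    · exact continuous_const.mul ((weakGradL Ω).continuous.norm.pow 2)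
  · intro φ hφ
    have h1 := norm_toLp_sq (hφ.memLp 2 (volume.restrict Ω))
    have h2 := norm_toLp_sq (hφ.memLp_gradient 2 (volume.restrict Ω))
    have := hφ.poincare hΩ
    rw [← h1, ← h2] at this
    exact this

theorem norm_sq_le_weakGrad (hΩ : ∀ x ∈ Ω, x 2 ∈ Set.Ioo (0 : ℝ) 1) (u : H10 Ω) :
    ‖u‖ ^ 2 ≤ 5 * ‖weakGrad u‖ ^ 2 := by
  rw [norm_sq_eq]
  linarith [norm_fst_le_weakGrad hΩ u]

/-! ### The Lax–Milgram theorem and weak convergence in Hilbert spaces -/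

theorem IsCoercive.existsUnique {V : Type*} [NormedAddCommGroup V] [InnerProductSpace ℝ V]
    [CompleteSpace V] {B : V →L[ℝ] V →L[ℝ] ℝ} (hB : IsCoercive B) (f : StrongDual ℝ V) :
    ∃! u : V, ∀ v, B u v = f v := by
  refine ⟨hB.continuousLinearEquivOfBilin.symm ((InnerProductSpace.toDual ℝ V).symm f), ?_, ?_⟩
  · intro v
    rw [← hB.continuousLinearEquivOfBilin_apply]
    simp
  · intro u hu
    rw [ContinuousLinearEquiv.eq_symm_apply]
    refine ext_inner_right ℝ fun v => ?_
    rw [hB.continuousLinearEquivOfBilin_apply, hu v]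
    simp

/-- A bounded sequence gives functionals `B (u n)` that are equi-Lipschitz in `v`, so convergence
passes to limits of the argument. -/
theorem isClosed_setOf_tendsto_form {V : Type*} [NormedAddCommGroup V] [InnerProductSpace ℝ V]
    (B : V →L[ℝ] V →L[ℝ] ℝ) {u : ℕ → V} (w : V) {K : ℝ} (hK : ∀ᶠ n in atTop, ‖u n‖ ≤ K) :
    IsClosed {v | Tendsto (fun n => B (u n) v) atTop (𝓝 (B w v))} := by
  refine isClosed_of_closure_subset fun v hv => ?_
  -- A common Lipschitz constant of the functionals `B (u n - w)`; the `+ 1` makes it positive, so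
  -- that it can be divided by.
  set L := ‖B‖ * (|K| + ‖w‖) + 1 with hL
  have hL0 : 0 < L := by positivity
  rw [Set.mem_ofPred_eq, Metric.tendsto_nhds]
  intro δ hδ
  obtain ⟨v', hv', hd⟩ := Metric.mem_closure_iff.1 hv (δ / 2 / L) (by positivity)
  have h1 := Metric.tendsto_nhds.1 hv' (δ / 2) (by positivity)
  filter_upwards [h1, hK] with n hn hKn
  rw [Real.dist_eq] at hn ⊢
  have h2 : B (u n) v - B w v = (B (u n) v' - B w v') + B (u n - w) (v - v') := by
    simp [map_sub]
  have h3 : |B (u n - w) (v - v')| ≤ L * ‖v - v'‖ := by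
    rw [← Real.norm_eq_abs]
    refine (B.le_opNorm₂ _ _).trans ?_
    gcongr
    calc ‖B‖ * ‖u n - w‖ ≤ ‖B‖ * (|K| + ‖w‖) := by
          gcongr
          exact (norm_sub_le _ _).trans (by gcongr; exact hKn.trans (le_abs_self K))
      _ ≤ L := by simp [hL]
  have h4 : L * ‖v - v'‖ < δ / 2 := by
    rw [dist_eq_norm, lt_div_iff₀ hL0] at hd
    linarith
  rw [h2]
  linarith [abs_add_le (B (u n) v' - B w v') (B (u n - w) (v - v'))]

/-- Lax–Milgram for the flipped form represents every continuous functional as `x ↦ B x v`, so the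
form tests all of the dual. -/
theorem IsCoercive.tendsto_toWeakSpace {V : Type*} [NormedAddCommGroup V] [InnerProductSpace ℝ V]
    [CompleteSpace V] {B : V →L[ℝ] V →L[ℝ] ℝ} (hB : IsCoercive B) {u : ℕ → V} {w : V}
    (h : ∀ v, Tendsto (fun n => B (u n) v) atTop (𝓝 (B w v))) :
    Tendsto (fun n => toWeakSpace ℝ V (u n)) atTop (𝓝 (toWeakSpace ℝ V w)) := by
  have hflip : IsCoercive B.flip := by
    obtain ⟨c, hc, h⟩ := hB
    exact ⟨c, hc, fun u => by simpa using h u⟩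
  have hinj : Function.Injective (topDualPairing ℝ V).flip := by
    intro x y hxy
    refine ext_inner_left ℝ fun z => ?_
    simpa using LinearMap.congr_fun hxy (InnerProductSpace.toDual ℝ V z)
  refine (WeakBilin.tendsto_iff_forall_eval_tendsto _ hinj).2 fun f => ?_
  obtain ⟨v, hv, -⟩ := IsCoercive.existsUnique hflip f
  have h1 : ∀ x, B x v = f x := fun x => by simpa using hv x
  have h2 := h v
  simp only [h1] at h2
  exact h2

/-! ### Bilinear forms and the Lax–Milgram theorem -/

theorem toEuclideanLin_apply_coord (A : Matrix (Fin 3) (Fin 3) ℝ) (ξ : E3) (i : Fin 3) :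
    Matrix.toEuclideanLin A ξ i = ∑ j, A i j * ξ j := by
  simp [Matrix.toLpLin_apply, Matrix.mulVec, dotProduct]

theorem inner_toEuclideanLin (A : Matrix (Fin 3) (Fin 3) ℝ) (ξ η : E3) :
    inner ℝ (Matrix.toEuclideanLin A ξ) η = inner ℝ ξ (Matrix.toEuclideanLin A.transpose η) := by
  simp only [PiLp.inner_apply, toEuclideanLin_apply_coord, Fin.sum_univ_three,
    Matrix.transpose_apply, RCLike.inner_apply, conj_trivial]
  ring

theorem memLp_toEuclideanLin {μ : Measure E3} {A : E3 → Matrix (Fin 3) (Fin 3) ℝ}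
    (hA : ∀ i j, Measurable fun x => A x i j) {C : ℝ}
    (hC : ∀ x ξ, ‖Matrix.toEuclideanLin (A x) ξ‖ ≤ C * ‖ξ‖) {g : E3 → E3} (hg : MemLp g 2 μ) :
    MemLp (fun x => Matrix.toEuclideanLin (A x) (g x)) 2 μ := by
  refine MemLp.of_le_mul (c := C) hg ?_ (ae_of_all _ fun x => hC x (g x))
  have hg' : AEMeasurable g μ := hg.1.aemeasurable
  have hgi : ∀ j, AEMeasurable (fun x => g x j) μ := fun j =>
    (measurable_pi_apply j).comp_aemeasurable ((PiLp.continuous_ofLp 2 _).measurable.comp_aemeasurable hg')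
  have h1 : AEMeasurable (fun x => (fun i => ∑ j, A x i j * g x j : Fin 3 → ℝ)) μ :=
    aemeasurable_pi_lambda _ fun i =>
      Finset.aemeasurable_fun_sum _ fun j _ => (hA i j).aemeasurable.mul (hgi j)
  have h2 := ((PiLp.continuous_toLp 2 (fun _ : Fin 3 => ℝ)).measurable.comp_aemeasurable h1)
  refine (h2.congr (ae_of_all _ fun x => ?_)).aestronglyMeasurable
  ext i
  simp [toEuclideanLin_apply_coord]

theorem integrable_inner_of_memLp {μ : Measure E3} {f g : E3 → E3} (hf : MemLp f 2 μ)
    (hg : MemLp g 2 μ) : Integrable (fun x => inner ℝ (f x) (g x)) μ := by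
  refine (L2.integrable_inner (𝕜 := ℝ) (hf.toLp f) (hg.toLp g)).congr ?_
  filter_upwards [hf.coeFn_toLp, hg.coeFn_toLp] with x h1 h2
  rw [h1, h2]

theorem memLp_weakGrad (u : H10 Ω) : MemLp (weakGrad u) 2 (volume.restrict Ω) := Lp.memLp _

/-- Pairing of the weak gradient with a square integrable field. -/
theorem integral_inner_weakGrad (u : H10 Ω) {X : E3 → E3} (hX : MemLp X 2 (volume.restrict Ω)) :
    ∫ x in Ω, inner ℝ (weakGrad u x) (X x) = inner ℝ (weakGradL Ω u) (hX.toLp X) := by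
  rw [L2.inner_def]
  refine integral_congr_ae ?_
  filter_upwards [hX.coeFn_toLp] with x h1
  rw [h1, weakGradL_apply]

theorem abs_integral_inner_weakGrad_le (u : H10 Ω) {X : E3 → E3}
    (hX : MemLp X 2 (volume.restrict Ω)) :
    |∫ x in Ω, inner ℝ (weakGrad u x) (X x)| ≤ ‖u‖ * ‖hX.toLp X‖ := by
  rw [integral_inner_weakGrad u hX]
  exact (abs_real_inner_le_norm _ _).trans
    (mul_le_mul_of_nonneg_right (norm_weakGrad_le u) (norm_nonneg _))

/-- The bilinear form `(u, v) ↦ ∫_Ω A ∇u · ∇v` of a bounded measurable matrix field. -/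
theorem exists_bilinearForm {A : E3 → Matrix (Fin 3) (Fin 3) ℝ}
    (hA : ∀ i j, Measurable fun x => A x i j) {C : ℝ}
    (hC : ∀ x ξ, ‖Matrix.toEuclideanLin (A x) ξ‖ ≤ C * ‖ξ‖) :
    ∃ B : H10 Ω →L[ℝ] H10 Ω →L[ℝ] ℝ, ∀ u v, B u v =
      ∫ x in Ω, inner ℝ (Matrix.toEuclideanLin (A x) (weakGrad u x)) (weakGrad v x) := by
  have hM : ∀ u : H10 Ω, MemLp (fun x => Matrix.toEuclideanLin (A x) (weakGrad u x)) 2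
      (volume.restrict Ω) := fun u => memLp_toEuclideanLin hA hC (memLp_weakGrad u)
  have hI : ∀ u v : H10 Ω, Integrable (fun x => inner ℝ (Matrix.toEuclideanLin (A x) (weakGrad u x))
      (weakGrad v x)) (volume.restrict Ω) :=
    fun u v => integrable_inner_of_memLp (hM u) (memLp_weakGrad v)
  let b : H10 Ω →ₗ[ℝ] H10 Ω →ₗ[ℝ] ℝ := LinearMap.mk₂ ℝ
    (fun u v => ∫ x in Ω, inner ℝ (Matrix.toEuclideanLin (A x) (weakGrad u x)) (weakGrad v x))
    (by
      intro u u' v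
      rw [← integral_add (hI u v) (hI u' v)]
      refine integral_congr_ae ?_
      filter_upwards [Lp.coeFn_add (weakGrad u) (weakGrad u')] with x hx
      rw [weakGrad_add, hx, Pi.add_apply, map_add, inner_add_left])
    (by
      intro c u v
      rw [smul_eq_mul, ← integral_const_mul]
      refine integral_congr_ae ?_
      filter_upwards [Lp.coeFn_smul c (weakGrad u)] with x hx
      rw [weakGrad_smul, hx, Pi.smul_apply, map_smul, real_inner_smul_left])
    (by
      intro u v v'
      rw [← integral_add (hI u v) (hI u v')]
      refine integral_congr_ae ?_
      filter_upwards [Lp.coeFn_add (weakGrad v) (weakGrad v')] with x hx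
      rw [weakGrad_add, hx, Pi.add_apply, inner_add_right])
    (by
      intro c u v
      rw [smul_eq_mul, ← integral_const_mul]
      refine integral_congr_ae ?_
      filter_upwards [Lp.coeFn_smul c (weakGrad v)] with x hx
      rw [weakGrad_smul, hx, Pi.smul_apply, real_inner_smul_right])
  refine ⟨b.mkContinuous₂ C ?_, fun u v => rfl⟩
  intro u v
  have h1 : ∫ x in Ω, inner ℝ (Matrix.toEuclideanLin (A x) (weakGrad u x)) (weakGrad v x)
      = inner ℝ (weakGradL Ω v) ((hM u).toLp _) := by
    rw [← integral_inner_weakGrad]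
    exact integral_congr_ae (ae_of_all _ fun x => real_inner_comm _ _)
  have h2 : ‖(hM u).toLp _‖ ≤ C * ‖weakGrad u‖ := by
    refine Lp.norm_le_mul_norm_of_ae_le_mul ?_
    filter_upwards [(hM u).coeFn_toLp] with x hx
    rw [hx]
    exact hC x _
  have hC0 : 0 ≤ C := by
    have := (norm_nonneg _).trans (hC 0 (EuclideanSpace.single 0 1))
    simpa using this
  change ‖∫ x in Ω, inner ℝ (Matrix.toEuclideanLin (A x) (weakGrad u x)) (weakGrad v x)‖ ≤ _
  rw [h1]
  calc _ ≤ ‖weakGradL Ω v‖ * ‖(hM u).toLp _‖ := norm_inner_le_norm _ _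
    _ ≤ ‖v‖ * (C * ‖u‖) := by
        gcongr
        · exact norm_weakGrad_le v
        · exact h2.trans (by gcongr; exact norm_weakGrad_le u)
    _ = C * ‖u‖ * ‖v‖ := by ring

/-- The factor 5 is `1 + 4`, from the Poincaré inequality with constant 4. -/
theorem coercive_bilinearForm (hΩ : ∀ x ∈ Ω, x 2 ∈ Set.Ioo (0 : ℝ) 1)
    {A : E3 → Matrix (Fin 3) (Fin 3) ℝ}
    (hA : ∀ i j, Measurable fun x => A x i j) {C : ℝ}
    (hC : ∀ x ξ, ‖Matrix.toEuclideanLin (A x) ξ‖ ≤ C * ‖ξ‖) {c : ℝ} (hc : 0 ≤ c)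
    (hcoer : ∀ x ξ, c * ‖ξ‖ ^ 2 ≤ inner ℝ (Matrix.toEuclideanLin (A x) ξ) ξ) (u : H10 Ω) :
    c / 5 * ‖u‖ ^ 2 ≤
      ∫ x in Ω, inner ℝ (Matrix.toEuclideanLin (A x) (weakGrad u x)) (weakGrad u x) := by
  have h1 : c * ‖weakGrad u‖ ^ 2 ≤
      ∫ x in Ω, inner ℝ (Matrix.toEuclideanLin (A x) (weakGrad u x)) (weakGrad u x) := by
    rw [← real_inner_self_eq_norm_sq, L2.inner_def, ← integral_const_mul]
    refine integral_mono ((L2.integrable_inner (𝕜 := ℝ) _ _).const_mul c)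
      (integrable_inner_of_memLp (memLp_toEuclideanLin hA hC (memLp_weakGrad u))
        (memLp_weakGrad u)) ?_
    intro x
    simpa [real_inner_self_eq_norm_sq] using hcoer x (weakGrad u x)
  have := norm_sq_le_weakGrad hΩ u
  nlinarith

theorem existsUnique_isSolution (hΩ : ∀ x ∈ Ω, x 2 ∈ Set.Ioo (0 : ℝ) 1)
    {A : E3 → Matrix (Fin 3) (Fin 3) ℝ}
    (hA : ∀ i j, Measurable fun x => A x i j) {C : ℝ}
    (hC : ∀ x ξ, ‖Matrix.toEuclideanLin (A x) ξ‖ ≤ C * ‖ξ‖) {c : ℝ} (hc : 0 < c)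
    (hcoer : ∀ x ξ, c * ‖ξ‖ ^ 2 ≤ inner ℝ (Matrix.toEuclideanLin (A x) ξ) ξ) (f : HNeg1 Ω) :
    ∃! u : H10 Ω, IsSolution Ω A f u := by
  obtain ⟨B, hB⟩ := exists_bilinearForm (Ω := Ω) hA hC
  have hBc : IsCoercive B := ⟨c / 5, by positivity, fun u => by
    rw [hB, mul_assoc, ← sq]
    exact coercive_bilinearForm hΩ hA hC hc.le hcoer u⟩
  have h := IsCoercive.existsUnique hBc f
  simp only [hB] at h
  exact h

theorem norm_isSolution_le (hΩ : ∀ x ∈ Ω, x 2 ∈ Set.Ioo (0 : ℝ) 1)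
    {A : E3 → Matrix (Fin 3) (Fin 3) ℝ}
    (hA : ∀ i j, Measurable fun x => A x i j) {C : ℝ}
    (hC : ∀ x ξ, ‖Matrix.toEuclideanLin (A x) ξ‖ ≤ C * ‖ξ‖) {c : ℝ} (hc : 0 < c)
    (hcoer : ∀ x ξ, c * ‖ξ‖ ^ 2 ≤ inner ℝ (Matrix.toEuclideanLin (A x) ξ) ξ) {f : HNeg1 Ω}
    {u : H10 Ω} (hu : IsSolution Ω A f u) : ‖u‖ ≤ 5 / c * ‖f‖ := by
  have h1 := coercive_bilinearForm hΩ hA hC hc.le hcoer u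
  rw [hu u] at h1
  have h2 : f u ≤ ‖f‖ * ‖u‖ := (le_abs_self _).trans (f.le_opNorm u)
  rcases (norm_nonneg u).eq_or_lt with h0 | h0
  · rw [← h0]
    positivity
  · have h3 : c / 5 * ‖u‖ ≤ ‖f‖ := by
      by_contra! h
      nlinarith [mul_lt_mul_of_pos_right h h0]
    rw [div_mul_eq_mul_div, le_div_iff₀ hc]
    linarith

/-- Weak convergence in `H¹₀(Ω)` is detected by a coercive form tested on test functions. -/
theorem tendsto_toWeakSpace_of_form {B : H10 Ω →L[ℝ] H10 Ω →L[ℝ] ℝ} (hB : IsCoercive B)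
    {u : ℕ → H10 Ω} {w : H10 Ω} {K : ℝ} (hK : ∀ᶠ n in atTop, ‖u n‖ ≤ K)
    (h : ∀ (φ : E3 → ℝ) (hφ : IsTestFunction Ω φ),
      Tendsto (fun n => B (u n) (testPair hφ)) atTop (𝓝 (B w (testPair hφ)))) :
    Tendsto (fun n => toWeakSpace ℝ (H10 Ω) (u n)) atTop (𝓝 (toWeakSpace ℝ (H10 Ω) w)) :=
  IsCoercive.tendsto_toWeakSpace hB
    (fun v => H10_induction (isClosed_setOf_tendsto_form B w hK) h v)

/-! ### Projection onto the plane and lattices of rods -/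

/-- The orthogonal projection of `ℝ³` onto the plane of the first two coordinates. -/
def planeProj : E3 →L[ℝ] E2 :=
  LinearMap.toContinuousLinearMap
    { toFun := fun x => !₂[x 0, x 1]
      map_add' := fun x y => by ext i; fin_cases i <;> simp
      map_smul' := fun c x => by ext i; fin_cases i <;> simp }

theorem planeProj_apply (x : E3) : planeProj x = !₂[x 0, x 1] := rfl

@[simp] theorem planeProj_apply_zero (x : E3) : planeProj x 0 = x 0 := rfl

@[simp] theorem planeProj_apply_one (x : E3) : planeProj x 1 = x 1 := rfl

theorem norm_sq_E2 (y : E2) : ‖y‖ ^ 2 = y 0 ^ 2 + y 1 ^ 2 := by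
  simp [EuclideanSpace.norm_sq_eq, Fin.sum_univ_two]

theorem norm_sq_E3 (y : E3) : ‖y‖ ^ 2 = y 0 ^ 2 + y 1 ^ 2 + y 2 ^ 2 := by
  simp [EuclideanSpace.norm_sq_eq, Fin.sum_univ_three]

theorem norm_planeProj_le (x : E3) : ‖planeProj x‖ ≤ ‖x‖ := by
  refine (sq_le_sq₀ (norm_nonneg _) (norm_nonneg _)).1 ?_
  rw [norm_sq_E2, norm_sq_E3, planeProj_apply_zero, planeProj_apply_one]
  nlinarith [sq_nonneg (x 2)]

/-- Fubini along the rods: it reduces volumes and integrals over rods in a slab to planar ones. -/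
theorem measurePreserving_height_planeProj :
    MeasurePreserving (fun x : E3 => (x 2, planeProj x)) volume (volume : Measure (ℝ × E2)) := by
  have h1 := PiLp.volume_preserving_ofLp (Fin 3)
  have h2 := volume_preserving_piFinSuccAbove (fun _ : Fin 3 => ℝ) 2
  have h3 : MeasurePreserving (Prod.map id (WithLp.toLp 2) : ℝ × (Fin 2 → ℝ) → ℝ × E2)
      volume volume :=
    (MeasurePreserving.id volume).prod (PiLp.volume_preserving_toLp (Fin 2))
  have h := h3.comp (h2.comp h1)
  convert! h using 1
  ext x
  · rfl
  · rename_i i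
    fin_cases i <;> rfl

/-- A horizontal slab. -/
def slab (a b : ℝ) : Set E3 := {x | x 2 ∈ Set.Ioo a b}

theorem map_planeProj_slab (a b : ℝ) :
    (volume.restrict (slab a b)).map planeProj = ENNReal.ofReal (b - a) • volume := by
  have h := measurePreserving_height_planeProj.restrict_preimage
    (s := Set.Ioo a b ×ˢ (Set.univ : Set E2)) (measurableSet_Ioo.prod MeasurableSet.univ)
  have h1 : (fun x : E3 => (x 2, planeProj x)) ⁻¹' (Set.Ioo a b ×ˢ (Set.univ : Set E2))
      = slab a b := by
    ext x
    simp [slab]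
  rw [h1] at h
  have h2 : (volume : Measure (ℝ × E2)).restrict (Set.Ioo a b ×ˢ (Set.univ : Set E2))
      = (volume.restrict (Set.Ioo a b)).prod volume := by
    conv_rhs => rw [← Measure.restrict_univ (μ := (volume : Measure E2))]
    rw [Measure.prod_restrict]
    rfl
  have h3 : (volume.restrict (slab a b)).map planeProj
      = ((volume.restrict (slab a b)).map (fun x : E3 => (x 2, planeProj x))).map Prod.snd := by
    rw [Measure.map_map measurable_snd h.measurable]
    rfl
  rw [h3, h.map_eq, h2, Measure.map_snd_prod]
  simp

theorem volume_slab_inter_preimage {a b : ℝ} {s : Set E2} (hs : MeasurableSet s) :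
    volume (slab a b ∩ planeProj ⁻¹' s) = ENNReal.ofReal (b - a) * volume s := by
  rw [Set.inter_comm, ← Measure.restrict_apply (planeProj.continuous.measurable hs),
    ← Measure.map_apply planeProj.continuous.measurable hs, map_planeProj_slab]
  simp

/-- For the horizontal faces of the open cells, which the fibers miss and the infinite rods contain.
-/
theorem volume_height_eq (c : ℝ) : volume {x : E3 | x 2 = c} = 0 := by
  have h := measurePreserving_height_planeProj.measure_preimage
    (s := {c} ×ˢ (Set.univ : Set E2))
    ((measurableSet_singleton c).prod MeasurableSet.univ).nullMeasurableSet
  have h1 : (fun x : E3 => (x 2, planeProj x)) ⁻¹' ({c} ×ˢ (Set.univ : Set E2))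
      = {x : E3 | x 2 = c} := by
    ext x
    simp
  rw [h1] at h
  rw [h, Measure.volume_eq_prod, Measure.prod_prod]
  simp

/-- The points of the square lattice of mesh `ε`. -/
def latticePt (ε : ℝ) (ν : ℤ × ℤ) : E2 := !₂[ε * ν.1, ε * ν.2]

@[simp] theorem latticePt_zero (ε : ℝ) (ν : ℤ × ℤ) : latticePt ε ν 0 = ε * ν.1 := rfl

@[simp] theorem latticePt_one (ε : ℝ) (ν : ℤ × ℤ) : latticePt ε ν 1 = ε * ν.2 := rfl

/-- The lattice of vertical rods of radius `ε r`. -/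
def rods (ε r : ℝ) : Set E3 := {x | ∃ ν : ℤ × ℤ, ‖planeProj x - latticePt ε ν‖ ≤ ε * r}

theorem rods_eq_iUnion (ε r : ℝ) :
    rods ε r = ⋃ ν : ℤ × ℤ, planeProj ⁻¹' Metric.closedBall (latticePt ε ν) (ε * r) := by
  ext x
  simp [rods, dist_eq_norm]

theorem measurableSet_rods (ε r : ℝ) : MeasurableSet (rods ε r) := by
  rw [rods_eq_iUnion]
  exact MeasurableSet.iUnion fun ν => planeProj.continuous.measurable measurableSet_closedBall

theorem norm_sq_sub_latticePt (ε : ℝ) (y : E2) (ν : ℤ × ℤ) :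
    ‖y - latticePt ε ν‖ ^ 2 = (y 0 - ε * ν.1) ^ 2 + (y 1 - ε * ν.2) ^ 2 := by
  rw [norm_sq_E2]
  rfl

/-- Two distinct lattice points are at distance at least the mesh. -/
theorem eq_of_norm_sub_latticePt_lt {ε : ℝ} (hε : 0 < ε) {y : E2} {ν ν' : ℤ × ℤ}
    (h : ‖y - latticePt ε ν‖ < ε / 2) (h' : ‖y - latticePt ε ν'‖ < ε / 2) : ν = ν' := by
  have key : ∀ (i : Fin 2), |latticePt ε ν i - latticePt ε ν' i| < ε := by
    intro i
    have h1 : ‖latticePt ε ν - latticePt ε ν'‖ < ε := by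
      have : latticePt ε ν - latticePt ε ν' = (y - latticePt ε ν') - (y - latticePt ε ν) := by abel
      rw [this]
      exact (norm_sub_le _ _).trans_lt (by linarith)
    have h2 := PiLp.norm_apply_le (latticePt ε ν - latticePt ε ν') i
    exact lt_of_le_of_lt h2 h1
  have aux : ∀ {a b : ℤ}, |ε * a - ε * b| < ε → a = b := by
    intro a b hab
    rw [← mul_sub, abs_mul, abs_of_pos hε] at hab
    have h1 : |(a : ℝ) - b| < 1 := by
      by_contra! hc
      nlinarith
    have h2 : |a - b| < 1 := by exact_mod_cast h1
    have := Int.abs_lt_one_iff.1 h2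
    omega
  exact Prod.ext (aux (key 0)) (aux (key 1))

/-! ### Volume of the fibers -/

/-- With radius below `1/2` the disc fits inside the cell, so only the vertical constraint of the
cube remains. -/
theorem cellFiber_eq {r : ℝ} (hr : 0 < r) (hr2 : r < 1 / 2) :
    cellFiber r = slab (-(1 / 2)) (1 / 2) ∩ planeProj ⁻¹' Metric.closedBall 0 r := by
  ext y
  have hball : y ∈ planeProj ⁻¹' Metric.closedBall 0 r ↔ y 0 ^ 2 + y 1 ^ 2 ≤ r ^ 2 := by
    rw [Set.mem_preimage, mem_closedBall_zero_iff, ← sq_le_sq₀ (norm_nonneg _) hr.le, norm_sq_E2]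
    rfl
  rw [Set.mem_inter_iff, hball]
  constructor
  · rintro ⟨h1, h2⟩
    exact ⟨h1 2, h2⟩
  · rintro ⟨h1, h2⟩
    refine ⟨?_, h2⟩
    have h3 : ∀ t : ℝ, t ^ 2 ≤ r ^ 2 → t ∈ Set.Ioo (-(1 / 2) : ℝ) (1 / 2) := by
      intro t ht
      have := abs_le_of_sq_le_sq' ht hr.le
      constructor <;> linarith [this.1, this.2]
    intro i
    fin_cases i
    · exact h3 _ (by simpa using by nlinarith [sq_nonneg (y 1)])
    · exact h3 _ (by simpa using by nlinarith [sq_nonneg (y 0)])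
    · exact h1

theorem volume_real_cellFiber {r : ℝ} (hr : 0 < r) (hr2 : r < 1 / 2) :
    volume.real (cellFiber r) = Real.pi * r ^ 2 := by
  rw [Measure.real, cellFiber_eq hr hr2, volume_slab_inter_preimage measurableSet_closedBall,
    EuclideanSpace.volume_closedBall_fin_two]
  rw [← ENNReal.ofReal_pow hr.le, ← ENNReal.ofReal_mul (by positivity),
    ← ENNReal.ofReal_mul (by norm_num), ENNReal.toReal_ofReal (by positivity)]
  ring

theorem fibers_subset_rods {ε r : ℝ} (hε : 0 < ε) (hr : 0 < r) :
    fibers Ω ε r ⊆ Ω ∩ rods ε r := by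
  rintro x ⟨hx, hx'⟩
  refine ⟨hx, ?_⟩
  obtain ⟨ν, y, ⟨-, hy⟩, rfl⟩ := Set.mem_iUnion.1 hx'
  refine ⟨(ν 0, ν 1), ?_⟩
  rw [← sq_le_sq₀ (norm_nonneg _) (by positivity), norm_sq_sub_latticePt]
  simp
  nlinarith [mul_le_mul_of_nonneg_left hy (sq_nonneg ε)]

theorem mem_fibers_of_mem_rods {ε r : ℝ} (hε : 0 < ε) (hr : 0 < r) (hr2 : r < 1 / 2) {x : E3}
    (hx : x ∈ Ω) (hxr : x ∈ rods ε r) (hx2 : ∀ k : ℤ, x 2 ≠ ε * (k + 1 / 2)) :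
    x ∈ fibers Ω ε r := by
  obtain ⟨ν, hν⟩ := hxr
  refine ⟨hx, Set.mem_iUnion.2 ⟨![ν.1, ν.2, round (x 2 / ε)],
    ε⁻¹ • x - WithLp.toLp 2 (fun i => ((![ν.1, ν.2, round (x 2 / ε)] i : ℤ) : ℝ)), ?_, ?_⟩⟩
  · rw [cellFiber_eq hr hr2]
    constructor
    -- The vertical cell index is the nearest integer, which puts the point in the closed cell; the
    -- hypothesis `hx2` on the height excludes both faces.
    · have h1 := abs_sub_round (x 2 / ε)
      have h2 : x 2 / ε - round (x 2 / ε) ≠ 1 / 2 := by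
        intro h
        apply hx2 (round (x 2 / ε))
        have : x 2 / ε = round (x 2 / ε) + 1 / 2 := by linarith
        rw [← this]
        field_simp
      have h3 : x 2 / ε - round (x 2 / ε) ≠ -(1 / 2) := by
        intro h
        -- The lower face of a cell is the upper face of the cell below, hence the shift of the
        -- index.
        apply hx2 (round (x 2 / ε) - 1)
        have : x 2 / ε = (round (x 2 / ε) : ℝ) - 1 / 2 := by linarith
        have h4 : x 2 = ε * ((round (x 2 / ε) : ℝ) - 1 / 2) := by
          rw [← this]
          field_simp
        push_cast
        linarith
      rw [abs_le] at h1
      simp only [slab, Set.mem_ofPred_eq, PiLp.sub_apply, PiLp.smul_apply, smul_eq_mul]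
      simp only [Matrix.cons_val, inv_mul_eq_div]
      exact ⟨lt_of_le_of_ne h1.1 (Ne.symm h3), lt_of_le_of_ne h1.2 h2⟩
    · rw [Set.mem_preimage, mem_closedBall_zero_iff]
      have : planeProj (ε⁻¹ • x - WithLp.toLp 2
          (fun i => ((![ν.1, ν.2, round (x 2 / ε)] i : ℤ) : ℝ)))
          = ε⁻¹ • (planeProj x - latticePt ε ν) := by
        ext i
        fin_cases i <;> simp <;> field_simp
      rw [this, norm_smul, Real.norm_of_nonneg (by positivity)]
      rw [inv_mul_le_iff₀ hε]
      exact hν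
  · simp [smul_smul, hε.ne']

/-- Stacked fibers fill the rods up to the countably many planes at heights `ε (k + 1/2)`. From here
on the fibers can be treated as sets invariant under vertical translations. -/
theorem fibers_ae_eq {ε r : ℝ} (hε : 0 < ε) (hr : 0 < r) (hr2 : r < 1 / 2) :
    ∀ᵐ x ∂(volume : Measure E3), x ∈ Ω → (x ∈ fibers Ω ε r ↔ x ∈ rods ε r) := by
  have h : ∀ᵐ x ∂(volume : Measure E3), ∀ k : ℤ, x 2 ≠ ε * (k + 1 / 2) := by
    rw [ae_all_iff]
    intro k
    have := volume_height_eq (ε * (k + 1 / 2))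
    rw [ae_iff]
    simpa using this
  filter_upwards [h] with x hx hxΩ
  exact ⟨fun h => (fibers_subset_rods hε hr h).2, fun h => mem_fibers_of_mem_rods hε hr hr2 hxΩ h hx⟩

theorem measurableSet_fibers (hΩ : MeasurableSet Ω) {ε : ℝ} (hε : 0 < ε) (r : ℝ) :
    MeasurableSet (fibers Ω ε r) := by
  refine hΩ.inter (MeasurableSet.iUnion fun ν => ?_)
  have hc : MeasurableSet (cellFiber r) := by
    have hi : ∀ i, Measurable (fun x : E3 => x i) := fun i =>
      (by fun_prop : Continuous (fun x : E3 => x i)).measurable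
    have h1 : MeasurableSet unitCell := by
      have : unitCell = ⋂ i, (fun x : E3 => x i) ⁻¹' Set.Ioo (-(1 / 2) : ℝ) (1 / 2) := by
        ext x
        simp [unitCell]
      rw [this]
      exact MeasurableSet.iInter fun i => hi i measurableSet_Ioo
    exact h1.inter (measurableSet_le (((hi 0).pow_const 2).add ((hi 1).pow_const 2))
      measurable_const)
  -- The image is rewritten as a preimage under the inverse affine map, for which measurability is
  -- immediate.
  have h2 : (fun y : E3 => ε • (y + WithLp.toLp 2 (fun i => (ν i : ℝ)))) '' cellFiber r
      = (fun x : E3 => ε⁻¹ • x - WithLp.toLp 2 (fun i => (ν i : ℝ))) ⁻¹' cellFiber r := by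
    ext x
    constructor
    · rintro ⟨y, hy, rfl⟩
      simpa [smul_smul, hε.ne'] using hy
    · intro hx
      exact ⟨_, hx, by simp [smul_smul, hε.ne']⟩
  rw [h2]
  exact (by fun_prop : Continuous (fun x : E3 => ε⁻¹ • x - WithLp.toLp 2 (fun i => (ν i : ℝ)))).measurable hc

/-! ### Counting rods that meet a bounded set -/

/-- A finite set of indices containing those of all the rods which meet the disc of radius `M`. -/
def latticeBox (M ε : ℝ) : Finset (ℤ × ℤ) :=
  Finset.Icc (-⌈(M + 1) / ε⌉) ⌈(M + 1) / ε⌉ ×ˢ Finset.Icc (-⌈(M + 1) / ε⌉) ⌈(M + 1) / ε⌉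

theorem mem_latticeBox {M ε : ℝ} (hε : 0 < ε) {y : E2} (hy : ‖y‖ ≤ M) {ν : ℤ × ℤ}
    (h : ‖y - latticePt ε ν‖ ≤ 1) : ν ∈ latticeBox M ε := by
  have h1 : ‖latticePt ε ν‖ ≤ M + 1 := by
    have : latticePt ε ν = y - (y - latticePt ε ν) := by abel
    rw [this]
    exact (norm_sub_le _ _).trans (by linarith)
  have h2 : ∀ a : ℤ, |ε * a| ≤ M + 1 → a ∈ Finset.Icc (-⌈(M + 1) / ε⌉) ⌈(M + 1) / ε⌉ := by
    intro a ha
    rw [abs_mul, abs_of_pos hε, ← le_div_iff₀' hε, abs_le] at ha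
    have h3 := Int.le_ceil ((M + 1) / ε)
    rw [Finset.mem_Icc]
    constructor
    · have : ((-⌈(M + 1) / ε⌉ : ℤ) : ℝ) ≤ a := by push_cast; linarith [ha.1]
      exact_mod_cast this
    · exact_mod_cast ha.2.trans h3
  rw [latticeBox, Finset.mem_product]
  exact ⟨h2 _ ((PiLp.norm_apply_le (latticePt ε ν) 0).trans h1),
    h2 _ ((PiLp.norm_apply_le (latticePt ε ν) 1).trans h1)⟩

/-- The side has `2⌈(M + 1)/ε⌉ + 1` points; times `ε` this is at most `2(M + 1) + 3ε ≤ 2M + 5`. -/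
theorem card_latticeBox_mul_le {M ε : ℝ} (hM : 0 ≤ M) (hε : 0 < ε) (hε1 : ε ≤ 1) :
    ((latticeBox M ε).card : ℝ) * ε ^ 2 ≤ (2 * M + 5) ^ 2 := by
  have hc : (0 : ℤ) ≤ ⌈(M + 1) / ε⌉ := Int.ceil_nonneg (by positivity)
  have h1 : (((Finset.Icc (-⌈(M + 1) / ε⌉) ⌈(M + 1) / ε⌉).card : ℕ) : ℝ)
      = 2 * ⌈(M + 1) / ε⌉ + 1 := by
    rw [Int.card_Icc]
    have : (((⌈(M + 1) / ε⌉ + 1 - -⌈(M + 1) / ε⌉).toNat : ℤ) : ℝ)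
        = ((2 * ⌈(M + 1) / ε⌉ + 1 : ℤ) : ℝ) := by
      rw [Int.toNat_of_nonneg (by omega)]
      congr 1
      ring
    push_cast at this ⊢
    exact this
  have h2 : (⌈(M + 1) / ε⌉ : ℝ) * ε ≤ M + 1 + ε := by
    have := (Int.ceil_lt_add_one ((M + 1) / ε)).le
    calc (⌈(M + 1) / ε⌉ : ℝ) * ε ≤ ((M + 1) / ε + 1) * ε := by gcongr
      _ = M + 1 + ε := by field_simp
  rw [latticeBox, Finset.card_product, Nat.cast_mul, h1]
  have h3 : (0 : ℝ) ≤ ⌈(M + 1) / ε⌉ := by exact_mod_cast hc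
  calc (2 * (⌈(M + 1) / ε⌉ : ℝ) + 1) * (2 * ⌈(M + 1) / ε⌉ + 1) * ε ^ 2
      = (2 * (⌈(M + 1) / ε⌉ * ε) + ε) ^ 2 := by ring
    _ ≤ (2 * M + 5) ^ 2 := pow_le_pow_left₀ (by positivity) (by linarith) 2

/-- There are at most `(2M + 5)² / ε²` relevant rods, each of volume `π ε² r²` in the slab, so `ε`
cancels. -/
theorem volume_inter_rods_le {M : ℝ} (hM : 0 ≤ M) (hΩ : ∀ x ∈ Ω, x 2 ∈ Set.Ioo (0 : ℝ) 1)
    (hΩM : ∀ x ∈ Ω, ‖planeProj x‖ ≤ M) {ε r : ℝ} (hε : 0 < ε) (hε1 : ε ≤ 1) (hr : 0 < r)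
    (hr1 : r ≤ 1) :
    volume (Ω ∩ rods ε r) ≤ ENNReal.ofReal ((2 * M + 5) ^ 2 * (Real.pi * r ^ 2)) := by
  have hsub : Ω ∩ rods ε r ⊆ ⋃ ν ∈ latticeBox M ε,
      slab 0 1 ∩ planeProj ⁻¹' Metric.closedBall (latticePt ε ν) (ε * r) := by
    rintro x ⟨hx, ν, hν⟩
    refine Set.mem_iUnion₂.2 ⟨ν, mem_latticeBox hε (hΩM x hx) (hν.trans ?_), hΩ x hx, ?_⟩
    · nlinarith
    · simpa [dist_eq_norm] using hν
  refine (measure_mono hsub).trans ((measure_biUnion_finset_le _ _).trans ?_)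
  have h1 : ∀ ν, volume (slab 0 1 ∩ planeProj ⁻¹' Metric.closedBall (latticePt ε ν) (ε * r))
      = ENNReal.ofReal (Real.pi * (ε * r) ^ 2) := by
    intro ν
    rw [volume_slab_inter_preimage measurableSet_closedBall,
      EuclideanSpace.volume_closedBall_fin_two, ← ENNReal.ofReal_pow (by positivity),
      ← ENNReal.ofReal_mul (by positivity), ← ENNReal.ofReal_mul (by norm_num)]
    congr 1
    ring
  simp only [h1, Finset.sum_const, nsmul_eq_mul]
  rw [← ENNReal.ofReal_natCast, ← ENNReal.ofReal_mul (by positivity)]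
  refine ENNReal.ofReal_le_ofReal ?_
  have := card_latticeBox_mul_le hM hε hε1
  calc ((latticeBox M ε).card : ℝ) * (Real.pi * (ε * r) ^ 2)
      = ((latticeBox M ε).card * ε ^ 2) * (Real.pi * r ^ 2) := by ring
    _ ≤ _ := by gcongr

/-! ### A radial field with divergence concentrated in a disc -/

/-- The components of the planar field `y / max(|y|, ρ)²`. -/
def radialField (ρ : ℝ) (i : Fin 2) (y : E2) : ℝ := y i / max ‖y‖ ρ ^ 2

/-- The field has a kink on the circle of radius `ρ`; Lipschitz regularity is what still permits
integration by parts across it. -/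
theorem lipschitzWith_radialField {ρ : ℝ} (hρ : 0 < ρ) (i : Fin 2) :
    LipschitzWith (Real.toNNReal (3 / ρ ^ 2)) (radialField ρ i) := by
  refine LipschitzWith.of_dist_le_mul fun y z => ?_
  rw [Real.coe_toNNReal _ (by positivity), Real.dist_eq, dist_eq_norm]
  set a := max ‖y‖ ρ
  set b := max ‖z‖ ρ
  have ha : ρ ≤ a := le_max_right _ _
  have hb : ρ ≤ b := le_max_right _ _
  have ha0 : 0 < a := hρ.trans_le ha
  have hb0 : 0 < b := hρ.trans_le hb
  have hab : |b - a| ≤ ‖y - z‖ := by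
    refine (abs_max_sub_max_le_abs _ _ _).trans ?_
    rw [norm_sub_rev]
    exact abs_norm_sub_norm_le z y
  have hzi : |z i| ≤ b := (PiLp.norm_apply_le z i).trans (le_max_left _ _)
  have hyzi : |y i - z i| ≤ ‖y - z‖ := PiLp.norm_apply_le (y - z) i
  -- The difference is split into three terms, each at most `‖y - z‖ / ρ²` because `a, b ≥ ρ` and
  -- `|z i| ≤ b`; hence the constant `3 / ρ²`.
  have h1 : radialField ρ i y - radialField ρ i z
      = (y i - z i) / a ^ 2 + z i / b * ((b - a) / a ^ 2 + (b - a) / (a * b)) := by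
    simp only [radialField]
    change y i / a ^ 2 - z i / b ^ 2 = _
    field_simp
    ring
  have h2 : |z i / b| ≤ 1 := by
    rw [abs_div, abs_of_pos hb0]
    exact (div_le_one hb0).2 hzi
  have h3 : ∀ t : ℝ, |t| ≤ ‖y - z‖ → ∀ s, ρ ^ 2 ≤ s → |t / s| ≤ ‖y - z‖ / ρ ^ 2 := by
    intro t ht s hs
    have hs0 : 0 < s := lt_of_lt_of_le (by positivity) hs
    rw [abs_div, abs_of_pos hs0]
    gcongr
  have ha2 : ρ ^ 2 ≤ a ^ 2 := by gcongr
  have hab2 : ρ ^ 2 ≤ a * b := by rw [sq]; gcongr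
  rw [h1]
  calc |(y i - z i) / a ^ 2 + z i / b * ((b - a) / a ^ 2 + (b - a) / (a * b))|
      ≤ |(y i - z i) / a ^ 2| + |z i / b| * (|(b - a) / a ^ 2| + |(b - a) / (a * b)|) := by
        refine (abs_add_le _ _).trans ?_
        rw [abs_mul]
        gcongr
        exact abs_add_le _ _
    _ ≤ ‖y - z‖ / ρ ^ 2 + 1 * (‖y - z‖ / ρ ^ 2 + ‖y - z‖ / ρ ^ 2) := by
        gcongr
        · exact h3 _ hyzi _ ha2
        · exact h3 _ hab _ ha2
        · exact h3 _ hab _ hab2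
    _ = 3 / ρ ^ 2 * ‖y - z‖ := by ring

theorem hasLineDerivAt_radialField_of_lt {ρ : ℝ} {y : E2} (hy : ‖y‖ < ρ) (i : Fin 2) :
    HasLineDerivAt ℝ (radialField ρ i) (1 / ρ ^ 2) y (EuclideanSpace.single i 1) := by
  have hc : Continuous fun t : ℝ => ‖y + t • (EuclideanSpace.single i (1 : ℝ) : E2)‖ := by fun_prop
  have hev : ∀ᶠ t : ℝ in 𝓝 0, ‖y + t • (EuclideanSpace.single i (1 : ℝ) : E2)‖ < ρ :=
    hc.continuousAt.eventually_lt continuousAt_const (by simpa using hy)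
  have h1 : HasDerivAt (fun t : ℝ => (y i + t) / ρ ^ 2) (1 / ρ ^ 2) 0 :=
    ((hasDerivAt_id (0 : ℝ)).const_add (y i)).div_const _
  refine h1.congr_of_eventuallyEq ?_
  filter_upwards [hev] with t ht
  simp [radialField, max_eq_right ht.le]

/-- Outside the disc the field is `∇ log |y|`, which is harmonic in the plane: summed over the two
directions these derivatives cancel. -/
theorem hasLineDerivAt_radialField_of_gt {ρ : ℝ} (hρ : 0 < ρ) {y : E2} (hy : ρ < ‖y‖) (i : Fin 2) :
    HasLineDerivAt ℝ (radialField ρ i) ((‖y‖ ^ 2 - 2 * y i ^ 2) / ‖y‖ ^ 4) y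
      (EuclideanSpace.single i 1) := by
  have hy0 : 0 < ‖y‖ := hρ.trans hy
  have hc : Continuous fun t : ℝ => ‖y + t • (EuclideanSpace.single i (1 : ℝ) : E2)‖ := by fun_prop
  have hev : ∀ᶠ t : ℝ in 𝓝 0, ρ < ‖y + t • (EuclideanSpace.single i (1 : ℝ) : E2)‖ :=
    continuousAt_const.eventually_lt hc.continuousAt (by simpa using hy)
  have h1 : HasDerivAt (fun t : ℝ => y i + t) 1 0 := (hasDerivAt_id (0 : ℝ)).const_add (y i)
  have h2 : HasDerivAt (fun t : ℝ => ‖y‖ ^ 2 + 2 * y i * t + t ^ 2) (2 * y i) 0 := by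
    have := (((hasDerivAt_id (0 : ℝ)).const_mul (2 * y i)).const_add (‖y‖ ^ 2)).fun_add
      (hasDerivAt_pow 2 (0 : ℝ))
    simpa using this
  have h3 := h1.div h2 (by simpa using hy0.ne')
  have h4 : HasDerivAt (fun t : ℝ => (y i + t) / (‖y‖ ^ 2 + 2 * y i * t + t ^ 2))
      ((‖y‖ ^ 2 - 2 * y i ^ 2) / ‖y‖ ^ 4) 0 := by
    convert! h3 using 1
    simp
    ring
  refine h4.congr_of_eventuallyEq ?_
  filter_upwards [hev] with t ht
  have h5 : ‖y + t • (EuclideanSpace.single i (1 : ℝ) : E2)‖ ^ 2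
      = ‖y‖ ^ 2 + 2 * y i * t + t ^ 2 := by
    rw [norm_add_sq_real, real_inner_smul_right, norm_smul, EuclideanSpace.inner_single_right]
    simp
    ring
  simp only [radialField, max_eq_left ht.le, h5]
  simp

theorem volume_planeProj_preimage_eq_zero {s : Set E2} (hs : volume s = 0) :
    volume (planeProj ⁻¹' s) = 0 := by
  have h := measurePreserving_height_planeProj.quasiMeasurePreserving.preimage_null
    (s := (Set.univ : Set ℝ) ×ˢ s) (by
      rw [Measure.volume_eq_prod, Measure.prod_prod, hs, mul_zero])
  convert! h using 1
  congr 1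
  ext x
  simp

/-- The standard basis vectors of the plane, in space. -/
def planeVec (i : Fin 2) : E3 := EuclideanSpace.single i.castSucc 1

theorem planeProj_planeVec (i : Fin 2) : planeProj (planeVec i) = EuclideanSpace.single i 1 := by
  ext j
  fin_cases i <;> fin_cases j <;> simp [planeVec, planeProj_apply]

theorem fderiv_planeVec (ψ : E3 → ℝ) (x : E3) (i : Fin 2) :
    fderiv ℝ ψ x (planeVec i) = planeProj (gradient ψ x) i := by
  rw [planeVec, ← gradient_apply]
  fin_cases i <;> rfl

theorem hasLineDerivAt_radialField_comp {ρ d : ℝ} {c : E2} {x : E3} {i : Fin 2}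
    (h : HasLineDerivAt ℝ (radialField ρ i) d (planeProj x - c) (EuclideanSpace.single i 1)) :
    HasLineDerivAt ℝ (fun x => radialField ρ i (planeProj x - c)) d x (planeVec i) := by
  unfold HasLineDerivAt at h ⊢
  convert! h using 2 with t
  change radialField ρ i (planeProj (x + t • planeVec i) - c) = _
  rw [map_add, map_smul, planeProj_planeVec]
  congr 1
  abel

/-- Integration by parts against the radial field. -/
theorem integral_disc_eq {ρ : ℝ} (hρ : 0 < ρ) (c : E2) {ψ : E3 → ℝ} (hψ : IsTestFunction Ω ψ) :
    2 / ρ ^ 2 * ∫ x, (planeProj ⁻¹' Metric.closedBall c ρ).indicator ψ x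
      = - ∫ x, inner ℝ (planeProj x - c) (planeProj (gradient ψ x))
          / max ‖planeProj x - c‖ ρ ^ 2 := by
  set F : Fin 2 → E3 → ℝ := fun i x => radialField ρ i (planeProj x - c) with hF
  have hproj : LipschitzWith 1 (fun x : E3 => planeProj x - c) := by
    refine LipschitzWith.of_dist_le_mul fun x y => ?_
    rw [dist_sub_right, dist_eq_norm, dist_eq_norm, ← map_sub, NNReal.coe_one, one_mul]
    exact norm_planeProj_le _
  have hLip : ∀ i, LipschitzWith (Real.toNNReal (3 / ρ ^ 2) * 1) (F i) := fun i =>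
    (lipschitzWith_radialField hρ i).comp hproj
  -- Integration by parts is used in its version for two Lipschitz functions, one of compact
  -- support.
  obtain ⟨D, hD⟩ := hψ.1.lipschitzWith_of_hasCompactSupport hψ.2.1 (by simp)
  have hibp : ∀ i, ∫ x, lineDeriv ℝ (F i) x (planeVec i) * ψ x
      = - ∫ x, F i x * fderiv ℝ ψ x (planeVec i) := by
    intro i
    rw [(hLip i).integral_lineDeriv_mul_eq hD hψ.2.1, ← integral_neg]
    refine integral_congr_ae (ae_of_all _ fun x => ?_)
    simp only
    rw [(hψ.differentiable x).lineDeriv_eq_fderiv, map_neg]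
    ring
  have hint1 : ∀ i, Integrable (fun x => lineDeriv ℝ (F i) x (planeVec i) * ψ x) := by
    intro i
    refine (hψ.integrable volume).bdd_mul (c := (Real.toNNReal (3 / ρ ^ 2) * 1 : NNReal) *
      ‖planeVec i‖) ?_ ?_
    · exact (measurable_lineDeriv (hLip i).continuous).aestronglyMeasurable
    · exact ae_of_all _ fun x => norm_lineDeriv_le_of_lipschitz ℝ (hLip i)
  have hint2 : ∀ i, Integrable (fun x => F i x * fderiv ℝ ψ x (planeVec i)) := fun i =>
    ((hLip i).continuous.mul (hψ.fderiv_apply (planeVec i)).continuous).integrable_of_hasCompactSupport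
      (hψ.fderiv_apply (planeVec i)).2.1.mul_left
  have hae : ∀ᵐ x ∂(volume : Measure E3), ‖planeProj x - c‖ ≠ ρ := by
    have h := volume_planeProj_preimage_eq_zero
      (Measure.addHaar_sphere (volume : Measure E2) c ρ)
    rw [ae_iff]
    convert! h using 2
    ext x
    simp
  -- Away from the null cylinder over the circle, the divergence is `2 / ρ²` inside and zero
  -- outside.
  have hdiv : ∀ᵐ x ∂(volume : Measure E3),
      lineDeriv ℝ (F 0) x (planeVec 0) * ψ x + lineDeriv ℝ (F 1) x (planeVec 1) * ψ x
      = 2 / ρ ^ 2 * (planeProj ⁻¹' Metric.closedBall c ρ).indicator ψ x := by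
    filter_upwards [hae] with x hx
    rcases lt_or_gt_of_ne hx with h | h
    · have hm : x ∈ planeProj ⁻¹' Metric.closedBall c ρ := by
        simpa [dist_eq_norm] using h.le
      rw [(hasLineDerivAt_radialField_comp (hasLineDerivAt_radialField_of_lt h 0)).lineDeriv,
        (hasLineDerivAt_radialField_comp (hasLineDerivAt_radialField_of_lt h 1)).lineDeriv,
        Set.indicator_of_mem hm]
      ring
    · have hm : x ∉ planeProj ⁻¹' Metric.closedBall c ρ := by
        simpa [dist_eq_norm] using h
      rw [(hasLineDerivAt_radialField_comp (hasLineDerivAt_radialField_of_gt hρ h 0)).lineDeriv,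
        (hasLineDerivAt_radialField_comp (hasLineDerivAt_radialField_of_gt hρ h 1)).lineDeriv,
        Set.indicator_of_notMem hm, ← add_mul, ← add_div]
      have : ‖planeProj x - c‖ ^ 2 - 2 * (planeProj x - c) 0 ^ 2 +
          (‖planeProj x - c‖ ^ 2 - 2 * (planeProj x - c) 1 ^ 2) = 0 := by
        rw [norm_sq_E2]
        ring
      rw [this]
      simp
  rw [← integral_const_mul, ← integral_congr_ae hdiv, integral_add (hint1 0) (hint1 1), hibp, hibp,
    ← neg_add, ← integral_add (hint2 0) (hint2 1)]
  congr 1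
  refine integral_congr_ae (ae_of_all _ fun x => ?_)
  simp only [hF, radialField, fderiv_planeVec, PiLp.inner_apply, Fin.sum_univ_two,
    RCLike.inner_apply, conj_trivial]
  ring

/-! ### Comparison of thin rods with thick rods -/

theorem integral_mul_le_sqrt_mul_sqrt {μ : Measure E3} {f g : E3 → ℝ} (hf : MemLp f 2 μ)
    (hg : MemLp g 2 μ) : ∫ x, f x * g x ∂μ ≤ √(∫ x, f x ^ 2 ∂μ) * √(∫ x, g x ^ 2 ∂μ) := by
  have h := real_inner_le_norm (hf.toLp f) (hg.toLp g)
  have h1 : inner ℝ (hf.toLp f) (hg.toLp g) = ∫ x, f x * g x ∂μ := by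
    rw [L2.inner_def]
    refine integral_congr_ae ?_
    filter_upwards [hf.coeFn_toLp, hg.coeFn_toLp] with x h1 h2
    rw [h1, h2]
    simp [mul_comm]
  have h2 : ∀ {k : E3 → ℝ} (hk : MemLp k 2 μ), ‖hk.toLp k‖ = √(∫ x, k x ^ 2 ∂μ) := by
    intro k hk
    have := norm_toLp_sq hk
    simp only [Real.norm_eq_abs, sq_abs] at this
    rw [← this, Real.sqrt_sq (norm_nonneg _)]
  rwa [h1, h2, h2] at h

/-- A majorant of the difference of two radial fields. -/
def discKernel (a b t : ℝ) : ℝ := if t < b then 1 / max t a else 0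

theorem discKernel_nonneg {a b t : ℝ} (ha : 0 < a) : 0 ≤ discKernel a b t := by
  unfold discKernel
  split_ifs
  · have : 0 < max t a := lt_max_of_lt_right ha
    positivity
  · exact le_rfl

theorem discKernel_le {a b t : ℝ} (ha : 0 < a) : discKernel a b t ≤ 1 / a := by
  unfold discKernel
  split_ifs
  · exact one_div_le_one_div_of_le ha (le_max_right _ _)
  · positivity

theorem measurable_discKernel (a b : ℝ) : Measurable (discKernel a b) :=
  Measurable.ite measurableSet_Iio (by fun_prop) measurable_const

/-- The radial fields for radii `a` and `b` coincide beyond `b`; below `b`, the difference of their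
coefficients lies between `0` and `1 / max t a ^ 2`. -/
theorem abs_mul_sub_le_discKernel {a b t : ℝ} (ha : 0 < a) (hab : a ≤ b) :
    t * |1 / max t a ^ 2 - 1 / max t b ^ 2| ≤ discKernel a b t := by
  unfold discKernel
  split_ifs with h
  · have hm : 0 < max t a := lt_max_of_lt_right ha
    have h1 : max t a ≤ b := max_le h.le hab
    rw [max_eq_right h.le]
    have h2 : 1 / b ^ 2 ≤ 1 / max t a ^ 2 := by gcongr
    rw [abs_of_nonneg (by linarith)]
    have h3 : 0 ≤ 1 / b ^ 2 := by positivity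
    calc t * (1 / max t a ^ 2 - 1 / b ^ 2) ≤ max t a * (1 / max t a ^ 2) := by
          gcongr
          · exact le_max_left _ _
          · linarith
      _ = 1 / max t a := by field_simp
  · rw [not_lt] at h
    rw [max_eq_left h, max_eq_left (hab.trans h)]
    simp

/-- In polar coordinates the integrand `t · k(t)²` is at most `1/a` on `(0, a]`, contributing `1`,
and equals `1/t` on `(a, b)`, contributing `log (b / a)`. This is the source of the logarithm in the
critical scale `ε² |ln r|`. -/
theorem integral_discKernel_sq_le {a b : ℝ} (ha : 0 < a) (hab : a ≤ b) :
    ∫ y : E2, discKernel a b ‖y‖ ^ 2 ≤ 2 * Real.pi * (1 + Real.log (b / a)) := by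
  have h := integral_fun_norm_addHaar (volume : Measure E2) (fun t => discKernel a b t ^ 2)
  have hvol : (volume : Measure E2).real (Metric.ball 0 1) = Real.pi := by
    rw [Measure.real, EuclideanSpace.volume_ball_fin_two]
    simp [Real.pi_nonneg]
  rw [h, hvol]
  simp only [finrank_euclideanSpace, Fintype.card_fin, Nat.add_one_sub_one, pow_one, smul_eq_mul,
    nsmul_eq_mul, Nat.cast_ofNat]
  rw [← mul_assoc]
  refine mul_le_mul_of_nonneg_left ?_ (by positivity)
  have hb : 0 < b := ha.trans_le hab
  set g : ℝ → ℝ := fun t => (Set.Ioc 0 a).indicator (fun _ => 1 / a) t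
    + (Set.Ioc a b).indicator (fun t => t⁻¹) t with hg
  have hi1 : Integrable (fun t => (Set.Ioc 0 a).indicator (fun _ => 1 / a) t) :=
    (integrableOn_const (by simp)).integrable_indicator measurableSet_Ioc
  have hi2 : Integrable (fun t => (Set.Ioc a b).indicator (fun t : ℝ => t⁻¹) t) := by
    have hc : ContinuousOn (fun t : ℝ => t⁻¹) (Set.Icc a b) :=
      continuousOn_inv₀.mono fun t ht => (ha.trans_le ht.1).ne'
    exact (hc.integrableOn_Icc.mono_set Set.Ioc_subset_Icc_self).integrable_indicator
      measurableSet_Ioc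
  have hle : ∀ t ∈ Set.Ioi (0 : ℝ), t * discKernel a b t ^ 2 ≤ g t := by
    intro t ht
    have ht0 : 0 < t := ht
    by_cases hta : t ≤ a
    · have h1 : g t = 1 / a := by
        have : t ∉ Set.Ioc a b := fun h => absurd h.1 (not_lt.2 hta)
        simp [hg, Set.indicator_of_mem (show t ∈ Set.Ioc 0 a from ⟨ht0, hta⟩),
          Set.indicator_of_notMem this]
      rw [h1]
      have h2 := discKernel_le (b := b) (t := t) ha
      have h3 := discKernel_nonneg (b := b) (t := t) ha
      calc t * discKernel a b t ^ 2 ≤ a * (1 / a) ^ 2 := by gcongr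
        _ = 1 / a := by field_simp
    · rw [not_le] at hta
      have hn : t ∉ Set.Ioc 0 a := fun h => absurd h.2 (not_le.2 hta)
      by_cases htb : t < b
      · have h1 : g t = t⁻¹ := by
          simp [hg, Set.indicator_of_mem (show t ∈ Set.Ioc a b from ⟨hta, htb.le⟩),
            Set.indicator_of_notMem hn]
        rw [h1, discKernel, if_pos htb, max_eq_left hta.le]
        apply le_of_eq
        field_simp
      · rw [discKernel, if_neg htb]
        simp only [ne_eq, OfNat.ofNat_ne_zero, not_false_eq_true, zero_pow, mul_zero]
        refine add_nonneg (Set.indicator_nonneg (fun _ _ => by positivity) _)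
          (Set.indicator_nonneg (fun t ht => ?_) _)
        exact inv_nonneg.2 (ha.trans ht.1).le
  calc ∫ t in Set.Ioi (0 : ℝ), t * discKernel a b t ^ 2 ≤ ∫ t in Set.Ioi (0 : ℝ), g t := by
        refine integral_mono_of_nonneg ?_ ((hi1.add hi2).integrableOn) ?_
        · filter_upwards [ae_restrict_mem measurableSet_Ioi] with t ht
          exact mul_nonneg (le_of_lt ht) (sq_nonneg _)
        · filter_upwards [ae_restrict_mem measurableSet_Ioi] with t ht
          exact hle t ht
    _ ≤ ∫ t, g t := by
        refine setIntegral_le_integral (hi1.add hi2) (ae_of_all _ fun t => ?_)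
        refine add_nonneg (Set.indicator_nonneg (fun _ _ => by positivity) _)
          (Set.indicator_nonneg (fun t ht => ?_) _)
        exact inv_nonneg.2 (ha.trans ht.1).le
    _ = 1 + Real.log (b / a) := by
        rw [hg, integral_add hi1 hi2, integral_indicator measurableSet_Ioc,
          integral_indicator measurableSet_Ioc]
        congr 1
        · rw [setIntegral_const]
          simp [ha.le, ha.ne']
        · rw [← intervalIntegral.integral_of_le hab, integral_inv_of_pos ha hb]

theorem integral_slab_comp_planeProj (F : E2 → ℝ) (hF : Measurable F) :
    ∫ x in slab 0 1, F (planeProj x) = ∫ y, F y := by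
  rw [← integral_map planeProj.continuous.measurable.aemeasurable hF.aestronglyMeasurable,
    map_planeProj_slab]
  simp

theorem integral_slab_discKernel_sq_le {a b : ℝ} (ha : 0 < a) (hab : a ≤ b) (c : E2) :
    ∫ x in slab 0 1, discKernel a b ‖planeProj x - c‖ ^ 2
      ≤ 2 * Real.pi * (1 + Real.log (b / a)) := by
  rw [integral_slab_comp_planeProj (fun y => discKernel a b ‖y - c‖ ^ 2)
    (((measurable_discKernel a b).comp (by fun_prop)).pow_const 2),
    integral_sub_right_eq_self (fun y : E2 => discKernel a b ‖y‖ ^ 2)]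
  exact integral_discKernel_sq_le ha hab

theorem memLp_discKernel {a b : ℝ} (ha : 0 < a) (c : E2) :
    MemLp (fun x => discKernel a b ‖planeProj x - c‖) 2 (volume.restrict (slab 0 1)) := by
  have hm : Measurable (fun x => discKernel a b ‖planeProj x - c‖) :=
    (measurable_discKernel a b).comp (by fun_prop)
  set s : Set E3 := planeProj ⁻¹' Metric.ball c b with hs
  have hsm : MeasurableSet s := planeProj.continuous.measurable measurableSet_ball
  have hfin : (volume.restrict (slab 0 1)) s ≠ ⊤ := by
    rw [Measure.restrict_apply hsm, Set.inter_comm, hs,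
      volume_slab_inter_preimage measurableSet_ball]
    exact ENNReal.mul_ne_top (by simp) measure_ball_lt_top.ne
  have h1 : MemLp (s.indicator fun _ => 1 / a) 2 (volume.restrict (slab 0 1)) :=
    memLp_indicator_const 2 hsm _ (Or.inr hfin)
  refine h1.of_le hm.aestronglyMeasurable (ae_of_all _ fun x => ?_)
  rw [Real.norm_of_nonneg (discKernel_nonneg ha)]
  by_cases hx : x ∈ s
  · rw [Set.indicator_of_mem hx]
    exact (discKernel_le ha).trans (le_abs_self _)
  · have : ¬ ‖planeProj x - c‖ < b := by
      rw [hs, Set.mem_preimage, mem_ball_iff_norm] at hx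
      exact hx
    simp [discKernel, this]

/-- Rods of relative radius below `1/2` are disjoint, and those outside the finite index box do not
meet `Ω`, off which `ψ` vanishes. -/
theorem indicator_rods_eq_sum {M : ℝ} (hΩM : ∀ x ∈ Ω, ‖planeProj x‖ ≤ M) {ψ : E3 → ℝ}
    (hψ : IsTestFunction Ω ψ) {ε r : ℝ} (hε : 0 < ε) (hε1 : ε ≤ 1) (hr2 : r < 1 / 2) (x : E3) :
    (rods ε r).indicator ψ x = ∑ ν ∈ latticeBox M ε,
      (planeProj ⁻¹' Metric.closedBall (latticePt ε ν) (ε * r)).indicator ψ x := by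
  by_cases hx : x ∈ Ω
  · by_cases hxr : x ∈ rods ε r
    · rw [Set.indicator_of_mem hxr]
      obtain ⟨ν, hν⟩ := hxr
      have hmem : x ∈ planeProj ⁻¹' Metric.closedBall (latticePt ε ν) (ε * r) := by
        simpa [dist_eq_norm] using hν
      rw [Finset.sum_eq_single ν, Set.indicator_of_mem hmem]
      · intro ν' _ hne
        refine Set.indicator_of_notMem (fun h => hne ?_) _
        have h' : ‖planeProj x - latticePt ε ν'‖ ≤ ε * r := by simpa [dist_eq_norm] using h
        exact eq_of_norm_sub_latticePt_lt hε (y := planeProj x) (by nlinarith) (by nlinarith)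
      · intro h
        exact absurd (mem_latticeBox hε (hΩM x hx) (hν.trans (by nlinarith))) h
    · rw [Set.indicator_of_notMem hxr, Finset.sum_eq_zero]
      intro ν _
      refine Set.indicator_of_notMem (fun h => hxr ⟨ν, ?_⟩) _
      rwa [Set.mem_preimage, mem_closedBall_iff_norm] at h
  · have h0 : ∀ s : Set E3, s.indicator ψ x = 0 := fun s => by
      by_cases h : x ∈ s <;> simp [h, hψ.eq_zero hx]
    simp only [h0, Finset.sum_const_zero]

/-- After normalization the prefactor `(ε r)² / (2 π r²) = ε² / (2π)` no longer depends on `r`. Two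
radii can then be compared by subtracting radial fields rod by rod. -/
theorem integral_rods_eq_sum {M : ℝ} (hΩM : ∀ x ∈ Ω, ‖planeProj x‖ ≤ M) {ψ : E3 → ℝ}
    (hψ : IsTestFunction Ω ψ) {ε r : ℝ} (hε : 0 < ε) (hε1 : ε ≤ 1) (hr : 0 < r) (hr2 : r < 1 / 2) :
    1 / (Real.pi * r ^ 2) * ∫ x, (rods ε r).indicator ψ x = - (ε ^ 2 / (2 * Real.pi) *
      ∑ ν ∈ latticeBox M ε, ∫ x, inner ℝ (planeProj x - latticePt ε ν) (planeProj (gradient ψ x))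
          / max ‖planeProj x - latticePt ε ν‖ (ε * r) ^ 2) := by
  have hI : ∀ ν, Integrable
      ((planeProj ⁻¹' Metric.closedBall (latticePt ε ν) (ε * r)).indicator ψ) := fun ν =>
    (hψ.integrable volume).indicator (planeProj.continuous.measurable measurableSet_closedBall)
  have h1 : ∫ x, (rods ε r).indicator ψ x = ∑ ν ∈ latticeBox M ε,
      ∫ x, (planeProj ⁻¹' Metric.closedBall (latticePt ε ν) (ε * r)).indicator ψ x := by
    rw [← integral_finsetSum _ fun ν _ => hI ν]
    exact integral_congr_ae (ae_of_all _ fun x =>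
      indicator_rods_eq_sum hΩM hψ hε hε1 hr2 x)
  have hρ : 0 < ε * r := by positivity
  have h2 : ∀ ν, ∫ x, (planeProj ⁻¹' Metric.closedBall (latticePt ε ν) (ε * r)).indicator ψ x
      = (ε * r) ^ 2 / 2 * - ∫ x, inner ℝ (planeProj x - latticePt ε ν) (planeProj (gradient ψ x))
          / max ‖planeProj x - latticePt ε ν‖ (ε * r) ^ 2 := by
    intro ν
    rw [← integral_disc_eq hρ _ hψ]
    field_simp
  rw [h1]
  simp only [h2]
  rw [← Finset.mul_sum, Finset.sum_neg_distrib]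
  have := Real.pi_pos
  field_simp

/-- The normalized thin rods are close to the normalized thick rods in the dual of `H¹`. -/
theorem abs_thin_sub_thick_le {M : ℝ} (hM : 0 ≤ M) (hΩ : ∀ x ∈ Ω, x 2 ∈ Set.Ioo (0 : ℝ) 1)
    (hΩM : ∀ x ∈ Ω, ‖planeProj x‖ ≤ M) {ψ : E3 → ℝ}
    (hψ : IsTestFunction Ω ψ) {ε r R : ℝ} (hε : 0 < ε) (hε1 : ε ≤ 1) (hr : 0 < r) (hrR : r ≤ R)
    (hR : R < 1 / 2) :
    |1 / (Real.pi * r ^ 2) * (∫ x, (rods ε r).indicator ψ x)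
      - 1 / (Real.pi * R ^ 2) * ∫ x, (rods ε R).indicator ψ x|
      ≤ (2 * M + 5) * ε * √(1 + Real.log (R / r)) * √(∫ x in Ω, ‖gradient ψ x‖ ^ 2) := by
  have hR0 : 0 < R := hr.trans_le hrR
  have ha : 0 < ε * r := by positivity
  have hab : ε * r ≤ ε * R := by gcongr
  set S := latticeBox M ε with hS
  set c := latticePt ε with hc
  set T : ℝ → ℤ × ℤ → E3 → ℝ := fun ρ ν x =>
    inner ℝ (planeProj x - c ν) (planeProj (gradient ψ x)) / max ‖planeProj x - c ν‖ ρ ^ 2 with hT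
  set k : ℤ × ℤ → E3 → ℝ := fun ν x => discKernel (ε * r) (ε * R) ‖planeProj x - c ν‖ with hk
  have hgc : Continuous (gradient ψ) := continuous_gradient hψ.1
  have hTi : ∀ ρ, 0 < ρ → ∀ ν, Integrable (T ρ ν) := by
    intro ρ hρ ν
    have h1 : Continuous (T ρ ν) := by
      refine Continuous.div (by fun_prop) (by fun_prop) fun x => ?_
      have : 0 < max ‖planeProj x - c ν‖ ρ := lt_max_of_lt_right hρ
      positivity
    refine h1.integrable_of_hasCompactSupport
      ((hasCompactSupport_gradient hψ.2.1).mono fun x hx h => hx ?_)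
    simp [hT, h]
  have hTz : ∀ ρ ν x, x ∉ slab 0 1 → T ρ ν x = 0 := by
    intro ρ ν x hx
    have : gradient ψ x = 0 := hψ.gradient_eq_zero fun h => hx (hΩ x h)
    simp [hT, this]
  have hTk : ∀ ν x, |T (ε * r) ν x - T (ε * R) ν x| ≤ k ν x * ‖gradient ψ x‖ := by
    intro ν x
    have h1 : T (ε * r) ν x - T (ε * R) ν x = inner ℝ (planeProj x - c ν) (planeProj (gradient ψ x))
        * (1 / max ‖planeProj x - c ν‖ (ε * r) ^ 2 - 1 / max ‖planeProj x - c ν‖ (ε * R) ^ 2) := by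
      simp only [hT]
      ring
    rw [h1, abs_mul]
    calc _ ≤ (‖planeProj x - c ν‖ * ‖gradient ψ x‖) *
          |1 / max ‖planeProj x - c ν‖ (ε * r) ^ 2 - 1 / max ‖planeProj x - c ν‖ (ε * R) ^ 2| := by
          gcongr
          refine (abs_real_inner_le_norm _ _).trans ?_
          gcongr
          exact norm_planeProj_le _
      _ = (‖planeProj x - c ν‖ *
          |1 / max ‖planeProj x - c ν‖ (ε * r) ^ 2 - 1 / max ‖planeProj x - c ν‖ (ε * R) ^ 2|)
          * ‖gradient ψ x‖ := by ring
      _ ≤ _ := by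
          gcongr
          exact abs_mul_sub_le_discKernel ha hab
  have hkL : ∀ ν, MemLp (k ν) 2 (volume.restrict (slab 0 1)) := fun ν => memLp_discKernel ha (c ν)
  have hgL : MemLp (fun x => ‖gradient ψ x‖) 2 (volume.restrict (slab 0 1)) :=
    (hψ.memLp_gradient 2 _).norm
  have hkg : ∀ ν, Integrable (fun x => k ν x * ‖gradient ψ x‖) (volume.restrict (slab 0 1)) :=
    fun ν => (hkL ν).integrable_mul hgL
  have hone : ∀ ν, |(∫ x, T (ε * r) ν x) - ∫ x, T (ε * R) ν x|
      ≤ ∫ x in slab 0 1, k ν x * ‖gradient ψ x‖ := by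
    intro ν
    rw [← integral_sub (hTi _ ha ν) (hTi _ (by positivity) ν),
      ← setIntegral_eq_integral_of_support (Ω := slab 0 1)
        (fun x hx => by rw [hTz _ ν x hx, hTz _ ν x hx, sub_zero])]
    refine abs_integral_le_integral_abs.trans
      (integral_mono_of_nonneg (ae_of_all _ fun x => abs_nonneg _) (hkg ν)
        (ae_of_all _ fun x => hTk ν x))
  -- The kernels are supported in discs of radius `ε R < ε / 2` around lattice points, so at most
  -- one is nonzero at each point. Their squared `L²` norms therefore add without cross terms.
  have hJsq : ∀ x, (∑ ν ∈ S, k ν x) ^ 2 = ∑ ν ∈ S, k ν x ^ 2 := by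
    intro x
    by_cases h : ∃ ν ∈ S, k ν x ≠ 0
    · obtain ⟨ν, hν, hne⟩ := h
      have h0 : ∀ {ν'}, k ν' x ≠ 0 → ‖planeProj x - c ν'‖ < ε / 2 := by
        intro ν' h
        have : ‖planeProj x - c ν'‖ < ε * R := by
          by_contra hcon
          exact h (by simp [hk, discKernel, hcon])
        nlinarith
      have h1 : ∀ ν' ∈ S, ν' ≠ ν → k ν' x = 0 := by
        intro ν' _ hne'
        by_contra hcon
        exact hne' (eq_of_norm_sub_latticePt_lt hε (h0 hcon) (h0 hne))
      rw [Finset.sum_eq_single_of_mem ν hν h1,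
        Finset.sum_eq_single_of_mem ν hν fun ν' h h' => by rw [h1 ν' h h', zero_pow two_ne_zero]]
    · push Not at h
      rw [Finset.sum_eq_zero h, Finset.sum_eq_zero fun ν hν => by rw [h ν hν, zero_pow two_ne_zero],
        zero_pow two_ne_zero]
  set ℓ := 1 + Real.log (R / r) with hℓ
  have hℓ0 : 0 ≤ ℓ := by
    have : 0 ≤ Real.log (R / r) := Real.log_nonneg ((one_le_div hr).2 hrR)
    positivity
  have hJL : MemLp (fun x => ∑ ν ∈ S, k ν x) 2 (volume.restrict (slab 0 1)) :=
    memLp_finsetSum _ fun ν _ => hkL ν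
  have hJ : ∫ x in slab 0 1, (∑ ν ∈ S, k ν x) ^ 2 ≤ S.card * (2 * Real.pi * ℓ) := by
    simp only [hJsq]
    rw [integral_finsetSum _ fun ν _ => (hkL ν).integrable_sq]
    refine (Finset.sum_le_card_nsmul _ _ (2 * Real.pi * ℓ) fun ν _ => ?_).trans_eq
      (nsmul_eq_mul _ _)
    have := integral_slab_discKernel_sq_le ha hab (c ν)
    rwa [mul_div_mul_left _ _ hε.ne'] at this
  have hG : ∫ x in slab 0 1, ‖gradient ψ x‖ ^ 2 = ∫ x in Ω, ‖gradient ψ x‖ ^ 2 := by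
    rw [setIntegral_eq_integral_of_support fun x hx => by
        simp [hψ.gradient_eq_zero fun h => hx (hΩ x h)],
      setIntegral_eq_integral_of_support fun x hx => by simp [hψ.gradient_eq_zero hx]]
  have hsum : |(∑ ν ∈ S, ∫ x, T (ε * r) ν x) - ∑ ν ∈ S, ∫ x, T (ε * R) ν x|
      ≤ √(S.card * (2 * Real.pi * ℓ)) * √(∫ x in Ω, ‖gradient ψ x‖ ^ 2) := by
    rw [← Finset.sum_sub_distrib]
    refine (Finset.abs_sum_le_sum_abs _ _).trans ((Finset.sum_le_sum fun ν _ => hone ν).trans ?_)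
    rw [← integral_finsetSum _ fun ν _ => hkg ν]
    simp only [← Finset.sum_mul]
    refine (integral_mul_le_sqrt_mul_sqrt hJL hgL).trans ?_
    rw [hG]
    gcongr
  rw [integral_rods_eq_sum hΩM hψ hε hε1 hr (hrR.trans_lt hR),
    integral_rods_eq_sum hΩM hψ hε hε1 hR0 hR, ← neg_sub', ← mul_sub, abs_neg, abs_mul,
    abs_of_pos (by positivity)]
  refine (mul_le_mul_of_nonneg_left hsum (by positivity)).trans ?_
  rw [← mul_assoc]
  refine mul_le_mul_of_nonneg_right ?_ (Real.sqrt_nonneg _)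
  have hcard := card_latticeBox_mul_le hM hε hε1
  -- One factor `ε` of the prefactor compensates the square root of the number of rods; the other
  -- survives as the gain.
  have h1 : √((S.card : ℝ) * (2 * Real.pi * ℓ)) * ε ≤ (2 * M + 5) * √(2 * Real.pi) * √ℓ := by
    have h2 : √((S.card : ℝ) * (2 * Real.pi * ℓ)) * ε
        = √(((S.card : ℝ) * ε ^ 2) * (2 * Real.pi * ℓ)) := by
      conv_lhs => rw [← Real.sqrt_sq hε.le, ← Real.sqrt_mul (by positivity)]
      congr 1
      ring
    have h3 : (2 * M + 5) * √(2 * Real.pi) * √ℓ = √((2 * M + 5) ^ 2 * (2 * Real.pi * ℓ)) := by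
      rw [Real.sqrt_mul (sq_nonneg (2 * M + 5)), Real.sqrt_sq (by positivity),
        Real.sqrt_mul (show 0 ≤ 2 * Real.pi by positivity) ℓ, mul_assoc]
    rw [h2, h3]
    gcongr
  -- A crude bound whose only purpose is to cancel the `2π` of the prefactor.
  have h4 : √(2 * Real.pi) ≤ 2 * Real.pi := by
    rw [Real.sqrt_le_left (by positivity)]
    nlinarith [Real.pi_gt_three]
  calc ε ^ 2 / (2 * Real.pi) * √((S.card : ℝ) * (2 * Real.pi * ℓ))
      = ε / (2 * Real.pi) * (√((S.card : ℝ) * (2 * Real.pi * ℓ)) * ε) := by ring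
    _ ≤ ε / (2 * Real.pi) * ((2 * M + 5) * (2 * Real.pi) * √ℓ) := by
        refine mul_le_mul_of_nonneg_left (h1.trans ?_) (by positivity)
        gcongr
    _ = (2 * M + 5) * ε * √ℓ := by
        have := Real.pi_pos
        field_simp

/-! ### Thick rods and averages over translations -/

/-- The `L¹` modulus of continuity of a smooth function is controlled by its gradient. -/
theorem integral_abs_translate_sub_le {ψ : E3 → ℝ} (hψ : IsTestFunction Ω ψ) (v : E3) :
    ∫ x, |ψ (x + v) - ψ x| ≤ ‖v‖ * ∫ x, ‖gradient ψ x‖ := by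
  have hgc : Continuous (gradient ψ) := continuous_gradient hψ.1
  have hgi : Integrable (fun x => ‖gradient ψ x‖) :=
    (memLp_one_iff_integrable.1 (hψ.memLp_gradient 1 volume)).norm
  set μ : Measure ℝ := volume.restrict (Set.Ioc 0 1) with hμ
  have hF : Continuous (fun p : E3 × ℝ => ‖gradient ψ (p.1 + p.2 • v)‖) := by fun_prop
  have hFi : Integrable (fun p : E3 × ℝ => ‖gradient ψ (p.1 + p.2 • v)‖) (volume.prod μ) := by
    rw [integrable_prod_iff' hF.aestronglyMeasurable]
    constructor
    · exact ae_of_all _ fun t => hgi.comp_add_right (t • v)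
    · simp only [norm_norm]
      have : ∀ t : ℝ, ∫ x, ‖gradient ψ (x + t • v)‖ = ∫ x, ‖gradient ψ x‖ := fun t =>
        integral_add_right_eq_self (fun x => ‖gradient ψ x‖) (t • v)
      simp only [this]
      exact integrable_const _
  -- The fundamental theorem of calculus along the segment; integrating in `x` and using translation
  -- invariance for each `t` then finishes.
  have hpt : ∀ x, |ψ (x + v) - ψ x| ≤ ‖v‖ * ∫ t, ‖gradient ψ (x + t • v)‖ ∂μ := by
    intro x
    have hd : ∀ t ∈ Set.uIcc (0 : ℝ) 1, HasDerivAt (fun t : ℝ => ψ (x + t • v))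
        (fderiv ℝ ψ (x + t • v) v) t := by
      intro t _
      have h1 : HasDerivAt (fun t : ℝ => x + t • v) v t := by
        simpa using ((hasDerivAt_id t).smul_const v).const_add x
      exact (hψ.differentiable _).hasFDerivAt.comp_hasDerivAt t h1
    have hc : Continuous (fun t : ℝ => fderiv ℝ ψ (x + t • v) v) :=
      (hψ.fderiv_apply v).continuous.comp (by fun_prop)
    have h2 := intervalIntegral.integral_eq_sub_of_hasDerivAt hd (hc.intervalIntegrable 0 1)
    simp only [one_smul, zero_smul, add_zero] at h2
    rw [← h2, intervalIntegral.integral_of_le zero_le_one, ← hμ, ← integral_const_mul]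
    refine abs_integral_le_integral_abs.trans (integral_mono_of_nonneg
      (ae_of_all _ fun t => abs_nonneg _) ?_ (ae_of_all _ fun t => ?_))
    · refine Integrable.const_mul ?_ _
      have hc' : Continuous (fun t : ℝ => ‖gradient ψ (x + t • v)‖) := by fun_prop
      exact (hc'.integrableOn_Icc (a := 0) (b := 1)).mono_set Set.Ioc_subset_Icc_self
    · have := (fderiv ℝ ψ (x + t • v)).le_opNorm v
      rw [← norm_gradient] at this
      simpa [mul_comm] using this
  calc ∫ x, |ψ (x + v) - ψ x| ≤ ∫ x, ‖v‖ * ∫ t, ‖gradient ψ (x + t • v)‖ ∂μ :=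
        integral_mono_of_nonneg (ae_of_all _ fun x => abs_nonneg _)
          (hFi.integral_prod_left.const_mul _) (ae_of_all _ hpt)
    _ = ‖v‖ * ∫ t, (∫ x, ‖gradient ψ (x + t • v)‖) ∂μ := by
        rw [integral_const_mul, integral_integral_swap hFi]
    _ = ‖v‖ * ∫ x, ‖gradient ψ x‖ := by
        have : ∀ t : ℝ, ∫ x, ‖gradient ψ (x + t • v)‖ = ∫ x, ‖gradient ψ x‖ := fun t =>
          integral_add_right_eq_self (fun x => ‖gradient ψ x‖) (t • v)
        simp only [this]
        simp [hμ]

/-! ### Tiling the plane by unit squares, and averaging over a period. -/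

/-- The half-open unit square. -/
def unitSquare : Set E2 := {w | ∀ i, w i ∈ Set.Ico (0 : ℝ) 1}

theorem measurableSet_unitSquare : MeasurableSet unitSquare := by
  have : unitSquare = ⋂ i, (fun x : E2 => x i) ⁻¹' Set.Ico (0 : ℝ) 1 := by
    ext x
    simp [unitSquare]
  rw [this]
  exact MeasurableSet.iInter fun i =>
    (by fun_prop : Continuous (fun x : E2 => x i)).measurable measurableSet_Ico

theorem volume_unitSquare : volume unitSquare = 1 := by
  have h := (PiLp.volume_preserving_ofLp (Fin 2)).measure_preimage
    (MeasurableSet.univ_pi fun _ : Fin 2 => measurableSet_Ico (a := (0 : ℝ)) (b := 1)).nullMeasurableSet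
  have h1 : unitSquare = (WithLp.ofLp : E2 → Fin 2 → ℝ) ⁻¹' Set.univ.pi fun _ => Set.Ico (0 : ℝ) 1 := by
    ext x
    simp [unitSquare]
  rw [h1, h, Real.volume_pi_Ico]
  simp

theorem norm_le_of_mem_unitSquare {w : E2} (hw : w ∈ unitSquare) : ‖w‖ ≤ 2 := by
  refine (sq_le_sq₀ (norm_nonneg _) (by norm_num)).1 ?_
  rw [norm_sq_E2]
  have h0 := hw 0
  have h1 := hw 1
  nlinarith [h0.1, h0.2, h1.1, h1.2]

/-- The translates of the unit square by integer vectors tile the plane. -/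
theorem volume_unitSquare_inter {t : Set E2} (ht : MeasurableSet t)
    (hdisj : ∀ w ν ν', w - latticePt 1 ν ∈ t → w - latticePt 1 ν' ∈ t → ν = ν') :
    volume (unitSquare ∩ {w | ∃ ν, w - latticePt 1 ν ∈ t}) = volume t := by
  have h1 : unitSquare ∩ {w | ∃ ν, w - latticePt 1 ν ∈ t}
      = ⋃ ν, unitSquare ∩ (fun w => w - latticePt 1 ν) ⁻¹' t := by
    ext w
    simp
  -- Cut `t` along the integer translates of the square. Sliding each piece back into the square
  -- preserves its area, and `hdisj` says that the slid pieces do not overlap.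
  have h2 : t = ⋃ ν, (fun w => w + latticePt 1 ν) ⁻¹' unitSquare ∩ t := by
    ext w
    simp only [Set.mem_iUnion, Set.mem_inter_iff, Set.mem_preimage, exists_and_right, iff_and_self]
    intro _
    refine ⟨(-⌊w 0⌋, -⌊w 1⌋), fun i => ?_⟩
    fin_cases i <;> simp [← sub_eq_add_neg, Int.fract_lt_one]
  have m1 : ∀ ν, MeasurableSet ((fun w : E2 => w - latticePt 1 ν) ⁻¹' t) := fun ν =>
    (by fun_prop : Measurable (fun w : E2 => w - latticePt 1 ν)) ht
  have m2 : ∀ ν, MeasurableSet ((fun w : E2 => w + latticePt 1 ν) ⁻¹' unitSquare) := fun ν =>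
    (by fun_prop : Measurable (fun w : E2 => w + latticePt 1 ν)) measurableSet_unitSquare
  rw [h1, measure_iUnion, h2, measure_iUnion, ← h2]
  · congr 1
    ext ν
    have : unitSquare ∩ (fun w => w - latticePt 1 ν) ⁻¹' t = (fun w => w + -latticePt 1 ν) ⁻¹'
        ((fun w => w + latticePt 1 ν) ⁻¹' unitSquare ∩ t) := by
      ext w
      simp [sub_eq_add_neg]
    rw [this, measure_preimage_add_right]
  · intro ν ν' hne
    refine Set.disjoint_left.2 fun w hw hw' => hne ?_
    have key : ∀ (a b : ℤ) (s : ℝ), s + 1 * a ∈ Set.Ico (0 : ℝ) 1 → s + 1 * b ∈ Set.Ico (0 : ℝ) 1 →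
        a = b := by
      intro a b s ha hb
      have h3 : (a : ℝ) < b + 1 := by linarith [ha.2, hb.1]
      have h4 : (b : ℝ) < a + 1 := by linarith [ha.1, hb.2]
      have h3' : a < b + 1 := by exact_mod_cast h3
      have h4' : b < a + 1 := by exact_mod_cast h4
      omega
    exact Prod.ext (key _ _ (w 0) (hw.1 0) (hw'.1 0)) (key _ _ (w 1) (hw.1 1) (hw'.1 1))
  · exact fun ν => (m2 ν).inter ht
  · intro ν ν' hne
    refine Set.disjoint_left.2 fun w hw hw' => hne ?_
    exact hdisj w ν ν' hw.2 hw'.2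
  · exact fun ν => measurableSet_unitSquare.inter (m1 ν)

/-- The horizontal plane in space. -/
def planeLift : E2 →L[ℝ] E3 :=
  LinearMap.toContinuousLinearMap
    { toFun := fun w => !₂[w 0, w 1, 0]
      map_add' := fun x y => by ext i; fin_cases i <;> simp
      map_smul' := fun c x => by ext i; fin_cases i <;> simp }

theorem planeProj_planeLift (w : E2) : planeProj (planeLift w) = w := by
  ext i
  fin_cases i <;> rfl

theorem norm_planeLift (w : E2) : ‖planeLift w‖ = ‖w‖ := by
  refine (sq_eq_sq₀ (norm_nonneg _) (norm_nonneg _)).1 ?_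
  rw [norm_sq_E2, norm_sq_E3]
  simp [planeLift]

theorem mem_rods_translate_iff {ε R : ℝ} (hε : 0 < ε) (x : E3) (w : E2) :
    x + ε • planeLift w ∈ rods ε R ↔
      ∃ ν, w - latticePt 1 ν ∈ Metric.closedBall (-(ε⁻¹ • planeProj x)) R := by
  refine exists_congr fun ν => ?_
  rw [mem_closedBall_iff_norm, map_add, map_smul, planeProj_planeLift]
  have h1 : planeProj x + ε • w - latticePt ε ν
      = ε • (w - latticePt 1 ν - -(ε⁻¹ • planeProj x)) := by
    ext i
    fin_cases i <;> simp <;> field_simp <;> ring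
  rw [h1, norm_smul, Real.norm_of_nonneg hε.le, mul_le_mul_iff_right₀ hε]

/-- Modulo the integer lattice, the translations that bring `x` into a rod form one disc of radius
`R`. Their measure is its area, whatever `x` is. -/
theorem volume_translate_mem_rods {ε R : ℝ} (hε : 0 < ε) (hR : 0 < R) (hR2 : R < 1 / 2) (x : E3) :
    volume (unitSquare ∩ {w | x + ε • planeLift w ∈ rods ε R})
      = ENNReal.ofReal (Real.pi * R ^ 2) := by
  have h1 : {w | x + ε • planeLift w ∈ rods ε R} =
      {w | ∃ ν, w - latticePt 1 ν ∈ Metric.closedBall (-(ε⁻¹ • planeProj x)) R} := by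
    ext w
    exact mem_rods_translate_iff hε x w
  rw [h1, volume_unitSquare_inter measurableSet_closedBall,
    EuclideanSpace.volume_closedBall_fin_two, ← ENNReal.ofReal_pow hR.le,
    ← ENNReal.ofReal_mul (by positivity), mul_comm]
  intro w ν ν' h h'
  rw [mem_closedBall_iff_norm] at h h'
  refine eq_of_norm_sub_latticePt_lt one_pos (y := w + ε⁻¹ • planeProj x) ?_ ?_
  · refine lt_of_le_of_lt (le_of_eq_of_le ?_ h) hR2
    congr 1
    abel
  · refine lt_of_le_of_lt (le_of_eq_of_le ?_ h') hR2
    congr 1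
    abel

/-- The normalized thick rods are close to `1` in the dual of `W^{1,1}`. -/
theorem abs_thick_sub_le {ψ : E3 → ℝ} (hψ : IsTestFunction Ω ψ) {ε R : ℝ} (hε : 0 < ε)
    (hR : 0 < R) (hR2 : R < 1 / 2) :
    |1 / (Real.pi * R ^ 2) * (∫ x, (rods ε R).indicator ψ x) - ∫ x, ψ x|
      ≤ 2 / (Real.pi * R ^ 2) * ε * ∫ x, ‖gradient ψ x‖ := by
  set K := 1 / (Real.pi * R ^ 2) with hK
  have hK0 : 0 < K := by have := Real.pi_pos; positivity
  set G : E3 → ℝ := (rods ε R).indicator fun _ => K with hG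
  have hGm : Measurable G := measurable_const.indicator (measurableSet_rods ε R)
  have hGb : ∀ x, |G x| ≤ K := by
    intro x
    rw [hG]
    by_cases h : x ∈ rods ε R <;> simp [h, hK0.le, abs_of_pos hK0]
  set μ : Measure E2 := volume.restrict unitSquare with hμ
  have hμ1 : IsProbabilityMeasure μ := ⟨by simp [hμ, volume_unitSquare]⟩
  have hψi := hψ.integrable volume
  -- The density of the rods averages to one over a period cell of translations, at every point.
  have hmean : ∀ x, ∫ w, G (x + ε • planeLift w) ∂μ = 1 := by
    intro x
    have hm : MeasurableSet {w | x + ε • planeLift w ∈ rods ε R} :=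
      (by fun_prop : Measurable (fun w => x + ε • planeLift w)) (measurableSet_rods ε R)
    have h1 : (fun w => G (x + ε • planeLift w))
        = {w | x + ε • planeLift w ∈ rods ε R}.indicator fun _ => K := by
      ext w
      rfl
    rw [h1, integral_indicator hm, setIntegral_const, Measure.real, hμ,
      Measure.restrict_apply hm, Set.inter_comm, volume_translate_mem_rods hε hR hR2,
      ENNReal.toReal_ofReal (by positivity), hK, smul_eq_mul]
    have := Real.pi_pos
    field_simp
  have hprod : Integrable (fun p : E3 × E2 => G (p.1 + ε • planeLift p.2) * ψ p.1)
      (volume.prod μ) := by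
    refine (hψi.comp_fst μ).bdd_mul (c := K) ?_ (ae_of_all _ fun p => hGb _)
    exact (hGm.comp (by fun_prop)).aestronglyMeasurable
  have h1 : ∫ x, ψ x = ∫ w, (∫ x, G (x + ε • planeLift w) * ψ x) ∂μ := by
    rw [← integral_integral_swap hprod]
    refine integral_congr_ae (ae_of_all _ fun x => ?_)
    simp only
    rw [integral_mul_const, hmean, one_mul]
  -- The translation is moved from the rough density to the smooth function, where it costs at most
  -- `‖ε w‖ ≤ 2 ε` times the `L¹` norm of the gradient.
  have h2 : ∀ w, ∫ x, G (x + ε • planeLift w) * ψ x = ∫ x, G x * ψ (x + -(ε • planeLift w)) := by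
    intro w
    rw [← integral_add_right_eq_self (fun x => G x * ψ (x + -(ε • planeLift w)))
      (ε • planeLift w)]
    simp
  have h3 : K * (∫ x, (rods ε R).indicator ψ x) = ∫ x, G x * ψ x := by
    rw [← integral_const_mul]
    refine integral_congr_ae (ae_of_all _ fun x => ?_)
    by_cases h : x ∈ rods ε R <;> simp [hG, h]
  have h4 : K * (∫ x, (rods ε R).indicator ψ x) - ∫ x, ψ x
      = ∫ w, ((∫ x, G x * ψ x) - ∫ x, G (x + ε • planeLift w) * ψ x) ∂μ := by
    rw [h3, integral_sub (integrable_const _) hprod.integral_prod_right, ← h1]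
    simp
  rw [h4, ← Real.norm_eq_abs]
  have h5 : ∀ᵐ w ∂μ, ‖(∫ x, G x * ψ x) - ∫ x, G (x + ε • planeLift w) * ψ x‖
      ≤ 2 / (Real.pi * R ^ 2) * ε * ∫ x, ‖gradient ψ x‖ := by
    filter_upwards [ae_restrict_mem measurableSet_unitSquare] with w hw
    rw [h2 w]
    have hGψ : ∀ {χ : E3 → ℝ}, Integrable χ → Integrable (fun x => G x * χ x) := fun hχ =>
      hχ.bdd_mul (c := K) hGm.aestronglyMeasurable (ae_of_all _ hGb)
    have hψt := hψi.comp_add_right (-(ε • planeLift w))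
    rw [← integral_sub (hGψ hψi) (hGψ hψt), Real.norm_eq_abs]
    calc |∫ x, (G x * ψ x - G x * ψ (x + -(ε • planeLift w)))|
        ≤ ∫ x, |G x * ψ x - G x * ψ (x + -(ε • planeLift w))| := abs_integral_le_integral_abs
      _ ≤ ∫ x, K * |ψ (x + -(ε • planeLift w)) - ψ x| := by
          refine integral_mono_of_nonneg (ae_of_all _ fun x => abs_nonneg _)
            ((hψt.sub hψi).abs.const_mul K) (ae_of_all _ fun x => ?_)
          simp only
          rw [← mul_sub, abs_mul, abs_sub_comm]
          gcongr
          exact hGb x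
      _ ≤ K * (‖-(ε • planeLift w)‖ * ∫ x, ‖gradient ψ x‖) := by
          rw [integral_const_mul]
          gcongr
          exact integral_abs_translate_sub_le hψ _
      _ ≤ K * ((ε * 2) * ∫ x, ‖gradient ψ x‖) := by
          have : 0 ≤ ∫ x, ‖gradient ψ x‖ := integral_nonneg fun _ => norm_nonneg _
          gcongr
          rw [norm_neg, norm_smul, norm_planeLift, Real.norm_of_nonneg hε.le]
          gcongr
          exact norm_le_of_mem_unitSquare hw
      _ = _ := by rw [hK]; ring
  refine (norm_integral_le_of_norm_le_const h5).trans ?_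
  simp

/-! ### Vertical derivatives in the rods -/

/-- The vertical unit vector. -/
def vert : E3 := EuclideanSpace.single 2 1

@[simp] theorem norm_vert : ‖vert‖ = 1 := by simp [vert]

theorem inner_smul_vert (ξ : E3) (c : ℝ) : inner ℝ ξ (c • vert) = c * ξ 2 := by
  rw [real_inner_smul_right, vert, EuclideanSpace.inner_single_right]
  simp

theorem planeProj_vert : planeProj vert = 0 := by
  ext i
  fin_cases i <;> simp [vert, planeProj_apply]

/-- The normalized density of the rods, minus its mean. -/
def rodDensity (ε r : ℝ) (x : E3) : ℝ := (rods ε r).indicator (fun _ => 1 / (Real.pi * r ^ 2)) x - 1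

theorem measurable_rodDensity (ε r : ℝ) : Measurable (rodDensity ε r) :=
  (measurable_const.indicator (measurableSet_rods ε r)).sub measurable_const

theorem abs_rodDensity_le (ε r : ℝ) (x : E3) :
    |rodDensity ε r x| ≤ 1 / (Real.pi * r ^ 2) + 1 := by
  have hK : 0 ≤ 1 / (Real.pi * r ^ 2) := by have := Real.pi_pos; positivity
  unfold rodDensity
  by_cases h : x ∈ rods ε r
  · rw [Set.indicator_of_mem h, abs_le]
    constructor <;> linarith
  · rw [Set.indicator_of_notMem h]
    simp only [zero_sub, abs_neg, abs_one]
    linarith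

theorem rodDensity_add_smul_vert (ε r : ℝ) (x : E3) (t : ℝ) :
    rodDensity ε r (x + t • vert) = rodDensity ε r x := by
  have h : x + t • vert ∈ rods ε r ↔ x ∈ rods ε r := by
    simp [rods, planeProj_vert]
  unfold rodDensity
  by_cases hx : x ∈ rods ε r
  · rw [Set.indicator_of_mem hx, Set.indicator_of_mem (h.2 hx)]
  · rw [Set.indicator_of_notMem hx, Set.indicator_of_notMem fun h' => hx (h.1 h')]

theorem integrable_rodDensity_mul (ε r : ℝ) {χ : E3 → ℝ} (hχ : Integrable χ) :
    Integrable (fun x => rodDensity ε r x * χ x) :=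
  hχ.bdd_mul (c := 1 / (Real.pi * r ^ 2) + 1) (measurable_rodDensity ε r).aestronglyMeasurable
    (ae_of_all _ (abs_rodDensity_le ε r))

/-- The rods are vertical, so their density has zero derivative in that direction although it is
discontinuous horizontally. -/
theorem integral_rodDensity_mul_fderiv_vert (ε r : ℝ) {χ : E3 → ℝ} (hχ : IsTestFunction Ω χ) :
    ∫ x, rodDensity ε r x * fderiv ℝ χ x vert = 0 := by
  have h := integral_mul_fderiv_of_hasLineDerivAt (f := rodDensity ε r) (f' := fun _ => 0)
    (v := vert) hχ ?_ (by simp) (integrable_rodDensity_mul ε r ((hχ.fderiv_apply vert).integrable _))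
    (integrable_rodDensity_mul ε r (hχ.integrable _))
  · simpa using h
  · intro x
    simp only [HasLineDerivAt, rodDensity_add_smul_vert]
    exact hasDerivAt_const _ _

theorem integral_rodDensity_mul (ε r : ℝ) {χ : E3 → ℝ} (hχ : Integrable χ) :
    ∫ x, rodDensity ε r x * χ x
      = 1 / (Real.pi * r ^ 2) * (∫ x, (rods ε r).indicator χ x) - ∫ x, χ x := by
  rw [← integral_const_mul, ← integral_sub ((hχ.indicator (measurableSet_rods ε r)).const_mul _) hχ]
  refine integral_congr_ae (ae_of_all _ fun x => ?_)
  by_cases h : x ∈ rods ε r <;> simp [rodDensity, h, sub_mul]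

/-- Rods of relative radius `1/4` serve as an intermediate step between the thin rods and the
constant `1`. The first error carries the logarithm; the second is of order `ε` and is absorbed
because the square root is at least `1`. -/
theorem abs_integral_rodDensity_mul_le {M : ℝ} (hM : 0 ≤ M)
    (hΩ : ∀ x ∈ Ω, x 2 ∈ Set.Ioo (0 : ℝ) 1) (hΩM : ∀ x ∈ Ω, ‖planeProj x‖ ≤ M)
    (hΩf : volume Ω ≠ ⊤) {ψ : E3 → ℝ}
    (hψ : IsTestFunction Ω ψ) {ε r : ℝ} (hε : 0 < ε) (hε1 : ε ≤ 1) (hr : 0 < r) (hr4 : r ≤ 1 / 4) :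
    |∫ x, rodDensity ε r x * ψ x|
      ≤ (2 * M + 5 + 2 / (Real.pi * (1 / 4) ^ 2) * √(volume.real Ω)) * (ε * √(1 + |Real.log r|))
        * √(∫ x in Ω, ‖gradient ψ x‖ ^ 2) := by
  have hpi := Real.pi_pos
  have h1 := abs_thin_sub_thick_le hM hΩ hΩM hψ hε hε1 hr hr4 (by norm_num)
  have h2 := abs_thick_sub_le hψ hε (R := 1 / 4) (by norm_num) (by norm_num)
  set N := √(∫ x in Ω, ‖gradient ψ x‖ ^ 2) with hN
  have hlog : Real.log (1 / 4 / r) ≤ |Real.log r| := by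
    rw [Real.log_div (by norm_num) hr.ne']
    have : Real.log (1 / 4) ≤ 0 := Real.log_nonpos (by norm_num) (by norm_num)
    linarith [neg_le_abs (Real.log r)]
  have h3 : √(1 + Real.log (1 / 4 / r)) ≤ √(1 + |Real.log r|) := by gcongr
  have h4 : 1 ≤ √(1 + |Real.log r|) := by
    rw [Real.one_le_sqrt]
    linarith [abs_nonneg (Real.log r)]
  have h5 : ∫ x, ‖gradient ψ x‖ ≤ √(volume.real Ω) * N := by
    have hfin : IsFiniteMeasure (volume.restrict Ω) := ⟨by simpa using hΩf.lt_top⟩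
    have := integral_mul_le_sqrt_mul_sqrt (μ := volume.restrict Ω) (f := fun _ => 1)
      (g := fun x => ‖gradient ψ x‖) (memLp_const 1) (hψ.memLp_gradient 2 _).norm
    rw [← setIntegral_eq_integral_of_support (Ω := Ω)
      (fun x hx => by simp [hψ.gradient_eq_zero hx])]
    simpa using this
  rw [integral_rodDensity_mul ε r (hψ.integrable _)]
  set L := √(1 + |Real.log r|)
  have hN0 : 0 ≤ N := Real.sqrt_nonneg _
  set a := 1 / (Real.pi * r ^ 2) * ∫ x, (rods ε r).indicator ψ x
  set b := 1 / (Real.pi * (1 / 4) ^ 2) * ∫ x, (rods ε (1 / 4)).indicator ψ x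
  calc |a - ∫ x, ψ x| ≤ |a - b| + |b - ∫ x, ψ x| := abs_sub_le _ _ _
    _ ≤ (2 * M + 5) * ε * L * N + 2 / (Real.pi * (1 / 4) ^ 2) * (ε * L) * (√(volume.real Ω) * N) := by
        refine add_le_add (h1.trans (by gcongr)) (h2.trans ?_)
        gcongr
        exact le_mul_of_one_le_right hε.le h4
    _ = _ := by ring

theorem memLp_smul_vert {g θ : E3 → ℝ} (hg : Measurable g) {C : ℝ} (hC : ∀ x, |g x| ≤ C)
    (hθ : IsTestFunction Ω θ) :
    MemLp (fun x => (g x * θ x) • vert) 2 (volume.restrict Ω) := by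
  refine (hθ.memLp 2 (volume.restrict Ω)).of_le_mul (c := C) ?_ (ae_of_all _ fun x => ?_)
  · exact ((hg.mul hθ.continuous.measurable).smul_const vert).aestronglyMeasurable
  · rw [norm_smul, norm_vert, mul_one, norm_mul]
    gcongr
    exact hC x

theorem IsTestFunction.exists_bound {φ : E3 → ℝ} (hφ : IsTestFunction Ω φ) :
    ∃ A, 0 ≤ A ∧ (∀ x, |φ x| ≤ A) ∧ ∀ x, ‖gradient φ x‖ ≤ A := by
  obtain ⟨A, hA⟩ := hφ.2.1.exists_bound_of_continuous hφ.continuous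
  obtain ⟨B, hB⟩ := (hasCompactSupport_gradient hφ.2.1).exists_bound_of_continuous
    (continuous_gradient hφ.1)
  refine ⟨max A B, ?_, fun x => (hA x).trans (le_max_left _ _),
    fun x => (hB x).trans (le_max_right _ _)⟩
  exact (norm_nonneg _).trans ((hA 0).trans (le_max_left _ _))

theorem gradient_mul {φ ψ : E3 → ℝ} {x : E3} (hφ : DifferentiableAt ℝ φ x)
    (hψ : DifferentiableAt ℝ ψ x) :
    gradient (fun x => φ x * ψ x) x = φ x • gradient ψ x + ψ x • gradient φ x := by
  simp [gradient, fderiv_fun_mul hφ hψ]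

/-- Vertical derivatives of functions in `H¹₀(Ω)` do not see the difference between the normalized
rods and the whole domain. -/
theorem exists_abs_integral_rodDensity_le {M : ℝ} (hM : 0 ≤ M)
    (hΩ : ∀ x ∈ Ω, x 2 ∈ Set.Ioo (0 : ℝ) 1) (hΩM : ∀ x ∈ Ω, ‖planeProj x‖ ≤ M)
    (hΩf : volume Ω ≠ ⊤) {θ : E3 → ℝ} (hθ : IsTestFunction Ω θ) :
    ∃ C, 0 ≤ C ∧ ∀ ε r : ℝ, 0 < ε → ε ≤ 1 → 0 < r → r ≤ 1 / 4 → ∀ u : H10 Ω,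
      |∫ x in Ω, inner ℝ (weakGrad u x) ((rodDensity ε r x * θ x) • vert)|
        ≤ C * (ε * √(1 + |Real.log r|)) * ‖u‖ := by
  have hpi := Real.pi_pos
  set χ : E3 → ℝ := fun x => fderiv ℝ θ x vert with hχdef
  have hχ : IsTestFunction Ω χ := hθ.fderiv_apply vert
  obtain ⟨A, hA0, hA1, hA2⟩ := hχ.exists_bound
  set D := 2 * M + 5 + 2 / (Real.pi * (1 / 4) ^ 2) * √(volume.real Ω) with hD
  have hD0 : 0 ≤ D := by positivity
  refine ⟨D * (2 * A), by positivity, fun ε r hε hε1 hr hr4 u => ?_⟩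
  have hX := memLp_smul_vert (measurable_rodDensity ε r) (abs_rodDensity_le ε r) hθ
  refine H10_induction (p := fun u : H10 Ω =>
    |∫ x in Ω, inner ℝ (weakGrad u x) ((rodDensity ε r x * θ x) • vert)|
        ≤ D * (2 * A) * (ε * √(1 + |Real.log r|)) * ‖u‖) ?_ ?_ u
  -- For fixed `ε` and `r` both sides are continuous in `u`, so it suffices to treat test functions.
  · simp only [fun u : H10 Ω => integral_inner_weakGrad u hX]
    refine isClosed_le ?_ (continuous_const.mul continuous_norm)
    exact ((weakGradL Ω).continuous.inner continuous_const).abs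
  · intro v hv
    have hvθ : IsTestFunction Ω (fun x => v x * θ x) := hv.mul_left hθ.1
    have hψ : IsTestFunction Ω (fun x => v x * χ x) := hv.mul_left hχ.1
    -- Applied to the product `v θ`: the vertical derivative of `v` is traded for that of `θ`,
    -- leaving the density paired with the test function `v χ`.
    have h0 := integral_rodDensity_mul_fderiv_vert ε r hvθ
    have hd : ∀ x, fderiv ℝ (fun x => v x * θ x) x vert
        = θ x * fderiv ℝ v x vert + v x * χ x := by
      intro x
      rw [fderiv_fun_mul (hv.differentiable x) (hθ.differentiable x)]
      simp [hχdef]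
      ring
    have hI1 : Integrable (fun x => rodDensity ε r x * (θ x * fderiv ℝ v x vert)) :=
      integrable_rodDensity_mul ε r
        ((hθ.mul_left (hv.fderiv_apply vert).1).integrable _)
    have hI2 : Integrable (fun x => rodDensity ε r x * (v x * χ x)) :=
      integrable_rodDensity_mul ε r (hψ.integrable _)
    simp only [hd, mul_add] at h0
    rw [integral_add hI1 hI2] at h0
    have h1 : ∫ x in Ω, inner ℝ (weakGrad (testPair hv) x) ((rodDensity ε r x * θ x) • vert)
        = ∫ x, rodDensity ε r x * (θ x * fderiv ℝ v x vert) := by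
      rw [← setIntegral_eq_integral_of_support (Ω := Ω)
        (fun x hx => by simp [hθ.eq_zero hx])]
      refine integral_congr_ae ?_
      filter_upwards [weakGrad_testPair hv] with x hx
      rw [hx, inner_smul_vert, gradient_apply, vert]
      ring
    have h2 : |∫ x, rodDensity ε r x * (v x * χ x)|
        ≤ D * (ε * √(1 + |Real.log r|)) * √(∫ x in Ω, ‖gradient (fun x => v x * χ x) x‖ ^ 2) :=
      abs_integral_rodDensity_mul_le hM hΩ hΩM hΩf hψ hε hε1 hr hr4
    have h3 : √(∫ x in Ω, ‖gradient (fun x => v x * χ x) x‖ ^ 2) ≤ 2 * A * ‖testPair hv‖ := by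
      rw [Real.sqrt_le_left (by positivity)]
      have hn : ‖testPair hv‖ ^ 2 = (∫ x in Ω, ‖v x‖ ^ 2) + ∫ x in Ω, ‖gradient v x‖ ^ 2 := by
        rw [norm_sq_eq, ← norm_toLp_sq (hv.memLp 2 (volume.restrict Ω)),
          ← norm_toLp_sq (hv.memLp_gradient 2 (volume.restrict Ω))]
        rfl
      have i1 : Integrable (fun x => ‖v x‖ ^ 2) (volume.restrict Ω) :=
        (hv.memLp 2 (volume.restrict Ω)).norm.integrable_sq
      have i2 : Integrable (fun x => ‖gradient v x‖ ^ 2) (volume.restrict Ω) :=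
        (hv.memLp_gradient 2 (volume.restrict Ω)).norm.integrable_sq
      have hle : ∫ x in Ω, ‖gradient (fun x => v x * χ x) x‖ ^ 2
          ≤ ∫ x in Ω, (2 * A ^ 2) * (‖v x‖ ^ 2 + ‖gradient v x‖ ^ 2) := by
        refine integral_mono (hψ.memLp_gradient 2 (volume.restrict Ω)).norm.integrable_sq
          ((i1.add i2).const_mul _) fun x => ?_
        simp only
        rw [gradient_mul (hv.differentiable x) (hχ.differentiable x)]
        have h4 : ‖v x • gradient χ x + χ x • gradient v x‖ ≤ A * ‖v x‖ + A * ‖gradient v x‖ := by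
          refine (norm_add_le _ _).trans ?_
          rw [norm_smul, norm_smul, mul_comm ‖v x‖]
          gcongr
          · exact hA2 x
          · exact hA1 x
        calc _ ≤ (A * ‖v x‖ + A * ‖gradient v x‖) ^ 2 := by gcongr
          _ ≤ _ := by nlinarith [mul_nonneg (sq_nonneg A) (sq_nonneg (‖v x‖ - ‖gradient v x‖))]
      rw [integral_const_mul, integral_add i1 i2, ← hn] at hle
      nlinarith [mul_nonneg (sq_nonneg A) (sq_nonneg ‖testPair hv‖)]
    change |∫ x in Ω, inner ℝ (weakGrad (testPair hv) x) ((rodDensity ε r x * θ x) • vert)| ≤ _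
    rw [h1, eq_neg_of_add_eq_zero_left h0, abs_neg]
    calc _ ≤ D * (ε * √(1 + |Real.log r|)) * (2 * A * ‖testPair hv‖) := h2.trans (by gcongr)
      _ = _ := by ring

/-! ### Correctors -/

theorem exists_abs_deriv_smoothTransition_le :
    ∃ C : ℝ, 0 ≤ C ∧ ∀ t, |deriv Real.smoothTransition t| ≤ C := by
  have hc : Continuous (deriv Real.smoothTransition) :=
    (Real.smoothTransition.contDiff (n := 1)).continuous_deriv le_rfl
  obtain ⟨C, hC⟩ := isCompact_Icc.exists_bound_of_continuousOn (s := Set.Icc (0 : ℝ) 1)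
    hc.continuousOn
  refine ⟨C, (norm_nonneg _).trans (hC 0 (by simp)), fun t => ?_⟩
  have hC0 : 0 ≤ C := (norm_nonneg _).trans (hC 0 (by simp))
  rcases lt_or_ge t 0 with h | h
  · have : Real.smoothTransition =ᶠ[𝓝 t] fun _ => 0 := by
      filter_upwards [Iio_mem_nhds h] with s hs
      exact Real.smoothTransition.zero_of_nonpos (le_of_lt hs)
    rw [this.deriv_eq]
    simpa using hC0
  · rcases lt_or_ge 1 t with h' | h'
    · have : Real.smoothTransition =ᶠ[𝓝 t] fun _ => 1 := by
        filter_upwards [Ioi_mem_nhds h'] with s hs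
        exact Real.smoothTransition.one_of_one_le (le_of_lt hs)
      rw [this.deriv_eq]
      simpa using hC0
    · exact hC t ⟨h, h'⟩

/-- The function `(sin²(π x₀/ε) + sin²(π x₁/ε)) / (π r)²`, a smooth periodic version of the squared
distance to the axes of the rods. -/
def rodGauge (ε r : ℝ) (x : E3) : ℝ :=
  (Real.sin (Real.pi * (x 0 / ε)) ^ 2 + Real.sin (Real.pi * (x 1 / ε)) ^ 2) / (Real.pi * r) ^ 2

/-- A periodic function with gradient close to a horizontal basis vector in the rods of radius
`ε r`, supported in the rods of radius `3 ε r`. -/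
def corrector (ε r : ℝ) (i : Fin 2) (x : E3) : ℝ :=
  ε / (2 * Real.pi) * Real.sin (2 * (Real.pi * (x i.castSucc / ε)))
    * Real.smoothTransition (3 - rodGauge ε r x)

theorem contDiff_rodGauge (ε r : ℝ) : ContDiff ℝ ∞ (rodGauge ε r) := by
  unfold rodGauge
  have h : ∀ j : Fin 3, ContDiff ℝ ∞ fun x : E3 => Real.sin (Real.pi * (x j / ε)) ^ 2 := fun j =>
    (Real.contDiff_sin.comp (contDiff_const.mul
      ((EuclideanSpace.proj (𝕜 := ℝ) j).contDiff.div_const ε))).pow 2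
  exact ((h 0).add (h 1)).div_const _

theorem contDiff_corrector (ε r : ℝ) (i : Fin 2) : ContDiff ℝ ∞ (corrector ε r i) := by
  unfold corrector
  refine ContDiff.mul (contDiff_const.mul (Real.contDiff_sin.comp (contDiff_const.mul
    (contDiff_const.mul ((EuclideanSpace.proj (𝕜 := ℝ) i.castSucc).contDiff.div_const ε))))) ?_
  exact Real.smoothTransition.contDiff.comp (contDiff_const.sub (contDiff_rodGauge ε r))

theorem abs_sin_pi_mul_eq (z : ℝ) (n : ℤ) :
    |Real.sin (Real.pi * z)| = |Real.sin (Real.pi * (z - n))| := by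
  rw [mul_sub, mul_comm Real.pi (n : ℝ), Real.sin_sub_int_mul_pi, abs_mul, abs_zpow]
  simp

theorem sin_sq_pi_mul_le (z : ℝ) (n : ℤ) :
    Real.sin (Real.pi * z) ^ 2 ≤ Real.pi ^ 2 * (z - n) ^ 2 := by
  rw [← sq_abs, abs_sin_pi_mul_eq z n, ← mul_pow, sq_abs]
  exact Real.sin_sq_le_sq

/-- Jordan's inequality `|sin t| ≥ (2/π)|t|` on `[-π/2, π/2]`, after reducing `z` modulo the
integers. -/
theorem four_mul_sq_le_sin_sq (z : ℝ) :
    4 * (z - round z) ^ 2 ≤ Real.sin (Real.pi * z) ^ 2 := by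
  have h1 := abs_sub_round z
  have hpi := Real.pi_pos
  have h2 : |Real.pi * (z - round z)| ≤ Real.pi / 2 := by
    rw [abs_mul, abs_of_pos hpi]
    nlinarith
  have h3 := Real.mul_abs_le_abs_sin h2
  rw [← sq_abs (Real.sin _), abs_sin_pi_mul_eq z (round z)]
  have h4 : 2 * |z - round z| ≤ |Real.sin (Real.pi * (z - round z))| := by
    refine le_trans (le_of_eq ?_) h3
    rw [abs_mul, abs_of_pos hpi]
    field_simp
  calc 4 * (z - round z) ^ 2 = (2 * |z - round z|) ^ 2 := by rw [mul_pow, sq_abs]; ring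
    _ ≤ _ := by gcongr

theorem rodGauge_le_one {ε r : ℝ} (hε : 0 < ε) (hr : 0 < r) {x : E3} (hx : x ∈ rods ε r) :
    rodGauge ε r x ≤ 1 := by
  obtain ⟨ν, hν⟩ := hx
  rw [← sq_le_sq₀ (norm_nonneg _) (by positivity), norm_sq_sub_latticePt, planeProj_apply_zero,
    planeProj_apply_one] at hν
  have hpi := Real.pi_pos
  rw [rodGauge, div_le_one (by positivity)]
  have h0 := sin_sq_pi_mul_le (x 0 / ε) ν.1
  have h1 := sin_sq_pi_mul_le (x 1 / ε) ν.2
  have h2 : (x 0 / ε - ν.1) ^ 2 + (x 1 / ε - ν.2) ^ 2 ≤ r ^ 2 := by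
    have : (x 0 / ε - ν.1) ^ 2 + (x 1 / ε - ν.2) ^ 2
        = ((x 0 - ε * ν.1) ^ 2 + (x 1 - ε * ν.2) ^ 2) / ε ^ 2 := by
      field_simp
    rw [this, div_le_iff₀ (by positivity)]
    linarith [mul_pow ε r 2, mul_comm (r ^ 2) (ε ^ 2)]
  calc _ ≤ Real.pi ^ 2 * ((x 0 / ε - ν.1) ^ 2 + (x 1 / ε - ν.2) ^ 2) := by linarith
    _ ≤ Real.pi ^ 2 * r ^ 2 := by gcongr
    _ = _ := by ring

/-- By Jordan's inequality the squared distance `d²` to the lattice, in units of `ε`, satisfies `4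
d² ≤ 3 π² r²`. Since `π² ≤ 12`, this gives `d ≤ 3 r`. -/
theorem mem_rods_of_rodGauge_le {ε r : ℝ} (hε : 0 < ε) (hr : 0 < r) {x : E3}
    (hx : rodGauge ε r x ≤ 3) : x ∈ rods ε (3 * r) := by
  have hpi := Real.pi_pos
  rw [rodGauge, div_le_iff₀ (by positivity)] at hx
  have h0 := four_mul_sq_le_sin_sq (x 0 / ε)
  have h1 := four_mul_sq_le_sin_sq (x 1 / ε)
  refine ⟨(round (x 0 / ε), round (x 1 / ε)), ?_⟩
  rw [← sq_le_sq₀ (norm_nonneg _) (by positivity), norm_sq_sub_latticePt, planeProj_apply_zero,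
    planeProj_apply_one]
  have h2 : (x 0 - ε * round (x 0 / ε)) ^ 2 + (x 1 - ε * round (x 1 / ε)) ^ 2
      = ε ^ 2 * ((x 0 / ε - round (x 0 / ε)) ^ 2 + (x 1 / ε - round (x 1 / ε)) ^ 2) := by
    have aux : ∀ t : ℝ, ∀ n : ℤ, (t - ε * n) ^ 2 = ε ^ 2 * (t / ε - n) ^ 2 := by
      intro t n
      field_simp
    rw [aux, aux]
    ring
  have h3 : Real.pi ^ 2 ≤ 12 := by nlinarith [Real.pi_lt_d2]
  have h4 : (x 0 / ε - round (x 0 / ε)) ^ 2 + (x 1 / ε - round (x 1 / ε)) ^ 2 ≤ 9 * r ^ 2 := by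
    nlinarith [mul_le_mul_of_nonneg_right h3 (sq_nonneg r)]
  simp only
  rw [h2]
  nlinarith [mul_le_mul_of_nonneg_left h4 (sq_nonneg ε)]

theorem sin_sq_le_of_rodGauge_le {ε r : ℝ} (hr : 0 < r) {x : E3}
    (hx : rodGauge ε r x ≤ 3) (i : Fin 2) :
    |Real.sin (Real.pi * (x i.castSucc / ε))| ≤ 2 * Real.pi * r := by
  have hpi := Real.pi_pos
  rw [rodGauge, div_le_iff₀ (by positivity)] at hx
  refine abs_le_of_sq_le_sq ?_ (by positivity)
  fin_cases i
  · simp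
    nlinarith [sq_nonneg (Real.sin (Real.pi * (x 1 / ε))), sq_nonneg (Real.pi * r)]
  · simp
    nlinarith [sq_nonneg (Real.sin (Real.pi * (x 0 / ε))), sq_nonneg (Real.pi * r)]

theorem abs_sin_two_mul_le (t : ℝ) : |Real.sin (2 * t)| ≤ 2 * |Real.sin t| := by
  rw [Real.sin_two_mul, abs_mul, abs_mul, abs_two]
  exact mul_le_of_le_one_right (by positivity) (Real.abs_cos_le_one t)

theorem abs_corrector_amplitude_le {ε r : ℝ} (hε : 0 < ε) (hr : 0 < r) {x : E3}
    (hx : rodGauge ε r x ≤ 3) (i : Fin 2) :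
    |ε / (2 * Real.pi) * Real.sin (2 * (Real.pi * (x i.castSucc / ε)))| ≤ 2 * (ε * r) := by
  have hpi := Real.pi_pos
  rw [abs_mul, abs_of_pos (show 0 < ε / (2 * Real.pi) by positivity)]
  calc _ ≤ ε / (2 * Real.pi) * (2 * (2 * Real.pi * r)) := by
        gcongr
        exact (abs_sin_two_mul_le _).trans (by gcongr; exact sin_sq_le_of_rodGauge_le hr hx i)
    _ = 2 * (ε * r) := by field_simp

theorem abs_corrector_le {ε r : ℝ} (hε : 0 < ε) (hr : 0 < r) (i : Fin 2) (x : E3) :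
    |corrector ε r i x| ≤ 2 * (ε * r) := by
  rcases le_or_gt (rodGauge ε r x) 3 with h | h
  · rw [corrector, abs_mul]
    refine (mul_le_of_le_one_right (abs_nonneg _) ?_).trans (abs_corrector_amplitude_le hε hr h i)
    rw [abs_of_nonneg (Real.smoothTransition.nonneg _)]
    exact Real.smoothTransition.le_one _
  · rw [corrector, Real.smoothTransition.zero_of_nonpos (by linarith)]
    simp
    positivity

theorem gradient_corrector_eq_zero {ε r : ℝ} (hε : 0 < ε) (hr : 0 < r) (i : Fin 2) {x : E3}
    (hx : x ∉ rods ε (3 * r)) : gradient (corrector ε r i) x = 0 := by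
  have h1 : 3 < rodGauge ε r x := by
    by_contra! h
    exact hx (mem_rods_of_rodGauge_le hε hr h)
  have h2 : corrector ε r i =ᶠ[𝓝 x] fun _ => 0 := by
    filter_upwards [(contDiff_rodGauge ε r).continuous.continuousAt.eventually
      (Ioi_mem_nhds h1)] with y hy
    rw [corrector, Real.smoothTransition.zero_of_nonpos (by linarith [hy])]
    simp
  rw [h2.gradient_eq, gradient_fun_const]

theorem hasFDerivAt_amplitude {ε : ℝ} (hε : 0 < ε) (i : Fin 2) (x : E3) :
    HasFDerivAt (fun x : E3 => ε / (2 * Real.pi) * Real.sin (2 * (Real.pi * (x i.castSucc / ε))))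
      (Real.cos (2 * (Real.pi * (x i.castSucc / ε))) •
        (EuclideanSpace.proj i.castSucc : E3 →L[ℝ] ℝ)) x := by
  have hpi := Real.pi_pos
  have hd : HasDerivAt (fun t : ℝ => ε / (2 * Real.pi) * Real.sin (2 * (Real.pi * (t / ε))))
      (Real.cos (2 * (Real.pi * (x i.castSucc / ε)))) (x i.castSucc) := by
    have h1 : HasDerivAt (fun t : ℝ => 2 * (Real.pi * (t / ε))) (2 * (Real.pi * (1 / ε)))
        (x i.castSucc) :=
      (((hasDerivAt_id _).div_const ε).const_mul Real.pi).const_mul 2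
    convert! (h1.sin.const_mul (ε / (2 * Real.pi))) using 1
    field_simp
  exact hd.comp_hasFDerivAt (f := fun x : E3 => x i.castSucc) x
    (EuclideanSpace.proj (𝕜 := ℝ) i.castSucc).hasFDerivAt

theorem hasFDerivAt_sin_sq (ε : ℝ) (j : Fin 3) (x : E3) :
    HasFDerivAt (fun x : E3 => Real.sin (Real.pi * (x j / ε)) ^ 2)
      ((2 * Real.sin (Real.pi * (x j / ε)) * (Real.cos (Real.pi * (x j / ε)) * (Real.pi / ε))) •
        (EuclideanSpace.proj j : E3 →L[ℝ] ℝ)) x := by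
  have hd : HasDerivAt (fun t : ℝ => Real.sin (Real.pi * (t / ε)) ^ 2)
      (2 * Real.sin (Real.pi * (x j / ε)) * (Real.cos (Real.pi * (x j / ε)) * (Real.pi / ε)))
      (x j) := by
    have h1 : HasDerivAt (fun t : ℝ => Real.pi * (t / ε)) (Real.pi * (1 / ε)) (x j) :=
      ((hasDerivAt_id _).div_const ε).const_mul Real.pi
    convert! h1.sin.pow 2 using 1
    rw [mul_one_div]
    push_cast
    ring
  exact hd.comp_hasFDerivAt (f := fun x : E3 => x j) x
    (EuclideanSpace.proj (𝕜 := ℝ) j).hasFDerivAt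

theorem norm_fderiv_rodGauge_le {ε r : ℝ} (hε : 0 < ε) (hr : 0 < r) {x : E3}
    (hx : rodGauge ε r x ≤ 3) : ‖fderiv ℝ (rodGauge ε r) x‖ ≤ 8 / (ε * r) := by
  have hpi := Real.pi_pos
  have hproj : ∀ j : Fin 3, ‖(EuclideanSpace.proj j : E3 →L[ℝ] ℝ)‖ ≤ 1 := fun j =>
    ContinuousLinearMap.opNorm_le_bound _ zero_le_one fun y => by
      simpa using PiLp.norm_apply_le y j
  have hb : ∀ i : Fin 2, ‖(2 * Real.sin (Real.pi * (x i.castSucc / ε)) *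
      (Real.cos (Real.pi * (x i.castSucc / ε)) * (Real.pi / ε))) •
        (EuclideanSpace.proj i.castSucc : E3 →L[ℝ] ℝ)‖ ≤ 4 * Real.pi ^ 2 * r / ε := by
    intro i
    rw [norm_smul, Real.norm_eq_abs, abs_mul, abs_mul, abs_mul, abs_two,
      abs_of_pos (show 0 < Real.pi / ε by positivity)]
    calc _ ≤ 2 * (2 * Real.pi * r) * (1 * (Real.pi / ε)) * 1 := by
          gcongr
          · exact sin_sq_le_of_rodGauge_le hr hx i
          · exact Real.abs_cos_le_one _
          · exact hproj _
      _ = _ := by ring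
  have hd : HasFDerivAt (rodGauge ε r) _ x :=
    (((hasFDerivAt_sin_sq ε 0 x).fun_add (hasFDerivAt_sin_sq ε 1 x)).mul_const
      (((Real.pi * r) ^ 2)⁻¹))
  rw [hd.fderiv, norm_smul, Real.norm_of_nonneg (by positivity)]
  calc _ ≤ ((Real.pi * r) ^ 2)⁻¹ * (4 * Real.pi ^ 2 * r / ε + 4 * Real.pi ^ 2 * r / ε) := by
        gcongr
        exact (norm_add_le _ _).trans (add_le_add (hb 0) (hb 1))
    _ = 8 / (ε * r) := by
        field_simp
        ring

/-- The cutoff varies at rate `1 / (ε r)` but multiplies an amplitude of order `ε r` where it is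
active. The product rule therefore gives a bound independent of `ε` and `r`. -/
theorem exists_norm_gradient_corrector_le :
    ∃ C : ℝ, 0 ≤ C ∧ ∀ ε r : ℝ, 0 < ε → 0 < r → ∀ (i : Fin 2) (x : E3),
      ‖gradient (corrector ε r i) x‖ ≤ (rods ε (3 * r)).indicator (fun _ => C) x := by
  obtain ⟨C, hC0, hC⟩ := exists_abs_deriv_smoothTransition_le
  refine ⟨16 * C + 1, by positivity, fun ε r hε hr i x => ?_⟩
  by_cases hx : x ∈ rods ε (3 * r)
  swap
  · rw [gradient_corrector_eq_zero hε hr i hx]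
    simp [hx]
  rw [Set.indicator_of_mem hx, norm_gradient]
  rcases lt_or_ge 3 (rodGauge ε r x) with h | h
  · have h2 : corrector ε r i =ᶠ[𝓝 x] fun _ => 0 := by
      filter_upwards [(contDiff_rodGauge ε r).continuous.continuousAt.eventually
        (Ioi_mem_nhds h)] with y hy
      rw [corrector, Real.smoothTransition.zero_of_nonpos (by linarith [hy])]
      simp
    rw [h2.fderiv_eq]
    simp
    positivity
  · have hg : DifferentiableAt ℝ (rodGauge ε r) x :=
      (contDiff_rodGauge ε r).differentiable (by simp) x
    have hst : HasDerivAt Real.smoothTransition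
        (deriv Real.smoothTransition (3 - rodGauge ε r x)) (3 - rodGauge ε r x) :=
      ((Real.smoothTransition.contDiff (n := 1)).differentiable (by simp) _).hasDerivAt
    have h1 := hst.comp_hasFDerivAt x (hg.hasFDerivAt.const_sub 3)
    have h2 := (hasFDerivAt_amplitude hε i x).mul h1
    have h3 : fderiv ℝ (corrector ε r i) x = _ := h2.fderiv
    rw [h3]
    refine (norm_add_le _ _).trans (add_le_add ?_ ?_)
    -- The derivative falls on the cutoff: amplitude `2 ε r` times gauge gradient `8 / (ε r)` gives
    -- `16 C`. The other term contributes at most `1`.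
    · rw [norm_smul, norm_smul, norm_neg, Real.norm_eq_abs, Real.norm_eq_abs]
      calc _ ≤ 2 * (ε * r) * (C * (8 / (ε * r))) := by
            gcongr
            · exact abs_corrector_amplitude_le hε hr h i
            · exact hC _
            · exact norm_fderiv_rodGauge_le hε hr h
        _ = 16 * C := by
            field_simp
            ring
    · rw [norm_smul, norm_smul, Real.norm_eq_abs, Real.norm_eq_abs]
      have hproj : ‖(EuclideanSpace.proj i.castSucc : E3 →L[ℝ] ℝ)‖ ≤ 1 :=
        ContinuousLinearMap.opNorm_le_bound _ zero_le_one fun y => by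
          simpa using PiLp.norm_apply_le y i.castSucc
      have hs : |Real.smoothTransition (3 - rodGauge ε r x)| ≤ 1 := by
        rw [abs_of_nonneg (Real.smoothTransition.nonneg _)]
        exact Real.smoothTransition.le_one _
      calc _ ≤ (1 : ℝ) * (1 * 1) := by
            gcongr
            · exact hs
            · exact Real.abs_cos_le_one _
        _ = 1 := by norm_num

/-- Near the rod the gauge is below `2`, so the cutoff is identically `1`. The gradient is then `cos
2t = 1 - 2 sin² t` times the basis vector, with `|sin t| ≤ 2 π r`. -/
theorem norm_gradient_corrector_sub_le {ε r : ℝ} (hε : 0 < ε) (hr : 0 < r) (i : Fin 2) {x : E3}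
    (hx : x ∈ rods ε r) :
    ‖gradient (corrector ε r i) x - planeVec i‖ ≤ 8 * Real.pi ^ 2 * r ^ 2 := by
  have h1 : rodGauge ε r x < 2 := (rodGauge_le_one hε hr hx).trans_lt (by norm_num)
  have h2 : corrector ε r i =ᶠ[𝓝 x] fun x : E3 =>
      ε / (2 * Real.pi) * Real.sin (2 * (Real.pi * (x i.castSucc / ε))) := by
    filter_upwards [(contDiff_rodGauge ε r).continuous.continuousAt.eventually
      (Iio_mem_nhds h1)] with y hy
    rw [corrector, Real.smoothTransition.one_of_one_le (by linarith [hy]), mul_one]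
  have h3 : gradient (corrector ε r i) x
      = Real.cos (2 * (Real.pi * (x i.castSucc / ε))) • planeVec i := by
    ext j
    rw [gradient_apply, h2.fderiv_eq, (hasFDerivAt_amplitude hε i x).fderiv]
    simp [planeVec, eq_comm]
  have h4 : gradient (corrector ε r i) x - planeVec i
      = (-(2 * Real.sin (Real.pi * (x i.castSucc / ε)) ^ 2)) • planeVec i := by
    rw [h3, Real.cos_two_mul, Real.cos_sq']
    module
  rw [h4, norm_smul]
  have h5 := sin_sq_le_of_rodGauge_le hr (h1.le.trans (by norm_num)) i
  have h6 : Real.sin (Real.pi * (x i.castSucc / ε)) ^ 2 ≤ (2 * Real.pi * r) ^ 2 := by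
    rw [← sq_abs]
    gcongr
  have h7 : ‖planeVec i‖ = 1 := by simp [planeVec]
  rw [h7, mul_one, norm_neg, Real.norm_of_nonneg (by positivity)]
  linarith [mul_pow (2 * Real.pi) r 2, mul_pow 2 Real.pi 2]

/-! ### Algebra of the conductivities -/

/-- The transpose of `α I₃ + β 𝓔(h)`, as a linear map. -/
def phaseT (α β : ℝ) (h : E3) : E3 →ₗ[ℝ] E3 :=
  α • LinearMap.id - β • Matrix.toEuclideanLin (hall h)

theorem phaseT_apply (α β : ℝ) (h ξ : E3) :
    phaseT α β h ξ = α • ξ - β • Matrix.toEuclideanLin (hall h) ξ := rfl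

theorem hall_transpose (h : E3) : (hall h).transpose = -hall h := by
  ext i j
  fin_cases i <;> fin_cases j <;> simp [hall]

theorem toEuclideanLin_one_apply (ξ : E3) :
    Matrix.toEuclideanLin (1 : Matrix (Fin 3) (Fin 3) ℝ) ξ = ξ := by
  simp

theorem toEuclideanLin_phase_apply (α β : ℝ) (h ξ : E3) :
    Matrix.toEuclideanLin (α • (1 : Matrix (Fin 3) (Fin 3) ℝ) + β • hall h) ξ
      = α • ξ + β • Matrix.toEuclideanLin (hall h) ξ := by
  rw [map_add, map_smul, map_smul, LinearMap.add_apply, LinearMap.smul_apply, LinearMap.smul_apply,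
    toEuclideanLin_one_apply]

theorem toEuclideanLin_phase_transpose (α β : ℝ) (h ξ : E3) :
    Matrix.toEuclideanLin (α • (1 : Matrix (Fin 3) (Fin 3) ℝ) + β • hall h).transpose ξ
      = phaseT α β h ξ := by
  rw [Matrix.transpose_add, Matrix.transpose_smul, Matrix.transpose_smul, Matrix.transpose_one,
    hall_transpose, smul_neg, ← neg_smul, toEuclideanLin_phase_apply, phaseT_apply]
  module

theorem inner_hall_self (h ξ : E3) : inner ℝ (Matrix.toEuclideanLin (hall h) ξ) ξ = 0 := by
  have h1 := inner_toEuclideanLin (hall h) ξ ξ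
  rw [hall_transpose, map_neg, LinearMap.neg_apply, inner_neg_right, real_inner_comm] at h1
  have h2 := real_inner_comm ξ (Matrix.toEuclideanLin (hall h) ξ)
  linarith

theorem exists_norm_hall_le (h : E3) :
    ∃ H, 0 ≤ H ∧ ∀ ξ, ‖Matrix.toEuclideanLin (hall h) ξ‖ ≤ H * ‖ξ‖ :=
  ⟨_, norm_nonneg _, (LinearMap.toContinuousLinearMap (Matrix.toEuclideanLin (hall h))).le_opNorm⟩

theorem norm_phase_le {h : E3} {H : ℝ}
    (hH : ∀ ξ, ‖Matrix.toEuclideanLin (hall h) ξ‖ ≤ H * ‖ξ‖) (α β : ℝ) (ξ : E3) :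
    ‖α • ξ + β • Matrix.toEuclideanLin (hall h) ξ‖ ≤ (|α| + |β| * H) * ‖ξ‖ := by
  refine (norm_add_le _ _).trans ?_
  rw [norm_smul, norm_smul, Real.norm_eq_abs, Real.norm_eq_abs, add_mul, mul_assoc]
  gcongr
  exact hH ξ

theorem norm_phaseT_le {h : E3} {H : ℝ}
    (hH : ∀ ξ, ‖Matrix.toEuclideanLin (hall h) ξ‖ ≤ H * ‖ξ‖) (α β : ℝ) (ξ : E3) :
    ‖phaseT α β h ξ‖ ≤ (|α| + |β| * H) * ‖ξ‖ := by
  have := norm_phase_le hH α (-β) ξ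
  rwa [neg_smul, ← sub_eq_add_neg, abs_neg] at this

open Classical in
theorem toEuclideanLin_conductivity (Ω : Set E3) (ε r α₁ β₁ α₂ β₂ : ℝ) (h x ξ : E3) :
    Matrix.toEuclideanLin (conductivity Ω ε r α₁ β₁ α₂ β₂ h x) ξ
      = (if x ∈ fibers Ω ε r then α₂ else α₁) • ξ
        + (if x ∈ fibers Ω ε r then β₂ else β₁) • Matrix.toEuclideanLin (hall h) ξ := by
  unfold conductivity
  split_ifs <;> exact toEuclideanLin_phase_apply _ _ _ _

open Classical in
theorem toEuclideanLin_conductivity_transpose (Ω : Set E3) (ε r α₁ β₁ α₂ β₂ : ℝ) (h x ξ : E3) :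
    Matrix.toEuclideanLin (conductivity Ω ε r α₁ β₁ α₂ β₂ h x).transpose ξ
      = if x ∈ fibers Ω ε r then phaseT α₂ β₂ h ξ else phaseT α₁ β₁ h ξ := by
  unfold conductivity
  split_ifs <;> exact toEuclideanLin_phase_transpose _ _ _ _

theorem measurable_conductivity (hΩ : MeasurableSet Ω) {ε : ℝ} (hε : 0 < ε) (r α₁ β₁ α₂ β₂ : ℝ)
    (h : E3) (i j : Fin 3) :
    Measurable fun x => conductivity Ω ε r α₁ β₁ α₂ β₂ h x i j := by
  have h1 : (fun x => conductivity Ω ε r α₁ β₁ α₂ β₂ h x i j) = fun x =>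
      open Classical in if x ∈ fibers Ω ε r
      then (α₂ • (1 : Matrix (Fin 3) (Fin 3) ℝ) + β₂ • hall h) i j
      else (α₁ • (1 : Matrix (Fin 3) (Fin 3) ℝ) + β₁ • hall h) i j := by
    ext x
    unfold conductivity
    split_ifs <;> rfl
  rw [h1]
  exact Measurable.ite (measurableSet_fibers hΩ hε r) measurable_const measurable_const

theorem exists_norm_conductivity_le (Ω : Set E3) (ε r α₁ β₁ α₂ β₂ : ℝ) (h : E3) :
    ∃ C, ∀ x ξ, ‖Matrix.toEuclideanLin (conductivity Ω ε r α₁ β₁ α₂ β₂ h x) ξ‖ ≤ C * ‖ξ‖ := by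
  obtain ⟨H, hH0, hH⟩ := exists_norm_hall_le h
  refine ⟨max (|α₁| + |β₁| * H) (|α₂| + |β₂| * H), fun x ξ => ?_⟩
  rw [toEuclideanLin_conductivity]
  split_ifs
  · refine (norm_phase_le hH _ _ _).trans ?_
    gcongr
    exact le_max_right _ _
  · refine (norm_phase_le hH _ _ _).trans ?_
    gcongr
    exact le_max_left _ _

/-- The antisymmetric Hall part contributes nothing to the quadratic form. -/
theorem coercive_conductivity (Ω : Set E3) (ε r α₁ β₁ α₂ β₂ : ℝ) (h x ξ : E3) :
    min α₁ α₂ * ‖ξ‖ ^ 2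
      ≤ inner ℝ (Matrix.toEuclideanLin (conductivity Ω ε r α₁ β₁ α₂ β₂ h x) ξ) ξ := by
  rw [toEuclideanLin_conductivity, inner_add_left, real_inner_smul_left, real_inner_smul_left,
    inner_hall_self, mul_zero, add_zero, real_inner_self_eq_norm_sq]
  gcongr
  split_ifs
  · exact min_le_right _ _
  · exact min_le_left _ _

/-- The vertical conductivity produced by the fibers. -/
def fiberCoeff (α β : ℝ) (h : E3) : ℝ :=
  (α ^ 3 + α * β ^ 2 * ‖h‖ ^ 2) / (α ^ 2 + β ^ 2 * (h 2) ^ 2)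

/-- The horizontal components of the current direction in the fibers. -/
def fiberSlope (α β : ℝ) (h : E3) (i : Fin 2) : ℝ :=
  ![α * β * h 1 + β ^ 2 * (h 2 * h 0), -(α * β * h 0) + β ^ 2 * (h 2 * h 1)] i
    / (α ^ 2 + β ^ 2 * (h 2) ^ 2)

/-- The algebraic core. Requiring the two horizontal components of the flux to vanish is a linear
system for the slopes with determinant `α² + β² h₃²`; the vertical component that remains is the
effective coefficient. -/
theorem phaseT_fiberSlope {α : ℝ} (hα : 0 < α) (β : ℝ) (h : E3) :
    phaseT α β h (fiberSlope α β h 0 • planeVec 0 + fiberSlope α β h 1 • planeVec 1 + vert)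
      = fiberCoeff α β h • vert := by
  have hΔ : α ^ 2 + β ^ 2 * (h 2) ^ 2 ≠ 0 := by positivity
  rw [phaseT_apply]
  ext i
  simp only [PiLp.sub_apply, PiLp.smul_apply, PiLp.add_apply, toEuclideanLin_apply_coord,
    Fin.sum_univ_three, smul_eq_mul, fiberSlope, fiberCoeff, norm_sq_E3]
  fin_cases i <;> simp [planeVec, vert, hall] <;> field_simp <;> ring

/-- Homogeneity of degree one turns the coefficient of diverging parameters, weighted by the volume
fraction, into the coefficient of convergent ones. -/
theorem fiberCoeff_smul {t : ℝ} (ht : t ≠ 0) (α β : ℝ) (h : E3) :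
    fiberCoeff (t * α) (t * β) h = t * fiberCoeff α β h := by
  unfold fiberCoeff
  have h1 : (t * α) ^ 3 + t * α * (t * β) ^ 2 * ‖h‖ ^ 2
      = t ^ 2 * (t * (α ^ 3 + α * β ^ 2 * ‖h‖ ^ 2)) := by ring
  have h2 : (t * α) ^ 2 + (t * β) ^ 2 * (h 2) ^ 2
      = t ^ 2 * (α ^ 2 + β ^ 2 * (h 2) ^ 2) := by ring
  rw [h1, h2, mul_div_mul_left _ _ (pow_ne_zero 2 ht), mul_div_assoc]

/-- Homogeneity of degree zero: the slopes themselves converge, even when the fiber parameters blow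
up. -/
theorem fiberSlope_smul {t : ℝ} (ht : t ≠ 0) (α β : ℝ) (h : E3) (i : Fin 2) :
    fiberSlope (t * α) (t * β) h i = fiberSlope α β h i := by
  unfold fiberSlope
  have h2 : (t * α) ^ 2 + (t * β) ^ 2 * (h 2) ^ 2
      = t ^ 2 * (α ^ 2 + β ^ 2 * (h 2) ^ 2) := by ring
  rw [h2, ← mul_div_mul_left _ (α ^ 2 + β ^ 2 * (h 2) ^ 2) (pow_ne_zero 2 ht)]
  congr 1
  fin_cases i <;> simp <;> ring

theorem tendsto_fiberCoeff {a b : ℕ → ℝ} {α β : ℝ} (hα : 0 < α) (ha : Tendsto a atTop (𝓝 α))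
    (hb : Tendsto b atTop (𝓝 β)) (h : E3) :
    Tendsto (fun n => fiberCoeff (a n) (b n) h) atTop (𝓝 (fiberCoeff α β h)) := by
  unfold fiberCoeff
  refine Tendsto.div ?_ ?_ (by positivity)
  · exact (ha.pow 3).add ((ha.mul (hb.pow 2)).mul_const _)
  · exact (ha.pow 2).add ((hb.pow 2).mul_const _)

theorem tendsto_fiberSlope {a b : ℕ → ℝ} {α β : ℝ} (hα : 0 < α) (ha : Tendsto a atTop (𝓝 α))
    (hb : Tendsto b atTop (𝓝 β)) (h : E3) (i : Fin 2) :
    Tendsto (fun n => fiberSlope (a n) (b n) h i) atTop (𝓝 (fiberSlope α β h i)) := by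
  unfold fiberSlope
  refine Tendsto.div ?_ ?_ (by positivity)
  · fin_cases i
    · exact ((ha.mul hb).mul_const _).add ((hb.pow 2).mul_const _)
    · exact ((ha.mul hb).mul_const _).neg.add ((hb.pow 2).mul_const _)
  · exact (ha.pow 2).add ((hb.pow 2).mul_const _)

theorem homogenized_eq (α₁ β₁ α₂ β₂ : ℝ) (h : E3) :
    homogenized α₁ β₁ α₂ β₂ h = (α₁ • (1 : Matrix (Fin 3) (Fin 3) ℝ) + β₁ • hall h)
      + fiberCoeff α₂ β₂ h • Matrix.vecMulVec (Pi.single 2 1) (Pi.single 2 1) := by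
  unfold homogenized fiberCoeff
  abel

theorem toEuclideanLin_vertical (ξ : E3) :
    Matrix.toEuclideanLin (Matrix.vecMulVec (Pi.single 2 1) (Pi.single 2 1) :
      Matrix (Fin 3) (Fin 3) ℝ) ξ = ξ 2 • vert := by
  ext i
  rw [toEuclideanLin_apply_coord]
  fin_cases i <;> simp [Matrix.vecMulVec_apply, vert, Fin.sum_univ_three]

theorem toEuclideanLin_homogenized (α₁ β₁ α₂ β₂ : ℝ) (h ξ : E3) :
    Matrix.toEuclideanLin (homogenized α₁ β₁ α₂ β₂ h) ξ
      = (α₁ • ξ + β₁ • Matrix.toEuclideanLin (hall h) ξ) + fiberCoeff α₂ β₂ h • (ξ 2 • vert) := by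
  rw [homogenized_eq, map_add, map_smul, LinearMap.add_apply, LinearMap.smul_apply,
    toEuclideanLin_vertical, toEuclideanLin_phase_apply]

theorem toEuclideanLin_homogenized_transpose (α₁ β₁ α₂ β₂ : ℝ) (h ξ : E3) :
    Matrix.toEuclideanLin (homogenized α₁ β₁ α₂ β₂ h).transpose ξ
      = phaseT α₁ β₁ h ξ + fiberCoeff α₂ β₂ h • (ξ 2 • vert) := by
  rw [homogenized_eq, Matrix.transpose_add, Matrix.transpose_smul, Matrix.transpose_vecMulVec,
    map_add, map_smul, LinearMap.add_apply, LinearMap.smul_apply, toEuclideanLin_vertical,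
    toEuclideanLin_phase_transpose]

theorem exists_norm_homogenized_le (α₁ β₁ α₂ β₂ : ℝ) (h : E3) :
    ∃ C, ∀ ξ, ‖Matrix.toEuclideanLin (homogenized α₁ β₁ α₂ β₂ h) ξ‖ ≤ C * ‖ξ‖ :=
  ⟨_, (LinearMap.toContinuousLinearMap
    (Matrix.toEuclideanLin (homogenized α₁ β₁ α₂ β₂ h))).le_opNorm⟩

theorem fiberCoeff_nonneg {α : ℝ} (hα : 0 < α) (β : ℝ) (h : E3) : 0 ≤ fiberCoeff α β h := by
  unfold fiberCoeff
  positivity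

theorem coercive_homogenized {α₂ : ℝ} (hα₂ : 0 < α₂) (α₁ β₁ β₂ : ℝ) (h ξ : E3) :
    α₁ * ‖ξ‖ ^ 2 ≤ inner ℝ (Matrix.toEuclideanLin (homogenized α₁ β₁ α₂ β₂ h) ξ) ξ := by
  rw [toEuclideanLin_homogenized, inner_add_left, inner_add_left, real_inner_smul_left,
    real_inner_smul_left, inner_hall_self, mul_zero, add_zero, real_inner_self_eq_norm_sq,
    smul_smul, real_inner_comm, inner_smul_vert]
  have := mul_nonneg (fiberCoeff_nonneg hα₂ β₂ h) (mul_self_nonneg (ξ 2))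
  linarith

/-! ### Oscillating test functions -/

theorem rods_subset_rods {ε r s : ℝ} (hε : 0 < ε) (hrs : r ≤ s) : rods ε r ⊆ rods ε s := by
  rintro x ⟨ν, hν⟩
  exact ⟨ν, hν.trans (by gcongr)⟩

/-- A field which is of size `a` in thin rods and of size `b` elsewhere is small in `L²(Ω)`. -/
theorem exists_norm_toLp_le {M : ℝ} (hM : 0 ≤ M) (hΩ : ∀ x ∈ Ω, x 2 ∈ Set.Ioo (0 : ℝ) 1)
    (hΩM : ∀ x ∈ Ω, ‖planeProj x‖ ≤ M) (hΩf : volume Ω ≠ ⊤) :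
    ∃ L, 0 ≤ L ∧ ∀ ε ρ a b : ℝ, 0 < ε → ε ≤ 1 → 0 < ρ → ρ ≤ 1 → 0 ≤ a → 0 ≤ b →
      ∀ (X : E3 → E3) (hX : MemLp X 2 (volume.restrict Ω)),
        (∀ᵐ x ∂(volume.restrict Ω), ‖X x‖ ≤ (rods ε ρ).indicator (fun _ => a) x + b) →
        ‖hX.toLp X‖ ≤ L * (a * ρ + b) := by
  have hpi := Real.pi_pos
  set V := volume.real Ω
  set D := 2 * ((2 * M + 5) ^ 2 * Real.pi + V)
  have hV : 0 ≤ V := measureReal_nonneg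
  have hD : 0 ≤ D := by positivity
  refine ⟨√D, Real.sqrt_nonneg _, fun ε ρ a b hε hε1 hρ hρ1 ha hb X hX h => ?_⟩
  have : IsFiniteMeasure (volume.restrict Ω) := ⟨by simpa using hΩf.lt_top⟩
  have hi : Integrable ((rods ε ρ).indicator (fun _ => 2 * a ^ 2)) (volume.restrict Ω) :=
    (integrable_const _).indicator (measurableSet_rods ε ρ)
  have hvol : (volume.restrict Ω).real (rods ε ρ) ≤ (2 * M + 5) ^ 2 * (Real.pi * ρ ^ 2) := by
    rw [measureReal_restrict_apply (measurableSet_rods ε ρ), Set.inter_comm, measureReal_def]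
    exact ENNReal.toReal_le_of_le_ofReal (by positivity)
      (volume_inter_rods_le hM hΩ hΩM hε hε1 hρ hρ1)
  have h1 : ‖hX.toLp X‖ ^ 2 ≤ 2 * a ^ 2 * ((2 * M + 5) ^ 2 * (Real.pi * ρ ^ 2)) + 2 * b ^ 2 * V := by
    rw [norm_toLp_sq hX]
    -- Pointwise `(a + b)² ≤ 2a² + 2b²`, with the first term carried only by rods of volume of order
    -- `ρ²`.
    calc ∫ x in Ω, ‖X x‖ ^ 2
        ≤ ∫ x in Ω, ((rods ε ρ).indicator (fun _ => 2 * a ^ 2) x + 2 * b ^ 2) := by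
          refine integral_mono_ae hX.integrable_norm_pow' (hi.add (integrable_const _)) ?_
          filter_upwards [h] with x hx
          by_cases hxr : x ∈ rods ε ρ
          · simp only [Set.indicator_of_mem hxr] at hx ⊢
            nlinarith [norm_nonneg (X x), sq_nonneg (a - b)]
          · simp only [Set.indicator_of_notMem hxr] at hx ⊢
            nlinarith [norm_nonneg (X x), sq_nonneg b]
      _ = 2 * a ^ 2 * (volume.restrict Ω).real (rods ε ρ) + 2 * b ^ 2 * V := by
          rw [integral_add hi (integrable_const _), integral_indicator_const _ (measurableSet_rods ε ρ),
            integral_const, measureReal_restrict_apply_univ]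
          simp only [smul_eq_mul, V]
          ring
      _ ≤ _ := by gcongr
  refine abs_le_of_sq_le_sq' ?_ (by positivity) |>.2
  refine h1.trans ?_
  rw [mul_pow, Real.sq_sqrt hD]
  have h2 : a ^ 2 * ρ ^ 2 ≤ (a * ρ + b) ^ 2 := by
    have : 0 ≤ a * ρ := by positivity
    nlinarith
  have h3 : b ^ 2 ≤ (a * ρ + b) ^ 2 := by
    have : 0 ≤ a * ρ := by positivity
    nlinarith
  calc 2 * a ^ 2 * ((2 * M + 5) ^ 2 * (Real.pi * ρ ^ 2)) + 2 * b ^ 2 * V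
      = 2 * ((2 * M + 5) ^ 2 * Real.pi) * (a ^ 2 * ρ ^ 2) + 2 * V * b ^ 2 := by ring
    _ ≤ 2 * ((2 * M + 5) ^ 2 * Real.pi) * (a * ρ + b) ^ 2 + 2 * V * (a * ρ + b) ^ 2 := by gcongr
    _ = D * (a * ρ + b) ^ 2 := by ring

/-- The coefficient of the corrector in the direction `i`, when the current in the fibers has slope
`s i` in this direction. -/
def tilt (φ : E3 → ℝ) (s : Fin 2 → ℝ) (i : Fin 2) (x : E3) : ℝ :=
  fderiv ℝ φ x (s i • vert - planeVec i)

/-- The oscillating part of the test functions. -/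
def oscillation (φ : E3 → ℝ) (ε r : ℝ) (s : Fin 2 → ℝ) (x : E3) : ℝ :=
  tilt φ s 0 x * corrector ε r 0 x + tilt φ s 1 x * corrector ε r 1 x

theorem IsTestFunction.tilt {φ : E3 → ℝ} (hφ : IsTestFunction Ω φ) (s : Fin 2 → ℝ) (i : Fin 2) :
    IsTestFunction Ω (tilt φ s i) := hφ.fderiv_apply _

theorem IsTestFunction.exists_bound_tilt {φ : E3 → ℝ} (hφ : IsTestFunction Ω φ) :
    ∃ A, 0 ≤ A ∧ ∀ s i x, |HallFibers.tilt φ s i x| ≤ A * (|s i| + 1) ∧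
      ‖gradient (HallFibers.tilt φ s i) x‖ ≤ A * (|s i| + 1) := by
  have hv := hφ.fderiv_apply vert
  have hp := fun i => hφ.fderiv_apply (planeVec i)
  obtain ⟨A, hA0, hA1, hA2⟩ := hv.exists_bound
  choose B hB0 hB1 hB2 using fun i => (hp i).exists_bound
  have hle : ∀ i, B i ≤ A + B 0 + B 1 := by
    intro i
    fin_cases i
    · simpa using by linarith [hB0 1]
    · simpa using by linarith [hB0 0]
  have hA : A ≤ A + B 0 + B 1 := by linarith [hB0 0, hB0 1]
  refine ⟨A + B 0 + B 1, hA0.trans hA, fun s i x => ⟨?_, ?_⟩⟩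
  · have h1 : HallFibers.tilt φ s i x = s i * fderiv ℝ φ x vert - fderiv ℝ φ x (planeVec i) := by
      simp [HallFibers.tilt]
    rw [h1]
    refine (abs_sub _ _).trans ?_
    rw [abs_mul, mul_add, mul_one, mul_comm]
    gcongr
    · exact (hA1 x).trans hA
    · exact (hB1 i x).trans (hle i)
  · have h1 : HallFibers.tilt φ s i
        = fun x => s i * fderiv ℝ φ x vert - fderiv ℝ φ x (planeVec i) := by
      ext x
      simp [HallFibers.tilt]
    have h2 : gradient (HallFibers.tilt φ s i) x = s i • gradient (fun x => fderiv ℝ φ x vert) x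
        - gradient (fun x => fderiv ℝ φ x (planeVec i)) x := by
      rw [h1]
      unfold gradient
      rw [fderiv_fun_sub ((hv.differentiable x).const_mul _) ((hp i).differentiable x),
        fderiv_const_mul (hv.differentiable x), map_sub, map_smul]
    rw [h2]
    refine (norm_sub_le _ _).trans ?_
    rw [norm_smul, Real.norm_eq_abs, mul_add, mul_one, mul_comm]
    gcongr
    · exact (hA2 x).trans hA
    · exact (hB2 i x).trans (hle i)

theorem IsTestFunction.oscillation {φ : E3 → ℝ} (hφ : IsTestFunction Ω φ) (ε r : ℝ)
    (s : Fin 2 → ℝ) : IsTestFunction Ω (oscillation φ ε r s) :=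
  ((hφ.tilt s 0).mul_left (contDiff_corrector ε r 0)).add
    ((hφ.tilt s 1).mul_left (contDiff_corrector ε r 1))

theorem gradient_oscillation {φ : E3 → ℝ} (hφ : IsTestFunction Ω φ) (ε r : ℝ) (s : Fin 2 → ℝ)
    (x : E3) :
    gradient (oscillation φ ε r s) x =
      (tilt φ s 0 x • gradient (corrector ε r 0) x + tilt φ s 1 x • gradient (corrector ε r 1) x)
      + (corrector ε r 0 x • gradient (tilt φ s 0) x
        + corrector ε r 1 x • gradient (tilt φ s 1) x) := by
  have h0 := (hφ.tilt s 0).differentiable x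
  have h1 := (hφ.tilt s 1).differentiable x
  have c0 := (contDiff_corrector ε r 0).differentiable (by simp) x
  have c1 := (contDiff_corrector ε r 1).differentiable (by simp) x
  have h2 : gradient (oscillation φ ε r s) x
      = gradient (fun x => tilt φ s 0 x * corrector ε r 0 x) x
        + gradient (fun x => tilt φ s 1 x * corrector ε r 1 x) x := by
    unfold oscillation gradient
    rw [fderiv_fun_add (h0.fun_mul c0) (h1.fun_mul c1), map_add]
  rw [h2, gradient_mul h0 c0, gradient_mul h1 c1]
  abel

/-- The tilts are designed for this: they remove the horizontal gradient of `φ` and put slope times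
vertical derivative in its place. -/
theorem gradient_add_tilt (φ : E3 → ℝ) (s : Fin 2 → ℝ) (x : E3) :
    gradient φ x + (tilt φ s 0 x • planeVec 0 + tilt φ s 1 x • planeVec 1)
      = fderiv ℝ φ x vert • (s 0 • planeVec 0 + s 1 • planeVec 1 + vert) := by
  ext i
  simp only [tilt, map_sub, map_smul, PiLp.add_apply, PiLp.smul_apply, gradient_apply, smul_eq_mul]
  fin_cases i <;> simp [planeVec, vert] <;> ring

/-- Terms where the derivative falls on the tilts carry an undifferentiated corrector, bounded by `2
ε r`. -/
theorem norm_gradient_oscillation_sub_le {φ : E3 → ℝ} (hφ : IsTestFunction Ω φ) {ε r B : ℝ}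
    (hε : 0 < ε) (hr : 0 < r) {s : Fin 2 → ℝ} (hB : ∀ i x, ‖gradient (tilt φ s i) x‖ ≤ B) (x : E3) :
    ‖gradient (oscillation φ ε r s) x
      - (tilt φ s 0 x • gradient (corrector ε r 0) x
        + tilt φ s 1 x • gradient (corrector ε r 1) x)‖ ≤ 4 * B * (ε * r) := by
  rw [gradient_oscillation hφ, add_sub_cancel_left]
  refine (norm_add_le _ _).trans ?_
  rw [norm_smul, norm_smul, Real.norm_eq_abs, Real.norm_eq_abs]
  have hb : ∀ i, |corrector ε r i x| * ‖gradient (tilt φ s i) x‖ ≤ 2 * (ε * r) * B := fun i =>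
    mul_le_mul (abs_corrector_le hε hr i x) (hB i x) (norm_nonneg _) (by positivity)
  linarith [hb 0, hb 1]

theorem norm_gradient_oscillation_le {φ : E3 → ℝ} (hφ : IsTestFunction Ω φ) {ε r B C : ℝ}
    (hε : 0 < ε) (hr : 0 < r) {s : Fin 2 → ℝ} (hB1 : ∀ i x, |tilt φ s i x| ≤ B)
    (hB : ∀ i x, ‖gradient (tilt φ s i) x‖ ≤ B)
    (hC : ∀ i x, ‖gradient (corrector ε r i) x‖ ≤ (rods ε (3 * r)).indicator (fun _ => C) x)
    (x : E3) :
    ‖gradient (oscillation φ ε r s) x‖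
      ≤ (rods ε (3 * r)).indicator (fun _ => 2 * B * C) x + 4 * B * (ε * r) := by
  have h1 := norm_gradient_oscillation_sub_le hφ hε hr hB x
  have hb : ∀ i, ‖tilt φ s i x • gradient (corrector ε r i) x‖
      ≤ B * (rods ε (3 * r)).indicator (fun _ => C) x := fun i => by
    rw [norm_smul, Real.norm_eq_abs]
    exact mul_le_mul (hB1 i x) (hC i x) (norm_nonneg _) ((abs_nonneg _).trans (hB1 i x))
  have h2 := norm_add_le (tilt φ s 0 x • gradient (corrector ε r 0) x)
    (tilt φ s 1 x • gradient (corrector ε r 1) x)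
  have h3 := norm_le_norm_add_norm_sub' (gradient (oscillation φ ε r s) x)
    (tilt φ s 0 x • gradient (corrector ε r 0) x + tilt φ s 1 x • gradient (corrector ε r 1) x)
  have h4 : (rods ε (3 * r)).indicator (fun _ => 2 * B * C) x
      = 2 * (B * (rods ε (3 * r)).indicator (fun _ => C) x) := by
    by_cases hx : x ∈ rods ε (3 * r)
    · simp only [Set.indicator_of_mem hx]
      ring
    · simp only [Set.indicator_of_notMem hx, mul_zero]
  rw [h4]
  linarith [hb 0, hb 1]

theorem norm_gradient_oscillation_sub_tilt_le {φ : E3 → ℝ} (hφ : IsTestFunction Ω φ) {ε r B : ℝ}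
    (hε : 0 < ε) (hr : 0 < r) {s : Fin 2 → ℝ} (hB1 : ∀ i x, |tilt φ s i x| ≤ B)
    (hB : ∀ i x, ‖gradient (tilt φ s i) x‖ ≤ B) {x : E3} (hx : x ∈ rods ε r) :
    ‖gradient (oscillation φ ε r s) x - (tilt φ s 0 x • planeVec 0 + tilt φ s 1 x • planeVec 1)‖
      ≤ 16 * Real.pi ^ 2 * B * r ^ 2 + 4 * B * (ε * r) := by
  have h1 := norm_gradient_oscillation_sub_le hφ hε hr hB x
  have hb : ∀ i, ‖tilt φ s i x • (gradient (corrector ε r i) x - planeVec i)‖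
      ≤ B * (8 * Real.pi ^ 2 * r ^ 2) := fun i => by
    rw [norm_smul, Real.norm_eq_abs]
    exact mul_le_mul (hB1 i x) (norm_gradient_corrector_sub_le hε hr i hx) (norm_nonneg _)
      ((abs_nonneg _).trans (hB1 i x))
  have h2 : gradient (oscillation φ ε r s) x
      - (tilt φ s 0 x • planeVec 0 + tilt φ s 1 x • planeVec 1)
      = (gradient (oscillation φ ε r s) x
        - (tilt φ s 0 x • gradient (corrector ε r 0) x
          + tilt φ s 1 x • gradient (corrector ε r 1) x))
        + tilt φ s 0 x • (gradient (corrector ε r 0) x - planeVec 0)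
        + tilt φ s 1 x • (gradient (corrector ε r 1) x - planeVec 1) := by
    module
  rw [h2]
  refine norm_add₃_le.trans ?_
  linarith [hb 0, hb 1]

/-! ### The remainder in the equation tested with oscillating functions -/

theorem exists_norm_conductivity_transpose_le (Ω : Set E3) (ε r α₁ β₁ α₂ β₂ : ℝ) (h : E3) :
    ∃ C, ∀ x ξ,
      ‖Matrix.toEuclideanLin (conductivity Ω ε r α₁ β₁ α₂ β₂ h x).transpose ξ‖ ≤ C * ‖ξ‖ := by
  obtain ⟨H, hH0, hH⟩ := exists_norm_hall_le h
  refine ⟨max (|α₁| + |β₁| * H) (|α₂| + |β₂| * H), fun x ξ => ?_⟩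
  rw [toEuclideanLin_conductivity_transpose]
  split_ifs
  · refine (norm_phaseT_le hH _ _ _).trans ?_
    gcongr
    exact le_max_right _ _
  · refine (norm_phaseT_le hH _ _ _).trans ?_
    gcongr
    exact le_max_left _ _

/-- The difference between the flux of the oscillating test functions, for the transposed
conductivity, and the homogenized flux, up to the oscillation of the density of the rods. -/
def fluxRemainder (Ω : Set E3) (φ : E3 → ℝ) (ε r α₁ β₁ α β κ : ℝ) (h x : E3) : E3 :=
  Matrix.toEuclideanLin (conductivity Ω ε r α₁ β₁ α β h x).transpose
      (gradient φ x + gradient (oscillation φ ε r (fiberSlope α β h)) x)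
    - (phaseT α₁ β₁ h (gradient φ x) + κ • (gradient φ x 2 • vert))
    - (Real.pi * r ^ 2 * fiberCoeff α β h * (rodDensity ε r x * fderiv ℝ φ x vert)) • vert

/-- In a rod the leading flux is exactly vertical, by the choice of slopes. The density term removes
it up to a factor `π r²`, so the singular coefficient survives only through its convergent multiple
`π r² c`. -/
theorem fluxRemainder_of_mem {φ : E3 → ℝ} {ε r α₁ β₁ α β κ : ℝ} {h x : E3} (hα : 0 < α)
    (hr : 0 < r) (hx : x ∈ fibers Ω ε r ↔ x ∈ rods ε r) (hxr : x ∈ rods ε r) :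
    fluxRemainder Ω φ ε r α₁ β₁ α β κ h x
      = phaseT α β h (gradient (oscillation φ ε r (fiberSlope α β h)) x
          - (tilt φ (fiberSlope α β h) 0 x • planeVec 0
            + tilt φ (fiberSlope α β h) 1 x • planeVec 1))
        - phaseT α₁ β₁ h (gradient φ x)
        + ((Real.pi * r ^ 2 * fiberCoeff α β h - κ) * fderiv ℝ φ x vert) • vert := by
  have hpi := Real.pi_pos
  have h1 := gradient_add_tilt φ (fiberSlope α β h) x
  have h2 : gradient φ x + gradient (oscillation φ ε r (fiberSlope α β h)) x
      = (gradient (oscillation φ ε r (fiberSlope α β h)) x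
          - (tilt φ (fiberSlope α β h) 0 x • planeVec 0
            + tilt φ (fiberSlope α β h) 1 x • planeVec 1))
        + fderiv ℝ φ x vert • (fiberSlope α β h 0 • planeVec 0 + fiberSlope α β h 1 • planeVec 1
          + vert) := by
    rw [← h1]
    abel
  have h3 : Real.pi * r ^ 2 * fiberCoeff α β h * (rodDensity ε r x * fderiv ℝ φ x vert)
      = (fiberCoeff α β h - Real.pi * r ^ 2 * fiberCoeff α β h) * fderiv ℝ φ x vert := by
    rw [rodDensity, Set.indicator_of_mem hxr]
    field_simp
  have h4 : gradient φ x 2 = fderiv ℝ φ x vert := gradient_apply φ x 2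
  rw [fluxRemainder, toEuclideanLin_conductivity_transpose, if_pos (hx.2 hxr), h2, map_add,
    map_smul, phaseT_fiberSlope hα, h3, h4]
  module

/-- Off the rods the centered density is `-1`, so the term removing `κ` is the same as in the rods.
-/
theorem fluxRemainder_of_notMem {φ : E3 → ℝ} {ε r α₁ β₁ α β κ : ℝ} {h x : E3}
    (hx : x ∈ fibers Ω ε r ↔ x ∈ rods ε r) (hxr : x ∉ rods ε r) :
    fluxRemainder Ω φ ε r α₁ β₁ α β κ h x
      = phaseT α₁ β₁ h (gradient (oscillation φ ε r (fiberSlope α β h)) x)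
        + ((Real.pi * r ^ 2 * fiberCoeff α β h - κ) * fderiv ℝ φ x vert) • vert := by
  have h4 : gradient φ x 2 = fderiv ℝ φ x vert := gradient_apply φ x 2
  rw [fluxRemainder, toEuclideanLin_conductivity_transpose, if_neg (fun h => hxr (hx.1 h)), map_add,
    rodDensity, Set.indicator_of_notMem hxr, h4]
  module

/-- In the rods a conductivity of order `r⁻²` multiplies a gradient error of order `r² + ε r`,
giving order `1 + ε / r`. This is not small pointwise, but it is confined to thin rods, so its `L²`
norm is of order `r + ε`. -/
theorem norm_fluxRemainder_le {φ : E3 → ℝ} (hφ : IsTestFunction Ω φ) {ε r α₁ β₁ α β κ A B C H P : ℝ}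
    {h x : E3} (hα : 0 < α) (hε : 0 < ε) (hr : 0 < r)
    (hx : x ∈ fibers Ω ε r ↔ x ∈ rods ε r) (hA0 : 0 ≤ A) (hA : ∀ x, ‖gradient φ x‖ ≤ A)
    (hB1 : ∀ i x, |tilt φ (fiberSlope α β h) i x| ≤ B)
    (hB : ∀ i x, ‖gradient (tilt φ (fiberSlope α β h) i) x‖ ≤ B)
    (hC0 : 0 ≤ C)
    (hC : ∀ i x, ‖gradient (corrector ε r i) x‖ ≤ (rods ε (3 * r)).indicator (fun _ => C) x)
    (hH0 : 0 ≤ H) (hH : ∀ ξ, ‖Matrix.toEuclideanLin (hall h) ξ‖ ≤ H * ‖ξ‖)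
    (hP : (|α| + |β| * H) * r ^ 2 ≤ P) :
    ‖fluxRemainder Ω φ ε r α₁ β₁ α β κ h x‖
      ≤ (rods ε (3 * r)).indicator (fun _ => P * (16 * Real.pi ^ 2 * B + 4 * B * (ε / r))
          + (|α₁| + |β₁| * H) * (A + 2 * B * C)) x
        + ((|α₁| + |β₁| * H) * (4 * B * (ε * r))
          + |Real.pi * r ^ 2 * fiberCoeff α β h - κ| * A) := by
  have hB0 : 0 ≤ B := (abs_nonneg _).trans (hB1 0 x)
  have hP0 : 0 ≤ P := le_trans (by positivity) hP
  have hd : |fderiv ℝ φ x vert| ≤ A := by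
    have h1 := (fderiv ℝ φ x).le_opNorm vert
    rw [norm_vert, mul_one, ← norm_gradient] at h1
    exact h1.trans (hA x)
  set Q := |α₁| + |β₁| * H
  have hQ : 0 ≤ Q := by positivity
  set δ := Real.pi * r ^ 2 * fiberCoeff α β h - κ
  have hlast : ‖(δ * fderiv ℝ φ x vert) • vert‖ ≤ |δ| * A := by
    rw [norm_smul, norm_vert, mul_one, norm_mul, Real.norm_eq_abs, Real.norm_eq_abs]
    gcongr
  by_cases hxr : x ∈ rods ε r
  · rw [fluxRemainder_of_mem hα hr hx hxr,
      Set.indicator_of_mem (rods_subset_rods hε (by linarith) hxr)]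
    refine (norm_add_le _ _).trans ?_
    have h1 := norm_phaseT_le hH α β (gradient (oscillation φ ε r (fiberSlope α β h)) x
          - (tilt φ (fiberSlope α β h) 0 x • planeVec 0
            + tilt φ (fiberSlope α β h) 1 x • planeVec 1))
    have h2 := norm_gradient_oscillation_sub_tilt_le hφ hε hr hB1 hB hxr
    have h3 := norm_phaseT_le hH α₁ β₁ (gradient φ x)
    have h4 := norm_sub_le (phaseT α β h (gradient (oscillation φ ε r (fiberSlope α β h)) x
          - (tilt φ (fiberSlope α β h) 0 x • planeVec 0
            + tilt φ (fiberSlope α β h) 1 x • planeVec 1))) (phaseT α₁ β₁ h (gradient φ x))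
    have h5 : (|α| + |β| * H) * (16 * Real.pi ^ 2 * B * r ^ 2 + 4 * B * (ε * r))
        = ((|α| + |β| * H) * r ^ 2) * (16 * Real.pi ^ 2 * B + 4 * B * (ε / r)) := by
      field_simp
    have h6 : ((|α| + |β| * H) * r ^ 2) * (16 * Real.pi ^ 2 * B + 4 * B * (ε / r))
        ≤ P * (16 * Real.pi ^ 2 * B + 4 * B * (ε / r)) := by
      gcongr
    have h7 := mul_le_mul_of_nonneg_left h2 (show 0 ≤ |α| + |β| * H by positivity)
    have h8 := mul_le_mul_of_nonneg_left (hA x) hQ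
    have h9 : 0 ≤ Q * (2 * B * C) := by positivity
    have h10 : 0 ≤ Q * (4 * B * (ε * r)) := by positivity
    linarith
  · rw [fluxRemainder_of_notMem hx hxr]
    refine (norm_add_le _ _).trans ?_
    have h1 := norm_phaseT_le hH α₁ β₁ (gradient (oscillation φ ε r (fiberSlope α β h)) x)
    have h2 := mul_le_mul_of_nonneg_left
      (norm_gradient_oscillation_le hφ hε hr hB1 hB hC x) hQ
    have h3 : Q * (rods ε (3 * r)).indicator (fun _ => 2 * B * C) x
        ≤ (rods ε (3 * r)).indicator (fun _ => P * (16 * Real.pi ^ 2 * B + 4 * B * (ε / r))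
          + Q * (A + 2 * B * C)) x := by
      by_cases hx3 : x ∈ rods ε (3 * r)
      · simp only [Set.indicator_of_mem hx3]
        have h9 : 0 ≤ P * (16 * Real.pi ^ 2 * B + 4 * B * (ε / r)) := by positivity
        have h10 : 0 ≤ Q * A := by positivity
        linarith
      · simp only [Set.indicator_of_notMem hx3, mul_zero, le_refl]
    linarith

theorem memLp_fluxRemainder (hΩm : MeasurableSet Ω) {φ : E3 → ℝ} (hφ : IsTestFunction Ω φ) {ε : ℝ}
    (hε : 0 < ε) (r α₁ β₁ α β α₂ β₂ : ℝ) (h : E3) :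
    MemLp (fluxRemainder Ω φ ε r α₁ β₁ α β (fiberCoeff α₂ β₂ h) h) 2 (volume.restrict Ω) := by
  obtain ⟨C, hC⟩ := exists_norm_conductivity_transpose_le Ω ε r α₁ β₁ α β h
  have h1 := memLp_toEuclideanLin
    (A := fun x => (conductivity Ω ε r α₁ β₁ α β h x).transpose)
    (fun i j => measurable_conductivity hΩm hε r α₁ β₁ α β h j i) hC
    ((hφ.memLp_gradient 2 (volume.restrict Ω)).add
      ((hφ.oscillation ε r (fiberSlope α β h)).memLp_gradient 2 (volume.restrict Ω)))
  have h2 := memLp_toEuclideanLin (A := fun _ => (homogenized α₁ β₁ α₂ β₂ h).transpose)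
    (fun i j => measurable_const) (fun _ => (LinearMap.toContinuousLinearMap
      (Matrix.toEuclideanLin (homogenized α₁ β₁ α₂ β₂ h).transpose)).le_opNorm)
    (hφ.memLp_gradient 2 (volume.restrict Ω))
  have h3 := (memLp_smul_vert (measurable_rodDensity ε r) (abs_rodDensity_le ε r)
    (hφ.fderiv_apply vert)).const_smul (Real.pi * r ^ 2 * fiberCoeff α β h)
  refine ((h1.sub h2).sub h3).ae_eq (ae_of_all _ fun x => ?_)
  rw [fluxRemainder, ← toEuclideanLin_homogenized_transpose,
    mul_smul (Real.pi * r ^ 2 * fiberCoeff α β h) _ vert]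
  rfl

/-- The equation tested with an oscillating function differs from the homogenized equation by a
pairing with the remainder and with the oscillation of the density of the rods. -/
theorem integral_flux_sub (hΩm : MeasurableSet Ω) {φ : E3 → ℝ} (hφ : IsTestFunction Ω φ) {ε : ℝ}
    (hε : 0 < ε) (r α₁ β₁ α β α₂ β₂ : ℝ) (h : E3) (u : H10 Ω) :
    (∫ x in Ω, inner ℝ (Matrix.toEuclideanLin (conductivity Ω ε r α₁ β₁ α β h x) (weakGrad u x))
        (weakGrad (testPair hφ + testPair (hφ.oscillation ε r (fiberSlope α β h))) x))
      - ∫ x in Ω, inner ℝ (Matrix.toEuclideanLin (homogenized α₁ β₁ α₂ β₂ h) (weakGrad u x))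
          (weakGrad (testPair hφ) x)
      = (∫ x in Ω, inner ℝ (weakGrad u x)
          (fluxRemainder Ω φ ε r α₁ β₁ α β (fiberCoeff α₂ β₂ h) h x))
        + Real.pi * r ^ 2 * fiberCoeff α β h * ∫ x in Ω, inner ℝ (weakGrad u x)
          ((rodDensity ε r x * fderiv ℝ φ x vert) • vert) := by
  obtain ⟨C, hC⟩ := exists_norm_conductivity_le Ω ε r α₁ β₁ α β h
  obtain ⟨D, hD⟩ := exists_norm_homogenized_le α₁ β₁ α₂ β₂ h
  have hu := memLp_weakGrad u
  have i1 := integrable_inner_of_memLp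
    (memLp_toEuclideanLin (measurable_conductivity hΩm hε r α₁ β₁ α β h) hC hu)
    (memLp_weakGrad (testPair hφ + testPair (hφ.oscillation ε r (fiberSlope α β h))))
  have i2 := integrable_inner_of_memLp
    (memLp_toEuclideanLin (A := fun _ => homogenized α₁ β₁ α₂ β₂ h)
      (fun i j => measurable_const) (fun _ => hD) hu) (memLp_weakGrad (testPair hφ))
  have i3 := integrable_inner_of_memLp hu (memLp_fluxRemainder hΩm hφ hε r α₁ β₁ α β α₂ β₂ h)
  have i4 := (integrable_inner_of_memLp hu (memLp_smul_vert (measurable_rodDensity ε r)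
    (abs_rodDensity_le ε r) (hφ.fderiv_apply vert))).const_mul
    (Real.pi * r ^ 2 * fiberCoeff α β h)
  rw [← integral_sub i1 i2, ← integral_const_mul, ← integral_add i3 i4]
  refine integral_congr_ae ?_
  filter_upwards [weakGrad_testPair hφ,
    weakGrad_testPair (hφ.oscillation ε r (fiberSlope α β h)),
    Lp.coeFn_add (weakGrad (testPair hφ))
      (weakGrad (testPair (hφ.oscillation ε r (fiberSlope α β h))))] with x h1 h2 h3
  -- Both matrices are transposed onto the explicit test gradients, so that only the gradient of `u`
  -- is left on the other side and the remainder appears by definition.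
  rw [weakGrad_add, h3, Pi.add_apply, h1, h2, inner_toEuclideanLin, inner_toEuclideanLin,
    ← inner_sub_right, ← real_inner_smul_right, ← inner_add_right, fluxRemainder,
    ← toEuclideanLin_homogenized_transpose, smul_smul, sub_add_cancel]

set_option maxHeartbeats 1000000 in
/-- The remainder of the equation tested with oscillating functions is small. -/
theorem exists_oscillating_test {M : ℝ} (hM : 0 ≤ M) (hΩm : MeasurableSet Ω)
    (hΩ : ∀ x ∈ Ω, x 2 ∈ Set.Ioo (0 : ℝ) 1) (hΩM : ∀ x ∈ Ω, ‖planeProj x‖ ≤ M)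
    (hΩf : volume Ω ≠ ⊤) {φ : E3 → ℝ} (hφ : IsTestFunction Ω φ) (α₁ β₁ α₂ β₂ : ℝ) (h : E3)
    {S P : ℝ} (hS : 0 ≤ S) (hP : 0 ≤ P) :
    ∃ K, 0 ≤ K ∧ ∀ ε r α β : ℝ, 0 < ε → ε ≤ 1 → 0 < r → r ≤ 1 / 4 → 0 < α →
      (|α| + |β|) * r ^ 2 ≤ P → (∀ i, |fiberSlope α β h i| ≤ S) →
      ∃ w : H10 Ω, ‖w‖ ≤ K * (ε + r) ∧ ∀ u : H10 Ω,
        |(∫ x in Ω, inner ℝ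
              (Matrix.toEuclideanLin (conductivity Ω ε r α₁ β₁ α β h x) (weakGrad u x))
              (weakGrad (testPair hφ + w) x))
            - ∫ x in Ω, inner ℝ (Matrix.toEuclideanLin (homogenized α₁ β₁ α₂ β₂ h) (weakGrad u x))
                (weakGrad (testPair hφ) x)|
          ≤ K * (ε + r + |Real.pi * r ^ 2 * fiberCoeff α β h - fiberCoeff α₂ β₂ h|
            + |Real.pi * r ^ 2 * fiberCoeff α β h| * (ε * √(1 + |Real.log r|))) * ‖u‖ := by
  have hpi := Real.pi_pos
  obtain ⟨H, hH0, hH⟩ := exists_norm_hall_le h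
  obtain ⟨A, hA0, -, hA⟩ := hφ.exists_bound
  obtain ⟨T, hT0, hT⟩ := hφ.exists_bound_tilt
  obtain ⟨C, hC0, hC⟩ := exists_norm_gradient_corrector_le
  obtain ⟨L, hL0, hL⟩ := exists_norm_toLp_le hM hΩ hΩM hΩf
  obtain ⟨D, hD0, hD⟩ := exists_abs_integral_rodDensity_le hM hΩ hΩM hΩf (hφ.fderiv_apply vert)
  set B := T * (S + 1)
  set Q := |α₁| + |β₁| * H
  have hB0 : 0 ≤ B := by positivity
  have hQ : 0 ≤ Q := by positivity
  set K1 := 3 * L * (6 * B * C + 4 * B)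
  set P' := P * (1 + H)
  have hP' : 0 ≤ P' := by positivity
  set K2 := 3 * L * (16 * Real.pi ^ 2 * B * P' + 4 * B * P' + Q * (A + 2 * B * C))
    + L * (Q * (4 * B) + A)
  have hK1 : 0 ≤ K1 := by positivity
  have hK2 : 0 ≤ K2 := by positivity
  refine ⟨K1 + K2 + D, by positivity, fun ε r α β hε hε1 hr hr1 hα hαβ hs => ?_⟩
  have hb1 : ∀ i x, |tilt φ (fiberSlope α β h) i x| ≤ B := fun i x =>
    (hT _ i x).1.trans (mul_le_mul_of_nonneg_left (by linarith [hs i]) hT0)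
  have hb2 : ∀ i x, ‖gradient (tilt φ (fiberSlope α β h) i) x‖ ≤ B := fun i x =>
    (hT _ i x).2.trans (mul_le_mul_of_nonneg_left (by linarith [hs i]) hT0)
  have hPr : (|α| + |β| * H) * r ^ 2 ≤ P' := by
    have h1 : |α| + |β| * H ≤ (|α| + |β|) * (1 + H) := by
      linarith [abs_nonneg β, mul_nonneg (abs_nonneg α) hH0]
    calc (|α| + |β| * H) * r ^ 2 ≤ (|α| + |β|) * (1 + H) * r ^ 2 := by gcongr
      _ = ((|α| + |β|) * r ^ 2) * (1 + H) := by ring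
      _ ≤ P' := mul_le_mul_of_nonneg_right hαβ (by linarith)
  have hεr : ε * r ≤ ε := mul_le_of_le_one_right hε.le (by linarith)
  refine ⟨testPair (hφ.oscillation ε r (fiberSlope α β h)), ?_, fun u => ?_⟩
  · set w := testPair (hφ.oscillation ε r (fiberSlope α β h))
    have h1 : ‖weakGrad w‖ ≤ L * (2 * B * C * (3 * r) + 4 * B * (ε * r)) :=
      hL ε (3 * r) (2 * B * C) (4 * B * (ε * r)) hε hε1 (by linarith) (by linarith) (by positivity)
        (by positivity) _ ((hφ.oscillation ε r (fiberSlope α β h)).memLp_gradient 2 _)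
        (ae_of_all _ (norm_gradient_oscillation_le hφ hε hr hb1 hb2 (hC ε r hε hr)))
    -- The Poincaré constant is `√5 ≤ 3`.
    have h2 : ‖w‖ ≤ 3 * ‖weakGrad w‖ := by
      refine abs_le_of_sq_le_sq' ?_ (by positivity) |>.2
      nlinarith [norm_sq_le_weakGrad hΩ w, sq_nonneg ‖weakGrad w‖]
    have h3 : L * (2 * B * C * (3 * r) + 4 * B * (ε * r)) ≤ L * ((6 * B * C + 4 * B) * (ε + r)) := by
      gcongr
      have e1 : 0 ≤ B * C * ε := by positivity
      have e2 : 0 ≤ B * r := by positivity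
      have e3 : B * (ε * r) ≤ B * ε := by gcongr
      linarith
    have h4 : K1 * (ε + r) ≤ (K1 + K2 + D) * (ε + r) := by
      gcongr
      linarith
    have h5 : 3 * (L * ((6 * B * C + 4 * B) * (ε + r))) = K1 * (ε + r) := by ring
    linarith
  · rw [integral_flux_sub hΩm hφ hε r α₁ β₁ α β α₂ β₂ h u]
    set c := Real.pi * r ^ 2 * fiberCoeff α β h with hc
    set δ := |c - fiberCoeff α₂ β₂ h|
    have hδ : 0 ≤ δ := abs_nonneg _
    have hX := memLp_fluxRemainder hΩm hφ hε r α₁ β₁ α β α₂ β₂ h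
    have h1 := abs_integral_inner_weakGrad_le u hX
    have h2 : ‖hX.toLp _‖ ≤ L * ((P' * (16 * Real.pi ^ 2 * B + 4 * B * (ε / r))
          + Q * (A + 2 * B * C)) * (3 * r) + (Q * (4 * B * (ε * r)) + δ * A)) := by
      refine hL ε (3 * r) _ _ hε hε1 (by linarith) (by linarith) (by positivity)
        (by positivity) _ hX ?_
      filter_upwards [ae_restrict_of_ae (fibers_ae_eq (Ω := Ω) hε hr (by linarith)),
        ae_restrict_mem hΩm] with x hx hxΩ
      exact norm_fluxRemainder_le hφ hα hε hr (hx hxΩ) hA0 hA hb1 hb2 hC0 (hC ε r hε hr) hH0 hH hPr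
    have h3 : L * ((P' * (16 * Real.pi ^ 2 * B + 4 * B * (ε / r))
          + Q * (A + 2 * B * C)) * (3 * r) + (Q * (4 * B * (ε * r)) + δ * A))
        ≤ K2 * (ε + r + δ) := by
      -- The radius `3 r` coming from the `L²` bound on rods cancels the denominator of `ε / r`.
      have e0 : (P' * (16 * Real.pi ^ 2 * B + 4 * B * (ε / r)) + Q * (A + 2 * B * C)) * (3 * r)
          = 3 * ((16 * Real.pi ^ 2 * B * P' + Q * (A + 2 * B * C)) * r + 4 * B * P' * ε) := by
        field_simp
        ring
      have e1 : (16 * Real.pi ^ 2 * B * P' + Q * (A + 2 * B * C)) * r + 4 * B * P' * ε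
          ≤ (16 * Real.pi ^ 2 * B * P' + 4 * B * P' + Q * (A + 2 * B * C)) * (ε + r + δ) := by
        calc _ ≤ (16 * Real.pi ^ 2 * B * P' + Q * (A + 2 * B * C)) * (ε + r + δ)
              + 4 * B * P' * (ε + r + δ) := by
              gcongr <;> linarith
          _ = _ := by ring
      have e2 : Q * (4 * B * (ε * r)) + δ * A ≤ (Q * (4 * B) + A) * (ε + r + δ) := by
        calc _ ≤ Q * (4 * B * (ε + r + δ)) + (ε + r + δ) * A := by
              gcongr <;> linarith
          _ = _ := by ring
      rw [e0]
      calc _ ≤ L * (3 * ((16 * Real.pi ^ 2 * B * P' + 4 * B * P' + Q * (A + 2 * B * C))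
              * (ε + r + δ)) + (Q * (4 * B) + A) * (ε + r + δ)) := by gcongr
        _ = _ := by ring
    have h4 := hD ε r hε hε1 hr hr1 u
    set η := ε * √(1 + |Real.log r|)
    have hη : 0 ≤ η := by positivity
    refine (abs_add_le _ _).trans ?_
    rw [abs_mul]
    calc _ ≤ ‖u‖ * (K2 * (ε + r + δ)) + |c| * (D * η * ‖u‖) :=
          add_le_add (h1.trans (mul_le_mul_of_nonneg_left (h2.trans h3) (norm_nonneg u)))
            (mul_le_mul_of_nonneg_left h4 (abs_nonneg c))
      _ = (K2 * (ε + r + δ) + D * (|c| * η)) * ‖u‖ := by ring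
      _ ≤ ((K1 + K2 + D) * (ε + r + δ) + (K1 + K2 + D) * (|c| * η)) * ‖u‖ := by
          gcongr <;> linarith
      _ = _ := by ring

/-! ### Passage to the limit -/

theorem isOpen_cylinder {U : Set E2} (hU : IsOpen U) : IsOpen (cylinder U) :=
  (hU.preimage planeProj.continuous).inter
    (isOpen_Ioo.preimage (by fun_prop : Continuous fun x : E3 => x 2))

theorem volume_cylinder_ne_top {U : Set E2} (hU : IsOpen U) (hb : Bornology.IsBounded U) :
    volume (cylinder U) ≠ ⊤ := by
  have h1 : cylinder U = slab 0 1 ∩ planeProj ⁻¹' U := by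
    ext x
    exact and_comm
  rw [h1, volume_slab_inter_preimage hU.measurableSet]
  exact ENNReal.mul_ne_top ENNReal.ofReal_ne_top hb.measure_lt_top.ne

theorem tendsto_mul_sqrt_one_add_log {ε r : ℕ → ℝ} (hε0 : ∀ n, 0 < ε n)
    (hε : Tendsto ε atTop (𝓝 0))
    (hεr : Tendsto (fun n => ε n ^ 2 * |Real.log (r n)|) atTop (𝓝 0)) :
    Tendsto (fun n => ε n * √(1 + |Real.log (r n)|)) atTop (𝓝 0) := by
  have h1 : Tendsto (fun n => √(ε n ^ 2 + ε n ^ 2 * |Real.log (r n)|)) atTop (𝓝 0) := by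
    have h := (Real.continuous_sqrt.tendsto _).comp ((hε.pow 2).add hεr)
    simpa [Function.comp_def] using h
  refine h1.congr fun n => ?_
  rw [← mul_one_add, Real.sqrt_mul (sq_nonneg _), Real.sqrt_sq (hε0 n).le]

theorem exists_coercive_homogenized_form (hΩ : ∀ x ∈ Ω, x 2 ∈ Set.Ioo (0 : ℝ) 1) {α₁ α₂ : ℝ}
    (hα₁ : 0 < α₁) (hα₂ : 0 < α₂) (β₁ β₂ : ℝ) (h : E3) :
    ∃ B : H10 Ω →L[ℝ] H10 Ω →L[ℝ] ℝ, IsCoercive B ∧ ∀ u v, B u v = ∫ x in Ω,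
      inner ℝ (Matrix.toEuclideanLin (homogenized α₁ β₁ α₂ β₂ h) (weakGrad u x))
        (weakGrad v x) := by
  obtain ⟨C, hC⟩ := exists_norm_homogenized_le α₁ β₁ α₂ β₂ h
  obtain ⟨B, hB⟩ := exists_bilinearForm (Ω := Ω) (A := fun _ => homogenized α₁ β₁ α₂ β₂ h)
    (fun _ _ => measurable_const) (fun _ => hC)
  refine ⟨B, ⟨α₁ / 5, by positivity, fun v => ?_⟩, hB⟩
  rw [hB, mul_assoc, ← sq]
  exact coercive_bilinearForm (A := fun _ => homogenized α₁ β₁ α₂ β₂ h) hΩ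
    (fun _ _ => measurable_const) (fun _ => hC) hα₁.le
    (fun _ => coercive_homogenized hα₂ α₁ β₁ β₂ h) v

theorem abs_sub_le_of_abs_add_sub_le {a b c X Y : ℝ} (h1 : |a + b - c| ≤ X) (h2 : |b| ≤ Y) :
    |c - a| ≤ X + Y := by
  rw [abs_le] at h1 h2 ⊢
  constructor <;> linarith

/-- The equation with oscillating coefficients, tested with a fixed function, converges to the
homogenized equation. -/
theorem tendsto_homogenized_form {M : ℝ} (hM : 0 ≤ M) (hΩm : MeasurableSet Ω)
    (hΩ : ∀ x ∈ Ω, x 2 ∈ Set.Ioo (0 : ℝ) 1) (hΩM : ∀ x ∈ Ω, ‖planeProj x‖ ≤ M)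
    (hΩf : volume Ω ≠ ⊤) {α₁ β₁ α₂ β₂ : ℝ} {ε r α β : ℕ → ℝ} (hα₂ : 0 < α₂)
    (hε0 : ∀ n, 0 < ε n) (hr0 : ∀ n, 0 < r n) (hα0 : ∀ n, 0 < α n)
    (hε : Tendsto ε atTop (𝓝 0)) (hr : Tendsto r atTop (𝓝 0))
    (hεr : Tendsto (fun n => ε n ^ 2 * |Real.log (r n)|) atTop (𝓝 0))
    (hα : Tendsto (fun n => Real.pi * r n ^ 2 * α n) atTop (𝓝 α₂))
    (hβ : Tendsto (fun n => Real.pi * r n ^ 2 * β n) atTop (𝓝 β₂))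
    {f : HNeg1 Ω} {h : E3} {u : ℕ → H10 Ω} {K : ℝ} (hK : ∀ᶠ n in atTop, ‖u n‖ ≤ K)
    (hu : ∀ n, IsSolution Ω (conductivity Ω (ε n) (r n) α₁ β₁ (α n) (β n) h) f (u n))
    {φ : E3 → ℝ} (hφ : IsTestFunction Ω φ) :
    Tendsto (fun n => ∫ x in Ω, inner ℝ
      (Matrix.toEuclideanLin (homogenized α₁ β₁ α₂ β₂ h) (weakGrad (u n) x))
      (weakGrad (testPair hφ) x)) atTop (𝓝 (f (testPair hφ))) := by
  have hpi := Real.pi_pos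
  set t : ℕ → ℝ := fun n => Real.pi * r n ^ 2
  have ht : ∀ n, t n ≠ 0 := fun n => (mul_pos hpi (pow_pos (hr0 n) 2)).ne'
  -- By homogeneity this is the coefficient of the rescaled parameters `t n * α n` and `t n * β n`,
  -- which converge.
  set c : ℕ → ℝ := fun n => t n * fiberCoeff (α n) (β n) h
  have hc : Tendsto c atTop (𝓝 (fiberCoeff α₂ β₂ h)) :=
    (tendsto_fiberCoeff hα₂ hα hβ h).congr fun n => fiberCoeff_smul (ht n) _ _ _
  have hs : ∀ i, Tendsto (fun n => fiberSlope (α n) (β n) h i) atTop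
      (𝓝 (fiberSlope α₂ β₂ h i)) := fun i =>
    (tendsto_fiberSlope hα₂ hα hβ h i).congr fun n => fiberSlope_smul (ht n) _ _ _ _
  set S := |fiberSlope α₂ β₂ h 0| + |fiberSlope α₂ β₂ h 1| + 1
  have hS : ∀ i, ∀ᶠ n in atTop, |fiberSlope (α n) (β n) h i| ≤ S := fun i => by
    refine ((hs i).abs.eventually_lt_const ?_).mono fun n hn => hn.le
    fin_cases i
    · show |fiberSlope α₂ β₂ h 0| < S
      linarith [abs_nonneg (fiberSlope α₂ β₂ h 1)]
    · show |fiberSlope α₂ β₂ h 1| < S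
      linarith [abs_nonneg (fiberSlope α₂ β₂ h 0)]
  set P := |α₂| + |β₂| + 1
  -- Convergent sequences are eventually bounded by their limit plus one; the factor `π ≥ 1` is
  -- dropped.
  have hP : ∀ᶠ n in atTop, (|α n| + |β n|) * r n ^ 2 ≤ P := by
    filter_upwards [(hα.abs.add hβ.abs).eventually_lt_const (lt_add_one _)] with n hn
    rw [abs_mul _ (α n), abs_mul _ (β n), abs_of_pos (mul_pos hpi (pow_pos (hr0 n) 2)),
      ← mul_add] at hn
    refine le_trans ?_ hn.le
    have h1 : 0 ≤ (|α n| + |β n|) * r n ^ 2 := by positivity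
    calc (|α n| + |β n|) * r n ^ 2 ≤ Real.pi * ((|α n| + |β n|) * r n ^ 2) :=
          le_mul_of_one_le_left h1 (by linarith [Real.pi_gt_three])
      _ = _ := by ring
  obtain ⟨D, hD0, hD⟩ := exists_oscillating_test hM hΩm hΩ hΩM hΩf hφ α₁ β₁ α₂ β₂ h
    (S := S) (P := P) (by positivity) (by positivity)
  set η : ℕ → ℝ := fun n => ε n + r n + |c n - fiberCoeff α₂ β₂ h|
    + |c n| * (ε n * √(1 + |Real.log (r n)|))
  have hη : Tendsto η atTop (𝓝 0) := by
    have h1 := ((hε.add hr).add (hc.sub_const (fiberCoeff α₂ β₂ h)).abs).add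
      (hc.abs.mul (tendsto_mul_sqrt_one_add_log hε0 hε hεr))
    simpa using h1
  have hle : ∀ᶠ n in atTop, |(∫ x in Ω, inner ℝ
      (Matrix.toEuclideanLin (homogenized α₁ β₁ α₂ β₂ h) (weakGrad (u n) x))
      (weakGrad (testPair hφ) x)) - f (testPair hφ)|
      ≤ D * η n * K + ‖f‖ * (D * (ε n + r n)) := by
    filter_upwards [hS 0, hS 1, hP, hK, hε.eventually_le_const one_pos,
      hr.eventually_le_const (show (0 : ℝ) < 1 / 4 by norm_num)] with n h0 h1 h2 h3 h4 h5
    obtain ⟨w, hw, hwu⟩ := hD (ε n) (r n) (α n) (β n) (hε0 n) h4 (hr0 n) h5 (hα0 n) h2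
      (by intro i; fin_cases i; exacts [h0, h1])
    have h6 := hwu (u n)
    -- The equation turns the oscillating form into `f φ + f w`, and `f w` is small because `w`
    -- tends to zero in norm.
    rw [hu n (testPair hφ + w), map_add] at h6
    have hη0 : 0 ≤ η n := by
      have := (hε0 n).le
      have := (hr0 n).le
      positivity
    have h7 : |f w| ≤ ‖f‖ * (D * (ε n + r n)) :=
      (f.le_opNorm w).trans (mul_le_mul_of_nonneg_left hw (norm_nonneg f))
    have h8 : D * η n * ‖u n‖ ≤ D * η n * K := mul_le_mul_of_nonneg_left h3 (by positivity)
    exact abs_sub_le_of_abs_add_sub_le (h6.trans h8) h7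
  have hlim : Tendsto (fun n => D * η n * K + ‖f‖ * (D * (ε n + r n))) atTop (𝓝 0) := by
    simpa using ((hη.const_mul D).mul_const K).add (((hε.add hr).const_mul D).const_mul ‖f‖)
  rw [tendsto_iff_dist_tendsto_zero]
  exact squeeze_zero' (Eventually.of_forall fun n => dist_nonneg) hle hlim

end HallFibers

end

/-! ### The homogenization theorem. -/

set_option maxHeartbeats 1000000 in
theorem mainTheorem2
    (U : Set HallFibers.E2) (hU_open : IsOpen U) (hU_conn : IsConnected U)
    (hU_bdd : Bornology.IsBounded U) (hU_lip : HallFibers.HasLipschitzBoundary U)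
    (Ω : Set HallFibers.E3) (hΩ : Ω = HallFibers.cylinder U)
    (α₁ β₁ α₂ β₂ : ℝ) (ε r α₂n β₂n : ℕ → ℝ)
    (hα₁ : 0 < α₁) (hα₂ : 0 < α₂)
    (hε_pos : ∀ n, 0 < ε n) (hr_pos : ∀ n, 0 < r n) (hα₂n : ∀ n, 0 < α₂n n)
    (hε : Tendsto ε atTop (𝓝 0)) (hr : Tendsto r atTop (𝓝 0))
    (hεr : Tendsto (fun n => ε n ^ 2 * |Real.log (r n)|) atTop (𝓝 0))
    (hα : Tendsto (fun n => volume.real (HallFibers.cellFiber (r n)) * α₂n n) atTop (𝓝 α₂))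
    (hβ : Tendsto (fun n => volume.real (HallFibers.cellFiber (r n)) * β₂n n) atTop (𝓝 β₂)) :
    ∃ k : ℕ → ℕ, StrictMono k ∧
      ∀ (f : HallFibers.HNeg1 Ω) (h : HallFibers.E3),
        (∀ n, ∃! u : HallFibers.H10 Ω, HallFibers.IsSolution Ω
          (HallFibers.conductivity Ω (ε n) (r n) α₁ β₁ (α₂n n) (β₂n n) h) f u) ∧
        (∃! u : HallFibers.H10 Ω, HallFibers.IsSolution Ω
          (fun _ => HallFibers.homogenized α₁ β₁ α₂ β₂ h) f u) ∧
        ∀ (u : ℕ → HallFibers.H10 Ω) (uLim : HallFibers.H10 Ω),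
          (∀ n, HallFibers.IsSolution Ω
            (HallFibers.conductivity Ω (ε n) (r n) α₁ β₁ (α₂n n) (β₂n n) h) f (u n)) →
          HallFibers.IsSolution Ω (fun _ => HallFibers.homogenized α₁ β₁ α₂ β₂ h) f uLim →
          Tendsto (fun n => toWeakSpace ℝ (HallFibers.H10 Ω) (u (k n))) atTop
            (𝓝 (toWeakSpace ℝ (HallFibers.H10 Ω) uLim)) := by
  open HallFibers in
  have hpi := Real.pi_pos
  have hΩm : MeasurableSet Ω := hΩ ▸ (isOpen_cylinder hU_open).measurableSet
  have hΩf : volume Ω ≠ ⊤ := hΩ ▸ volume_cylinder_ne_top hU_open hU_bdd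
  have hΩ1 : ∀ x ∈ Ω, x 2 ∈ Set.Ioo (0 : ℝ) 1 := by
    rw [hΩ]
    exact fun x hx => hx.2
  obtain ⟨M, hM0, hM⟩ := hU_bdd.exists_pos_norm_le
  have hΩM : ∀ x ∈ Ω, ‖planeProj x‖ ≤ M := by
    rw [hΩ]
    exact fun x hx => hM _ hx.1
  have hvol : ∀ᶠ n in atTop, volume.real (cellFiber (r n)) = Real.pi * r n ^ 2 := by
    filter_upwards [hr.eventually_lt_const (show (0 : ℝ) < 1 / 2 by norm_num)] with n hn
    exact volume_real_cellFiber (hr_pos n) hn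
  replace hα : Tendsto (fun n => Real.pi * r n ^ 2 * α₂n n) atTop (𝓝 α₂) :=
    hα.congr' (hvol.mono fun n hn => by rw [hn])
  replace hβ : Tendsto (fun n => Real.pi * r n ^ 2 * β₂n n) atTop (𝓝 β₂) :=
    hβ.congr' (hvol.mono fun n hn => by rw [hn])
  -- The volume fraction times `α₁` tends to zero, while its product with the fiber conductivity has
  -- the positive limit `α₂`. Thus `α₁` becomes a uniform ellipticity constant, which gives the
  -- energy bound.
  have hlarge : ∀ᶠ n in atTop, α₁ ≤ α₂n n := by
    have h1 : Tendsto (fun n => Real.pi * r n ^ 2 * α₁) atTop (𝓝 0) := by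
      simpa using ((hr.pow 2).const_mul Real.pi).mul_const α₁
    filter_upwards [h1.eventually_lt hα hα₂] with n hn
    exact (lt_of_mul_lt_mul_left hn (by positivity)).le
  -- The limit is identified for the whole sequence, so no extraction is needed.
  refine ⟨id, strictMono_id, fun f h => ⟨fun n => ?_, ?_, fun u uLim hu hlim => ?_⟩⟩
  · obtain ⟨C, hC⟩ := exists_norm_conductivity_le Ω (ε n) (r n) α₁ β₁ (α₂n n) (β₂n n) h
    exact existsUnique_isSolution (A := conductivity Ω (ε n) (r n) α₁ β₁ (α₂n n) (β₂n n) h) hΩ1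
      (measurable_conductivity hΩm (hε_pos n) (r n) α₁ β₁ (α₂n n) (β₂n n) h) hC
      (lt_min hα₁ (hα₂n n)) (coercive_conductivity Ω (ε n) (r n) α₁ β₁ (α₂n n) (β₂n n) h) f
  · obtain ⟨C, hC⟩ := exists_norm_homogenized_le α₁ β₁ α₂ β₂ h
    exact existsUnique_isSolution (Ω := Ω) (A := fun _ => homogenized α₁ β₁ α₂ β₂ h) hΩ1
      (fun _ _ => measurable_const) (fun _ => hC) hα₁
      (fun _ => coercive_homogenized hα₂ α₁ β₁ β₂ h) f
  · obtain ⟨B, hBc, hB⟩ := exists_coercive_homogenized_form hΩ1 hα₁ hα₂ β₁ β₂ h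
    have hK : ∀ᶠ n in atTop, ‖u n‖ ≤ 5 / α₁ * ‖f‖ := by
      filter_upwards [hlarge] with n hn
      obtain ⟨C, hC⟩ := exists_norm_conductivity_le Ω (ε n) (r n) α₁ β₁ (α₂n n) (β₂n n) h
      refine norm_isSolution_le (A := conductivity Ω (ε n) (r n) α₁ β₁ (α₂n n) (β₂n n) h) hΩ1
        (measurable_conductivity hΩm (hε_pos n) (r n) α₁ β₁ (α₂n n) (β₂n n) h) hC hα₁
        (fun x ξ => ?_) (hu n)
      have h1 := coercive_conductivity Ω (ε n) (r n) α₁ β₁ (α₂n n) (β₂n n) h x ξ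
      rwa [min_eq_left hn] at h1
    refine tendsto_toWeakSpace_of_form hBc hK fun φ hφ => ?_
    -- The homogenized equation identifies the required limit with `f φ`, which is the limit
    -- supplied by the oscillating test functions.
    rw [hB, hlim (testPair hφ)]
    simp only [hB]
    exact tendsto_homogenized_form hM0.le hΩm hΩ1 hΩM hΩf hα₂ hε_pos hr_pos hα₂n hε hr hεr hα hβ
      hK hu hφ
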